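/- Let $M$ be a compact smooth Riemannian spin manifold of dimension $4$ with Levi-Civita connection $\nabla^{LC}$ and Riemann tensor $R(X,Y)Z=\nabla_X\nabla_YZ-\nabla_Y\nabla_XZ-\nabla_{[X,Y]}Z$, let $S\to M$ be the spinor bundle (a hermitian complex vector bundle of rank $4$) with Clifford multiplication $c$, normalised by $c(v)^2=-|v|^2$, with charge conjugation $J_M$ and with spin connection $\nabla^S$. Let $B\to M$ be a locally trivial $*$-algebra bundle with fibre $M_N(\mathbb C)$, equipped with a smooth family $\tau_x$ of faithful tracial states on its fibres, with the inner product $\langle s,s'\rangle=\tau(s^*s')$, and with a hermitian $*$-algebra connection $\nabla^B$, i.e. a hermitian connection with $\nabla^B(ss')=(\nabla^Bs)s'+s\nabla^Bs'$ and $(\nabla^Bs)^*=\nabla^B s^*$. On sections of $B\otimes S$ let $D_B=c\circ(\nabla^B\otimes1+1\otimes\nabla^S)$ and $J(s\otimes\psi)=s^*\otimes J_M\psi$. Let $a_j,b_j$ be finitely many smooth sections of $B$ such that $A=\sum_ja_j[D_B,b_j]$ is self-adjoint, and let $$D_A=D_B+A+JAJ^{-1}$$ be the fluctuated Dirac operator.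 Let $\mathbb A^{pert}$ be the one-form with values in $\mathrm{End}(B)$ given by $\mathbb A^{pert}_v s=[\,\sum_ja_j\nabla^B_vb_j\,,\,s\,]$, and let $F$ be the curvature of the connection $\nabla^B+\mathbb A^{pert}$ on $B$. Then $D_A^2$ is of Laplace type: in every local coordinate system and every smooth local frame of $B\otimes S$ it has the form $-g^{\mu\nu}\partial_\mu\partial_\nu+K^\mu\partial_\mu+L$ with smooth matrix-valued functions $K^\mu$, $L$. There are a unique connection $\nabla$ on $B\otimes S$ and a unique smooth bundle endomorphism $E$ with $$D_A^2=\nabla^*\nabla-E ,$$ where $\nabla^*\nabla=-\mathrm{tr}_g\nabla^2=-\sum_i(\nabla_{e_i}\nabla_{e_i}-\nabla_{\nabla^{LC}_{e_i}e_i})$ is the connection Laplacian; this connection $\nabla$ is hermitian. For every orthonormal basis $e_1,\dots,e_4$ of a tangent space, with $\gamma^\mu=c(e_\mu)$ and $\gamma_{ab}=\frac12[c(e_a),c(e_b)]$, $$E=-\tfrac14R\otimes1-\sum_{\mu<\nu}\gamma^\mu\gamma^\nu\otimes F_{\mu\nu},$$ where $R$ is the scalar curvature (positive on round spheres) and $F_{\mu\nu}=F(e_\mu,e_\nu)$,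 and the curvature $\Omega$ of $\nabla$ is $$\Omega(X,Y)=\tfrac14\sum_{a,b}\langle R(X,Y)e_a,e_b\rangle\,\gamma_{ab}\otimes1+1\otimes F(X,Y).$$ (The factors are written with the operator on $S$ first and the operator on $B$ second.) -/

import Mathlib

open scoped Manifold ContDiff Topology TensorProduct ComplexConjugate
open Bundle

namespace EYM

noncomputable section

/-! ### Smooth sections and smooth functions near a point -/

/-- The model space of a four-dimensional manifold. -/
abbrev E4 : Type := EuclideanSpace ℝ (Fin 4)

section Base

variable {M : Type*} [TopologicalSpace M] [ChartedSpace E4 M]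

/-- The function `f : M → ℂ` is smooth in a neighbourhood of `x₀`. -/
def SmoothFun (f : M → ℂ) (x₀ : M) : Prop :=
  ∀ᶠ x in 𝓝 x₀, ContMDiffAt (𝓡 4) 𝓘(ℝ, ℂ) ∞ f x

/-- The differential `df_x(v)` of a complex-valued function. -/
def dC (f : M → ℂ) (x : M) (v : TangentSpace (𝓡 4) x) : ℂ :=
  mvfderiv (𝓡 4) f x v

/-- The section `s` of the vector bundle `V` is smooth in a neighbourhood of `x₀`. -/
def SmoothSec (F : Type*) [NormedAddCommGroup F] [NormedSpace ℝ F] {V : M → Type*}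
    [TopologicalSpace (TotalSpace F V)] [∀ x, TopologicalSpace (V x)] [FiberBundle F V]
    (s : ∀ x, V x) (x₀ : M) : Prop :=
  ∀ᶠ x in 𝓝 x₀, ContMDiffAt (𝓡 4) ((𝓡 4).prod 𝓘(ℝ, F)) ∞
    (fun y => (TotalSpace.mk' F y (s y) : TotalSpace F V)) x

/-- The vector field `X` is smooth in a neighbourhood of `x₀`. -/
def SmoothVF [IsManifold (𝓡 4) ∞ M] (X : ∀ x : M, TangentSpace (𝓡 4) x) (x₀ : M) : Prop :=
  SmoothSec E4 (V := fun x : M => TangentSpace (𝓡 4) x) X x₀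

/-- A smooth extension of the tangent vector `v` to a vector field near its base point. -/
def extVF [IsManifold (𝓡 4) ∞ M] {x : M} (v : TangentSpace (𝓡 4) x) :
    ∀ y : M, TangentSpace (𝓡 4) y :=
  FiberBundle.extend E4 (E := fun y : M => TangentSpace (𝓡 4) y) v

/-- The curvature operator `R(X,Y)s = ∇_X ∇_Y s - ∇_Y ∇_X s - ∇_{[X,Y]} s` of a covariant
derivative, given as `cov s x v = (∇_v s)(x)`. -/
def curvOp {V : M → Type*} [∀ x, AddCommGroup (V x)]
    (cov : (∀ x, V x) → ∀ x, TangentSpace (𝓡 4) x → V x)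
    (X Y : ∀ x : M, TangentSpace (𝓡 4) x) (s : ∀ x, V x) (x : M) : V x :=
  cov (fun y => cov s y (Y y)) x (X x) - cov (fun y => cov s y (X y)) x (Y x)
    - cov s x (VectorField.mlieBracket (𝓡 4) X Y x)

/-- The curvature tensor at a point: `R_x(v,w)b`, computed by means of smooth extensions. -/
def curv [IsManifold (𝓡 4) ∞ M] (F : Type*) [NormedAddCommGroup F] {V : M → Type*}
    [∀ x, AddCommGroup (V x)] [TopologicalSpace (TotalSpace F V)] [∀ x, TopologicalSpace (V x)]
    [FiberBundle F V]
    (cov : (∀ x, V x) → ∀ x, TangentSpace (𝓡 4) x → V x)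
    {x : M} (v w : TangentSpace (𝓡 4) x) (b : V x) : V x :=
  curvOp cov (extVF v) (extVF w) (FiberBundle.extend F b) x

end Base

/-! ### Riemannian geometry of the base -/

section Riemannian

variable {M : Type*} [TopologicalSpace M] [ChartedSpace E4 M] [IsManifold (𝓡 4) ∞ M]
  [RiemannianBundle (fun x : M => TangentSpace (𝓡 4) x)]
  [IsContMDiffRiemannianBundle (𝓡 4) ∞ E4 (fun x : M => TangentSpace (𝓡 4) x)]

instance instFiniteDimensionalTangent (x : M) : FiniteDimensional ℝ (TangentSpace (𝓡 4) x) :=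
  inferInstanceAs (FiniteDimensional ℝ E4)

instance instMetricC1 :
    IsContMDiffRiemannianBundle (𝓡 4) 1 E4 (fun x : M => TangentSpace (𝓡 4) x) :=
  IsContMDiffRiemannianBundle.of_le (n := ∞) (by exact_mod_cast le_top)

/-- An orthonormal basis of the tangent space at `x`. -/
def onb (x : M) : OrthonormalBasis (Fin 4) ℝ (TangentSpace (𝓡 4) x) :=
  (stdOrthonormalBasis ℝ (TangentSpace (𝓡 4) x)).reindex
    (finCongr (by
      rw [show Module.finrank ℝ (TangentSpace (𝓡 4) x) = Module.finrank ℝ E4 from rfl]; simp))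

/-- The Levi-Civita connection: smooth, metric and torsion free. -/
structure IsLeviCivita
    (LC : CovariantDerivative (𝓡 4) E4 (fun x : M => TangentSpace (𝓡 4) x)) : Prop where
  smooth : CovariantDerivative.ContMDiffCovariantDerivative LC ∞
  metric : LC.IsMetricCompatible
  torsion : LC.torsion = 0

variable (LC : CovariantDerivative (𝓡 4) E4 (fun x : M => TangentSpace (𝓡 4) x))

/-- The Riemann tensor `R(v,w)u`. -/
def riem {x : M} (v w u : TangentSpace (𝓡 4) x) : TangentSpace (𝓡 4) x :=
  curv E4 (V := fun x : M => TangentSpace (𝓡 4) x) (fun s x v => LC s x v) v w u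

/-- The scalar curvature `∑ i j, ⟨R(e_i,e_j)e_j, e_i⟩` (positive on round spheres). -/
def scal (x : M) : ℝ :=
  ∑ i, ∑ j, inner ℝ (riem LC (onb x i) (onb x j) (onb x j)) (onb x i)

/-- The inverse metric `g^{μν} = g(dx^μ, dx^ν)` in the coordinates `φ`. -/
def invMetric (φ : OpenPartialHomeomorph M E4) (μ ν : Fin 4) (y : M) : ℝ :=
  ∑ i, mvfderiv (𝓡 4) (fun z => φ z μ) y (onb y i) * mvfderiv (𝓡 4) (fun z => φ z ν) y (onb y i)

/-- The partial derivative `∂f/∂x^μ` in the coordinates `φ`. -/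
def pderiv (φ : OpenPartialHomeomorph M E4) (μ : Fin 4) (f : M → ℂ) (y : M) : ℂ :=
  fderiv ℝ (fun z => f (φ.symm z)) (φ y) (EuclideanSpace.single μ (1 : ℝ))

end Riemannian

/-! ### The algebra bundle -/

section AlgebraBundle

variable {M : Type*} [TopologicalSpace M] [ChartedSpace E4 M] [IsManifold (𝓡 4) ∞ M]
  (FB : Type*) [NormedAddCommGroup FB] [NormedSpace ℂ FB]
  (B : M → Type*) [TopologicalSpace (TotalSpace FB B)]
  [∀ x, Ring (B x)] [∀ x, Algebra ℂ (B x)] [∀ x, StarRing (B x)] [∀ x, StarModule ℂ (B x)]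
  [∀ x, TopologicalSpace (B x)] [FiberBundle FB B]

/-- `B` is locally trivial as a `*`-algebra bundle with typical fibre `M_N(ℂ)`: near each point
there are `*`-isomorphisms `M_N(ℂ) ≅ B_x` depending smoothly on `x`. (All fibres being isomorphic,
the isomorphisms may be indexed by all of `M`; only those near `x₀` are constrained.) -/
def IsMatrixAlgebraBundle (N : ℕ) : Prop :=
  ∀ x₀ : M, ∃ Φ : ∀ x, Matrix (Fin N) (Fin N) ℂ ≃⋆ₐ[ℂ] B x,
    ∀ m, SmoothSec FB (fun x => Φ x m) x₀

/-- A smooth family of faithful tracial states on the fibres of `B`. -/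
structure TracialState where
  /-- the state on the fibre over `x` -/
  τ : ∀ x, B x →ₗ[ℂ] ℂ
  trace_comm : ∀ x (b b' : B x), τ x (b * b') = τ x (b' * b)
  map_one : ∀ x, τ x 1 = 1
  nonneg : ∀ x (b : B x), 0 ≤ (τ x (star b * b)).re ∧ (τ x (star b * b)).im = 0
  faithful : ∀ x (b : B x), τ x (star b * b) = 0 → b = 0
  smooth : ∀ (s : ∀ x, B x) (x₀ : M), SmoothSec FB s x₀ → SmoothFun (fun x => τ x (s x)) x₀

variable {FB B}

/-- The Hilbert–Schmidt inner product `⟨b, b'⟩ = τ(b^* b')` on a fibre, conjugate linear in the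
first variable. -/
def TracialState.hs (t : TracialState FB B) (x : M) : B x →ₗ⋆[ℂ] B x →ₗ[ℂ] ℂ :=
  LinearMap.mk₂'ₛₗ (starRingEnd ℂ) (RingHom.id ℂ) (fun b b' => t.τ x (star b * b'))
    (by intros; simp [add_mul]) (by intros; simp)
    (by intros; simp [mul_add]) (by intros; simp)

variable [VectorBundle ℝ FB B] [∀ x, IsTopologicalAddGroup (B x)]
  [∀ x, ContinuousSMul ℝ (B x)]

/-- `∇` is a hermitian `*`-algebra connection on `B`. -/
structure IsHermitianStarAlgebraConnection (t : TracialState FB B)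
    (nB : CovariantDerivative (𝓡 4) FB B) : Prop where
  smooth : CovariantDerivative.ContMDiffCovariantDerivative nB ∞
  complex : ∀ (s : ∀ x, B x) (x : M) (v : TangentSpace (𝓡 4) x), SmoothSec FB s x →
    nB (fun y => Complex.I • s y) x v = Complex.I • nB s x v
  mul : ∀ (s s' : ∀ x, B x) (x : M) (v : TangentSpace (𝓡 4) x),
    SmoothSec FB s x → SmoothSec FB s' x →
    nB (fun y => s y * s' y) x v = s x * nB s' x v + nB s x v * s' x
  star : ∀ (s : ∀ x, B x) (x : M) (v : TangentSpace (𝓡 4) x), SmoothSec FB s x →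
    nB (fun y => star (s y)) x v = star (nB s x v)
  hermitian : ∀ (s s' : ∀ x, B x) (x : M) (v : TangentSpace (𝓡 4) x),
    SmoothSec FB s x → SmoothSec FB s' x →
    dC (fun y => t.hs y (s y) (s' y)) x v = t.hs x (nB s x v) (s' x) + t.hs x (s x) (nB s' x v)

end AlgebraBundle

/-! ### The spinor bundle -/

section Spinor

variable {M : Type*} [TopologicalSpace M] [ChartedSpace E4 M] [IsManifold (𝓡 4) ∞ M]
  [RiemannianBundle (fun x : M => TangentSpace (𝓡 4) x)]
  [IsContMDiffRiemannianBundle (𝓡 4) ∞ E4 (fun x : M => TangentSpace (𝓡 4) x)]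
  (FS : Type*) [NormedAddCommGroup FS] [NormedSpace ℂ FS]
  (S : M → Type*) [TopologicalSpace (TotalSpace FS S)]
  [∀ x, NormedAddCommGroup (S x)] [∀ x, InnerProductSpace ℂ (S x)]
  [FiberBundle FS S]

/-- A spin structure on the oriented Riemannian four-manifold `M`, given by its spinor bundle: a
hermitian complex vector bundle `S` of rank four with Clifford multiplication `c` by tangent
vectors (normalised by `c(v)² = -|v|²`, so that `c(v)` is skew-hermitian), chirality operator `γ`
(it fixes the orientation) and charge conjugation `J` with the signs of KO-dimension four. -/
structure SpinorStructure where
  rank : Module.finrank ℂ FS = 4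
  inner_smooth : ∀ (ψ φ : ∀ x, S x) (x₀ : M), SmoothSec FS ψ x₀ → SmoothSec FS φ x₀ →
    SmoothFun (fun x => inner ℂ (ψ x) (φ x)) x₀
  /-- Clifford multiplication -/
  c : ∀ x : M, TangentSpace (𝓡 4) x →ₗ[ℝ] (S x →ₗ[ℂ] S x)
  c_sq : ∀ (x : M) (v : TangentSpace (𝓡 4) x) (ψ : S x),
    c x v (c x v ψ) = -((inner ℝ v v : ℝ) : ℂ) • ψ
  c_skew : ∀ (x : M) (v : TangentSpace (𝓡 4) x) (ψ φ : S x),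
    inner ℂ (c x v ψ) φ = -inner ℂ ψ (c x v φ)
  c_smooth : ∀ (X : ∀ x : M, TangentSpace (𝓡 4) x) (ψ : ∀ x, S x) (x₀ : M),
    SmoothVF X x₀ → SmoothSec FS ψ x₀ → SmoothSec FS (fun x => c x (X x) (ψ x)) x₀
  /-- chirality -/
  γ : ∀ x : M, S x →ₗ[ℂ] S x
  γ_sq : ∀ (x : M) (ψ : S x), γ x (γ x ψ) = ψ
  γ_selfAdjoint : ∀ (x : M) (ψ φ : S x), inner ℂ (γ x ψ) φ = inner ℂ ψ (γ x φ)
  γ_c : ∀ (x : M) (v : TangentSpace (𝓡 4) x) (ψ : S x), γ x (c x v ψ) = -c x v (γ x ψ)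
  γ_smooth : ∀ (ψ : ∀ x, S x) (x₀ : M), SmoothSec FS ψ x₀ → SmoothSec FS (fun x => γ x (ψ x)) x₀
  /-- charge conjugation -/
  J : ∀ x : M, S x ≃ₗ⋆[ℂ] S x
  J_sq : ∀ (x : M) (ψ : S x), J x (J x ψ) = -ψ
  J_antiunitary : ∀ (x : M) (ψ φ : S x), inner ℂ (J x ψ) (J x φ) = inner ℂ φ ψ
  J_c : ∀ (x : M) (v : TangentSpace (𝓡 4) x) (ψ : S x), J x (c x v ψ) = c x v (J x ψ)
  J_γ : ∀ (x : M) (ψ : S x), J x (γ x ψ) = γ x (J x ψ)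
  J_smooth : ∀ (ψ : ∀ x, S x) (x₀ : M), SmoothSec FS ψ x₀ → SmoothSec FS (fun x => J x (ψ x)) x₀

variable {FS S} [VectorBundle ℝ FS S]

/-- `∇^S` is the spin connection: the hermitian connection on `S` that is compatible with Clifford
multiplication and the Levi-Civita connection and commutes with charge conjugation. -/
structure IsSpinConnection (LC : CovariantDerivative (𝓡 4) E4 (fun x : M => TangentSpace (𝓡 4) x))
    (σ : SpinorStructure FS S) (nS : CovariantDerivative (𝓡 4) FS S) : Prop where
  smooth : CovariantDerivative.ContMDiffCovariantDerivative nS ∞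
  complex : ∀ (ψ : ∀ x, S x) (x : M) (v : TangentSpace (𝓡 4) x), SmoothSec FS ψ x →
    nS (fun y => Complex.I • ψ y) x v = Complex.I • nS ψ x v
  hermitian : ∀ (ψ φ : ∀ x, S x) (x : M) (v : TangentSpace (𝓡 4) x),
    SmoothSec FS ψ x → SmoothSec FS φ x →
    dC (fun y => inner ℂ (ψ y) (φ y)) x v
      = inner ℂ (nS ψ x v) (φ x) + inner ℂ (ψ x) (nS φ x v)
  clifford : ∀ (Y : ∀ x : M, TangentSpace (𝓡 4) x) (ψ : ∀ x, S x) (x : M)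
    (v : TangentSpace (𝓡 4) x), SmoothVF Y x → SmoothSec FS ψ x →
    nS (fun y => σ.c y (Y y) (ψ y)) x v = σ.c x (LC Y x v) (ψ x) + σ.c x (Y x) (nS ψ x v)
  real : ∀ (ψ : ∀ x, S x) (x : M) (v : TangentSpace (𝓡 4) x), SmoothSec FS ψ x →
    nS (fun y => σ.J y (ψ y)) x v = σ.J x (nS ψ x v)

end Spinor

/-! ### The tensor product bundle `B ⊗ S` -/

section Tensor

variable {M : Type*} [TopologicalSpace M] [ChartedSpace E4 M] [IsManifold (𝓡 4) ∞ M]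
  [RiemannianBundle (fun x : M => TangentSpace (𝓡 4) x)]
  [IsContMDiffRiemannianBundle (𝓡 4) ∞ E4 (fun x : M => TangentSpace (𝓡 4) x)]
  (FB : Type*) [NormedAddCommGroup FB] [NormedSpace ℂ FB]
  {B : M → Type*} [TopologicalSpace (TotalSpace FB B)]
  [∀ x, Ring (B x)] [∀ x, Algebra ℂ (B x)] [∀ x, StarRing (B x)] [∀ x, StarModule ℂ (B x)]
  [∀ x, TopologicalSpace (B x)] [FiberBundle FB B]
  (FS : Type*) [NormedAddCommGroup FS] [NormedSpace ℂ FS]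
  {S : M → Type*} [TopologicalSpace (TotalSpace FS S)]
  [∀ x, NormedAddCommGroup (S x)] [∀ x, InnerProductSpace ℂ (S x)]
  [FiberBundle FS S]

/-- A section of `B ⊗ S` is smooth near `x₀` if near `x₀` it is a finite sum of elementary tensors
of smooth sections of `B` and of `S`. -/
def SmoothTensor (ξ : ∀ x, B x ⊗[ℂ] S x) (x₀ : M) : Prop :=
  ∃ (n : ℕ) (s : Fin n → ∀ x, B x) (ψ : Fin n → ∀ x, S x),
    (∀ i, SmoothSec FB (s i) x₀) ∧ (∀ i, SmoothSec FS (ψ i) x₀) ∧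
    ∀ᶠ x in 𝓝 x₀, ξ x = ∑ i, s i x ⊗ₜ[ℂ] ψ i x

variable (B S) in
/-- A smooth connection on the complex vector bundle `B ⊗ S`; `toFun ξ x v` is `(∇_v ξ)(x)`.
Sections which are not smooth near the point in question are not constrained. -/
structure TensorConnection where
  /-- the covariant derivative as a function -/
  toFun : (∀ x, B x ⊗[ℂ] S x) → ∀ x : M, TangentSpace (𝓡 4) x →ₗ[ℝ] (B x ⊗[ℂ] S x)
  add : ∀ (ξ η : ∀ x, B x ⊗[ℂ] S x) (x : M), SmoothTensor FB FS ξ x → SmoothTensor FB FS η x →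
    toFun (fun y => ξ y + η y) x = toFun ξ x + toFun η x
  leibniz : ∀ (f : M → ℂ) (ξ : ∀ x, B x ⊗[ℂ] S x) (x : M) (v : TangentSpace (𝓡 4) x),
    SmoothFun f x → SmoothTensor FB FS ξ x →
    toFun (fun y => f y • ξ y) x v = f x • toFun ξ x v + dC f x v • ξ x
  smooth : ∀ (X : ∀ x : M, TangentSpace (𝓡 4) x) (ξ : ∀ x, B x ⊗[ℂ] S x) (x : M),
    SmoothVF X x → SmoothTensor FB FS ξ x → SmoothTensor FB FS (fun y => toFun ξ y (X y)) x

variable {FB FS}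

/-- The connection Laplacian `-tr_g ∇²ξ = -∑ i, (∇_{e_i} ∇_{e_i} ξ - ∇_{∇_{e_i} e_i} ξ)`, which is
`∇^*∇` for a hermitian connection. -/
def connLaplacian (LC : CovariantDerivative (𝓡 4) E4 (fun x : M => TangentSpace (𝓡 4) x))
    (n : TensorConnection FB B FS S) (ξ : ∀ x, B x ⊗[ℂ] S x) (x : M) : B x ⊗[ℂ] S x :=
  -∑ i, (n.toFun (fun y => n.toFun ξ y (extVF (onb x i) y)) x (onb x i)
    - n.toFun ξ x (LC (extVF (onb x i)) x (onb x i)))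

/-- The hermitian inner product on the fibres of `B ⊗ S`, with
`⟨b ⊗ ψ, b' ⊗ ψ'⟩ = ⟨b, b'⟩ ⟨ψ, ψ'⟩`. -/
def tensorInner (t : TracialState FB B) (x : M) :
    (B x ⊗[ℂ] S x) →ₗ⋆[ℂ] (B x ⊗[ℂ] S x) →ₗ[ℂ] ℂ :=
  (TensorProduct.lift <| TensorProduct.mapBilinear (.id ℂ) (B x) (S x) ℂ ℂ).compr₂
    (LinearMap.mul' ℂ ℂ) ∘ₛₗ TensorProduct.map (t.hs x) (innerₛₗ ℂ)

/-- `∇` is compatible with the hermitian metric of `B ⊗ S`. -/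
def TensorConnection.IsHermitian (t : TracialState FB B) (n : TensorConnection FB B FS S) : Prop :=
  ∀ (ξ η : ∀ x, B x ⊗[ℂ] S x) (x : M) (v : TangentSpace (𝓡 4) x),
    SmoothTensor FB FS ξ x → SmoothTensor FB FS η x →
    dC (fun y => tensorInner t y (ξ y) (η y)) x v
      = tensorInner t x (n.toFun ξ x v) (η x) + tensorInner t x (ξ x) (n.toFun η x v)

/-- Left multiplication by `b` on a fibre of `B ⊗ S`. -/
def leftMul {x : M} (b : B x) : (B x ⊗[ℂ] S x) →ₗ[ℂ] (B x ⊗[ℂ] S x) :=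
  TensorProduct.map (LinearMap.mulLeft ℂ b) LinearMap.id

/-- Clifford multiplication `1 ⊗ c(v)` on a fibre of `B ⊗ S`. -/
def cliff (σ : SpinorStructure FS S) {x : M} (v : TangentSpace (𝓡 4) x) :
    (B x ⊗[ℂ] S x) →ₗ[ℂ] (B x ⊗[ℂ] S x) :=
  TensorProduct.map LinearMap.id (σ.c x v)

/-- The real structure `J(b ⊗ ψ) = b^* ⊗ J_M ψ` on a fibre of `B ⊗ S`. -/
def realStr (σ : SpinorStructure FS S) (x : M) : (B x ⊗[ℂ] S x) ≃ₗ⋆[ℂ] (B x ⊗[ℂ] S x) :=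
  TensorProduct.congr (starLinearEquiv ℂ) (σ.J x)

section Dirac

variable [VectorBundle ℂ FB B] [VectorBundle ℝ FB B] [FiniteDimensional ℂ FB]
  [∀ x, IsTopologicalAddGroup (B x)] [∀ x, ContinuousSMul ℝ (B x)]
  [VectorBundle ℂ FS S] [VectorBundle ℝ FS S] [FiniteDimensional ℂ FS]

/-- The tensor product connection `∇^B ⊗ 1 + 1 ⊗ ∇^S` on `B ⊗ S`. To compute it at `x`, the section
`ξ` is expanded as `∑ ξ^{ka} b_k ⊗ ψ_a` in the local frames `b_k`, `ψ_a` of `B` and `S` that are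
defined by the preferred local trivializations at `x`. -/
def tensorNabla (nB : CovariantDerivative (𝓡 4) FB B) (nS : CovariantDerivative (𝓡 4) FS S)
    (ξ : ∀ x, B x ⊗[ℂ] S x) (x : M) (v : TangentSpace (𝓡 4) x) : B x ⊗[ℂ] S x :=
  let eB := trivializationAt FB B x
  let eS := trivializationAt FS S x
  let β := Module.finBasis ℂ FB
  let γ := Module.finBasis ℂ FS
  let b := fun k (y : M) => eB.symm y (β k)
  let ψ := fun a (y : M) => eS.symm y (γ a)
  let coeff := fun k a (y : M) => (β.tensorProduct γ).repr
    (TensorProduct.map (eB.linearMapAt ℂ y) (eS.linearMapAt ℂ y) (ξ y)) (k, a)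
  ∑ k, ∑ a, (dC (coeff k a) x v • (b k x ⊗ₜ[ℂ] ψ a x)
    + coeff k a x • (nB (b k) x v ⊗ₜ[ℂ] ψ a x + b k x ⊗ₜ[ℂ] nS (ψ a) x v))

variable (σ : SpinorStructure FS S)
  (nB : CovariantDerivative (𝓡 4) FB B) (nS : CovariantDerivative (𝓡 4) FS S)

/-- The twisted Dirac operator `D_B = c ∘ (∇^B ⊗ 1 + 1 ⊗ ∇^S)`. -/
def dirac (ξ : ∀ x, B x ⊗[ℂ] S x) (x : M) : B x ⊗[ℂ] S x :=
  ∑ i, cliff σ (onb x i) (tensorNabla nB nS ξ x (onb x i))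

variable {m : ℕ} (a b : Fin m → ∀ x, B x)

/-- The inner fluctuation `A = ∑ j, a_j [D_B, b_j]`, as an operator on sections. -/
def fluct (ξ : ∀ x, B x ⊗[ℂ] S x) (x : M) : B x ⊗[ℂ] S x :=
  ∑ j, leftMul (a j x) (dirac σ nB nS (fun y => leftMul (b j y) (ξ y)) x
    - leftMul (b j x) (dirac σ nB nS ξ x))

/-- The fluctuated Dirac operator `D_A = D_B + A + J A J⁻¹`. -/
def diracA (ξ : ∀ x, B x ⊗[ℂ] S x) (x : M) : B x ⊗[ℂ] S x :=
  dirac σ nB nS ξ x + fluct σ nB nS a b ξ x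
    + realStr σ x (fluct σ nB nS a b (fun y => (realStr σ y).symm (ξ y)) x)

/-- The `B`-valued one-form `∑ j, a_j ∇^B b_j`. -/
def pertForm (x : M) (v : TangentSpace (𝓡 4) x) : B x :=
  ∑ j, a j x * nB (b j) x v

/-- The connection `∇^B + 𝔸^pert` on `B`, where `𝔸^pert_v` is the commutator with
`∑ j, a_j ∇^B_v b_j`. -/
def nablaPert (s : ∀ x, B x) (x : M) (v : TangentSpace (𝓡 4) x) : B x :=
  nB s x v + (pertForm nB a b x v * s x - s x * pertForm nB a b x v)

end Dirac

/-- `Q` is an operator of Laplace type: in all coordinates `φ` and all smooth frames `f` of `B ⊗ S`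
on an open set `U` one has `Q = -g^{μν} ∂_μ ∂_ν + K^μ ∂_μ + L` with smooth matrix-valued functions
`K^μ`, `L`. (The frame is indexed by all points; only its values on `U` matter.) -/
def IsLaplaceType (FB FS : Type*) [NormedAddCommGroup FB] [NormedSpace ℂ FB]
    [TopologicalSpace (TotalSpace FB B)] [FiberBundle FB B]
    [NormedAddCommGroup FS] [NormedSpace ℂ FS]
    [TopologicalSpace (TotalSpace FS S)] [FiberBundle FS S]
    (Q : (∀ x, B x ⊗[ℂ] S x) → ∀ x : M, B x ⊗[ℂ] S x) : Prop :=
  ∀ (φ : OpenPartialHomeomorph M E4), φ ∈ IsManifold.maximalAtlas (𝓡 4) ∞ M →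
  ∀ (U : Set M), IsOpen U → U ⊆ φ.source →
  ∀ (r : ℕ) (f : ∀ x, Module.Basis (Fin r) ℂ (B x ⊗[ℂ] S x)),
    (∀ k, ∀ x ∈ U, SmoothTensor FB FS (fun y => f y k) x) →
  ∃ (K : Fin 4 → M → Matrix (Fin r) (Fin r) ℂ) (L : M → Matrix (Fin r) (Fin r) ℂ),
    (∀ μ k l, ∀ x ∈ U, SmoothFun (fun y => K μ y k l) x) ∧
    (∀ k l, ∀ x ∈ U, SmoothFun (fun y => L y k l) x) ∧
    ∀ ξ : (∀ x, B x ⊗[ℂ] S x), (∀ x, SmoothTensor FB FS ξ x) → ∀ x ∈ U, ∀ k,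
      (f x).repr (Q ξ x) k =
        -∑ μ, ∑ ν, (invMetric φ μ ν x : ℂ) *
            pderiv φ μ (pderiv φ ν (fun y => (f y).repr (ξ y) k)) x
          + ∑ μ, ∑ l, K μ x k l * pderiv φ μ (fun y => (f y).repr (ξ y) l) x
          + ∑ l, L x k l * (f x).repr (ξ x) l

end Tensor

end

end EYM

open scoped Manifold ContDiff Topology TensorProduct ComplexConjugate
open Bundle

namespace EYM

noncomputable section

set_option linter.unusedSectionVars false

/-! ### Shortcuts for instance search -/

-- By the Leibniz rule `[D_B, b] = ∑ c(e_i) ∇_{e_i} b`, so `A` is Clifford multiplication combined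
-- with left multiplication by the one-form `θ = ∑ a_j ∇^B b_j` (`fluct_eq`). Since `J_M` commutes
-- with `c`, conjugation by `J` replaces left multiplication by `θ` with right multiplication by
-- `θ^*` (`realStr_conj`). Self-adjointness of `A`, skewness of `c`, the Clifford relations and
-- faithfulness of `τ` force `θ^* = -θ` (`star_pertForm`). The two fluctuation terms therefore add
-- up to the commutator with `θ`, and `D_A` is the Dirac operator of the tensor product of `∇^B +
-- 𝔸^pert` with `∇^S` (`diracA_eq_diracOp`). This connection is hermitian because `τ` is a trace,
-- and Clifford multiplication is parallel for it.
--
-- For every connection with parallel Clifford multiplication the Weitzenböck formula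
-- `diracOp_sq_eq` gives `D² = ∇^*∇ + ½ ∑ c(e_i) c(e_j) Ω(e_i, e_j)`. Here `Ω` is the sum of `F` and
-- of the curvature of `∇^S`. The latter is `¼ ∑ ⟨R e_i, e_j⟩ c(e_i) c(e_j)` (`spin_curv_eq`): the
-- difference of the two sides commutes with the irreducible Clifford action, hence is a scalar by
-- `clifford_schur`; the scalar is real because `J_M` is parallel and imaginary because `∇^S` is
-- hermitian, so it vanishes. The Bianchi identity contracts the spin part to a quarter of the
-- scalar curvature (`clifford_contract`), and `F` contributes the sum over `i < j`. This determines
-- `E` and `Ω`.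
--
-- The product rule `∇^*∇(fξ) = f ∇^*∇ξ + (Δf) ξ - 2 ∑ df(e_i) ∇_{e_i} ξ` (`lap_csmul`) settles the
-- rest. Applied to two decompositions of the same operator it isolates the connection, whence
-- uniqueness (`conn_eq_of_lap_sub_eq`). Applied to a local frame it gives the Laplace form: `K^μ`
-- is the matrix of the commutator `[∇^*∇, x^μ]` and `L` that of the operator itself, both in the
-- frame (`isLaplaceType_lap`).
--
-- Sections are arbitrary functions and connections are controlled only on germs of smooth sections.
-- The calculus is therefore developed once for an abstract `IsLocalConn`, and then used for
-- functions, `TM`, `B`, `S` and `B ⊗ S`. Most curvature identities are instances of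
-- `curvOp_pairing` for a suitable parallel pairing.

local instance instTopologicalSpaceTangent {M : Type*} [TopologicalSpace M] [ChartedSpace E4 M]
    [IsManifold (𝓡 4) ∞ M] :
    TopologicalSpace (TotalSpace E4 fun x : M => TangentSpace (𝓡 4) x) := inferInstance

local instance instModuleRealTensor {R W : Type*} [Ring R] [Algebra ℂ R] [NormedAddCommGroup W]
    [InnerProductSpace ℂ W] : Module ℝ (R ⊗[ℂ] W) := Module.complexToReal _

/-! ### Connections and smooth sections -/

section LocalConnections

variable {M : Type*} [TopologicalSpace M] [ChartedSpace E4 M]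

/-- The function `f` with values in a normed space is smooth near `x₀`. -/
def SmFun {G : Type*} [NormedAddCommGroup G] [NormedSpace ℝ G] (f : M → G) (x₀ : M) : Prop :=
  ∀ᶠ x in 𝓝 x₀, ContMDiffAt (𝓡 4) 𝓘(ℝ, G) ∞ f x

section Functions

variable {G : Type*} [NormedAddCommGroup G] [NormedSpace ℝ G]
  {G' : Type*} [NormedAddCommGroup G'] [NormedSpace ℝ G'] {f g : M → G} {x : M}

lemma SmFun.contMDiffAt (h : SmFun f x) : ContMDiffAt (𝓡 4) 𝓘(ℝ, G) ∞ f x := h.self_of_nhds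

lemma SmFun.mdiff (h : SmFun f x) : MDifferentiableAt (𝓡 4) 𝓘(ℝ, G) f x :=
  h.contMDiffAt.mdifferentiableAt (by simp)

lemma SmFun.eventually (h : SmFun f x) : ∀ᶠ y in 𝓝 x, SmFun f y :=
  Filter.Eventually.eventually_nhds h

lemma SmFun.congr (h : SmFun f x) (hg : ∀ᶠ y in 𝓝 x, g y = f y) : SmFun g x := by
  filter_upwards [h, hg.eventually_nhds] with y hy hy'
  exact hy.congr_of_eventuallyEq hy'

lemma SmFun.const (c : G) : SmFun (fun _ : M => c) x :=
  Filter.Eventually.of_forall fun _ => contMDiffAt_const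

lemma SmFun.add (hf : SmFun f x) (hg : SmFun g x) : SmFun (fun y => f y + g y) x := by
  filter_upwards [hf, hg] with y h1 h2 using h1.add h2

lemma SmFun.clm (L : G →L[ℝ] G') (hf : SmFun f x) : SmFun (fun y => L (f y)) x := by
  filter_upwards [hf] with y h1
  exact (L.contDiff.contMDiff.contMDiffAt).comp y h1

lemma SmFun.smul {u : M → ℝ} (hu : SmFun u x) (hf : SmFun f x) :
    SmFun (fun y => u y • f y) x := by
  filter_upwards [hu, hf] with y h1 h2 using h1.smul h2

lemma SmFun.bilin {f' : M → G'} {G'' : Type*} [NormedAddCommGroup G''] [NormedSpace ℝ G'']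
    (L : G →L[ℝ] G' →L[ℝ] G'') (hf : SmFun f x) (hf' : SmFun f' x) :
    SmFun (fun y => L (f y) (f' y)) x := by
  filter_upwards [hf, hf'] with y h1 h2
  exact ContMDiffAt.clm_apply ((L.contDiff.contMDiff.contMDiffAt).comp y h1) h2

lemma SmFun.hasMFDerivAt (hf : SmFun f x) :
    HasMFDerivAt (𝓡 4) 𝓘(ℝ, G) f x (mfderiv (𝓡 4) 𝓘(ℝ, G) f x) :=
  hf.mdiff.hasMFDerivAt

lemma mvfderiv_clm (L : G →L[ℝ] G') (hf : SmFun f x) (v : TangentSpace (𝓡 4) x) :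
    mvfderiv (𝓡 4) (fun y => L (f y)) x v = L (mvfderiv (𝓡 4) f x v) := by
  have h := (L.hasMFDerivAt (x := f x)).comp x hf.hasMFDerivAt
  exact congrArg (fun A => A v) h.mfderiv

lemma mvfderiv_congr (hf : SmFun f x) (hg : ∀ᶠ y in 𝓝 x, g y = f y) :
    mvfderiv (𝓡 4) g x = mvfderiv (𝓡 4) f x :=
  (hf.hasMFDerivAt.congr_of_eventuallyEq hg).mfderiv

lemma mvfderiv_bilin {f' : M → G'} {G'' : Type*} [NormedAddCommGroup G''] [NormedSpace ℝ G'']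
    (L : G →L[ℝ] G' →L[ℝ] G'') (hf : SmFun f x) (hf' : SmFun f' x) (v : TangentSpace (𝓡 4) x) :
    mvfderiv (𝓡 4) (fun y => L (f y) (f' y)) x v
      = L (mvfderiv (𝓡 4) f x v) (f' x) + L (f x) (mvfderiv (𝓡 4) f' x v) := by
  have hB : HasMFDerivAt 𝓘(ℝ, G × G') 𝓘(ℝ, G'') (fun p : G × G' => L p.1 p.2) (f x, f' x)
      (L.isBoundedBilinearMap.deriv (f x, f' x)) :=
    (L.isBoundedBilinearMap.hasFDerivAt (f x, f' x)).hasMFDerivAt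
  have hp : HasMFDerivAt (𝓡 4) 𝓘(ℝ, G × G') (fun y => (f y, f' y)) x
      ((mfderiv (𝓡 4) 𝓘(ℝ, G) f x).prod (mfderiv (𝓡 4) 𝓘(ℝ, G') f' x)) :=
    ⟨hf.hasMFDerivAt.1.prodMk hf'.hasMFDerivAt.1, hf.hasMFDerivAt.2.prodMk hf'.hasMFDerivAt.2⟩
  have h := hB.comp x hp
  refine (congrArg (fun A => A v) h.mfderiv).trans ?_
  exact add_comm _ _

end Functions

/-! ### Connections on families of vector spaces -/

section Abstract

variable {V : M → Type*} [∀ x, AddCommGroup (V x)] [∀ x, Module ℝ (V x)]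

/-- `Sm s x` is a sheaf-like notion of smoothness of the section `s` near `x`. -/
structure IsSmoothClass (Sm : (∀ x, V x) → M → Prop) : Prop where
  eventually : ∀ {s x}, Sm s x → ∀ᶠ y in 𝓝 x, Sm s y
  congr : ∀ {s t x}, Sm s x → (∀ᶠ y in 𝓝 x, t y = s y) → Sm t x
  zero : ∀ x, Sm (fun _ => 0) x
  add : ∀ {s t x}, Sm s x → Sm t x → Sm (fun y => s y + t y) x
  smul : ∀ {f : M → ℝ} {s x}, SmFun f x → Sm s x → Sm (fun y => f y • s y) x

namespace IsSmoothClass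

variable {Sm : (∀ x, V x) → M → Prop} (h : IsSmoothClass Sm) {x : M}
include h

lemma const_smul {s} (c : ℝ) (hs : Sm s x) : Sm (fun y => c • s y) x :=
  h.smul (SmFun.const c) hs

lemma neg {s} (hs : Sm s x) : Sm (fun y => -s y) x := by
  simpa using h.const_smul (-1) hs

lemma sub {s t} (hs : Sm s x) (ht : Sm t x) : Sm (fun y => s y - t y) x := by
  simpa [sub_eq_add_neg] using h.add hs (h.neg ht)

lemma sum {ι : Type*} (I : Finset ι) {s : ι → ∀ x, V x} (hs : ∀ i ∈ I, Sm (s i) x) :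
    Sm (fun y => ∑ i ∈ I, s i y) x := by
  classical
  induction I using Finset.induction_on with
  | empty => simpa using h.zero x
  | insert a I ha ih =>
    simp only [Finset.sum_insert ha]
    exact h.add (hs a (by simp)) (ih fun i hi => hs i (by simp [hi]))

end IsSmoothClass

variable [IsManifold (𝓡 4) ∞ M]

/-- `cov` is a connection on the smooth sections described by `Sm`. -/
structure IsLocalConn (Sm : (∀ x, V x) → M → Prop)
    (cov : (∀ x, V x) → ∀ x : M, TangentSpace (𝓡 4) x → V x) : Prop extends
    IsSmoothClass Sm where
  cov_congr : ∀ {s t x}, Sm s x → (∀ᶠ y in 𝓝 x, t y = s y) → ∀ v, cov t x v = cov s x v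
  cov_add : ∀ {s t x}, Sm s x → Sm t x → ∀ v,
    cov (fun y => s y + t y) x v = cov s x v + cov t x v
  cov_smul : ∀ {f : M → ℝ} {s x}, SmFun f x → Sm s x → ∀ v,
    cov (fun y => f y • s y) x v = f x • cov s x v + mvfderiv (𝓡 4) f x v • s x
  cov_vadd : ∀ s x v w, cov s x (v + w) = cov s x v + cov s x w
  cov_vsmul : ∀ s x (c : ℝ) v, cov s x (c • v) = c • cov s x v
  cov_smooth : ∀ {X : ∀ x : M, TangentSpace (𝓡 4) x} {s x}, SmoothVF X x → Sm s x →
    Sm (fun y => cov s y (X y)) x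

namespace IsLocalConn

variable {Sm : (∀ x, V x) → M → Prop}
  {cov : (∀ x, V x) → ∀ x : M, TangentSpace (𝓡 4) x → V x} (h : IsLocalConn Sm cov) {x : M}
include h

lemma cov_zero (v : TangentSpace (𝓡 4) x) : cov (fun _ => 0) x v = 0 := by
  have := h.cov_add (h.zero x) (h.zero x) v
  simpa using this

lemma cov_const_smul {s} (c : ℝ) (hs : Sm s x) (v : TangentSpace (𝓡 4) x) :
    cov (fun y => c • s y) x v = c • cov s x v := by
  rw [h.cov_smul (SmFun.const c) hs]
  simp [mvfderiv_const]

lemma cov_neg {s} (hs : Sm s x) (v : TangentSpace (𝓡 4) x) :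
    cov (fun y => -s y) x v = -cov s x v := by
  simpa using h.cov_const_smul (-1) hs v

lemma cov_sub {s t} (hs : Sm s x) (ht : Sm t x) (v : TangentSpace (𝓡 4) x) :
    cov (fun y => s y - t y) x v = cov s x v - cov t x v := by
  simpa [sub_eq_add_neg, h.cov_neg ht] using h.cov_add hs (h.neg ht) v

lemma cov_sum {ι : Type*} (I : Finset ι) {s : ι → ∀ x, V x} (hs : ∀ i ∈ I, Sm (s i) x)
    (v : TangentSpace (𝓡 4) x) :
    cov (fun y => ∑ i ∈ I, s i y) x v = ∑ i ∈ I, cov (s i) x v := by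
  classical
  induction I using Finset.induction_on with
  | empty => simpa using h.cov_zero v
  | insert a I ha ih =>
    simp only [Finset.sum_insert ha]
    rw [h.cov_add (hs a (by simp)) (h.sum I fun i hi => hs i (by simp [hi])),
      ih fun i hi => hs i (by simp [hi])]

lemma cov_vneg (s) (v : TangentSpace (𝓡 4) x) : cov s x (-v) = -cov s x v := by
  simpa using h.cov_vsmul s x (-1) v

lemma cov_vsub (s) (v w : TangentSpace (𝓡 4) x) : cov s x (v - w) = cov s x v - cov s x w := by
  rw [sub_eq_add_neg, h.cov_vadd, h.cov_vneg, sub_eq_add_neg]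

/-- The covariant derivative of a section as a linear map of the direction. -/
def covL (s : ∀ x, V x) (x : M) : TangentSpace (𝓡 4) x →ₗ[ℝ] V x where
  toFun v := cov s x v
  map_add' := h.cov_vadd s x
  map_smul' c v := h.cov_vsmul s x c v

@[simp] lemma covL_apply (s : ∀ x, V x) (v : TangentSpace (𝓡 4) x) :
    h.covL s x v = cov s x v := rfl

/-- Smooth sections may be differentiated at nearby points. -/
lemma cov_eventually_congr {s t} (hs : Sm s x) (hst : ∀ᶠ y in 𝓝 x, t y = s y) :
    ∀ᶠ y in 𝓝 x, ∀ v, cov t y v = cov s y v := by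
  filter_upwards [h.eventually hs, hst.eventually_nhds] with y h1 h2 v
  exact h.cov_congr h1 h2 v

lemma curvOp_congr {s t} {X Y : ∀ x : M, TangentSpace (𝓡 4) x} (hX : SmoothVF X x)
    (hY : SmoothVF Y x) (hs : Sm s x) (hst : ∀ᶠ y in 𝓝 x, t y = s y) :
    curvOp cov X Y t x = curvOp cov X Y s x := by
  have := h.cov_eventually_congr hs hst
  simp only [curvOp]
  rw [h.cov_congr (h.cov_smooth hY hs) (this.mono fun y hy => hy _),
    h.cov_congr (h.cov_smooth hX hs) (this.mono fun y hy => hy _), h.cov_congr hs hst]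

lemma curvOp_add {s t} {X Y : ∀ x : M, TangentSpace (𝓡 4) x} (hX : SmoothVF X x)
    (hY : SmoothVF Y x) (hs : Sm s x) (ht : Sm t x) :
    curvOp cov X Y (fun y => s y + t y) x = curvOp cov X Y s x + curvOp cov X Y t x := by
  have key : ∀ᶠ y in 𝓝 x, ∀ v, cov (fun y => s y + t y) y v = cov s y v + cov t y v := by
    filter_upwards [h.eventually hs, h.eventually ht] with y h1 h2 v using h.cov_add h1 h2 v
  have e : ∀ {Z W : ∀ x : M, TangentSpace (𝓡 4) x}, SmoothVF Z x →
      cov (fun y => cov (fun y => s y + t y) y (Z y)) x (W x) =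
      cov (fun y => cov s y (Z y)) x (W x) + cov (fun y => cov t y (Z y)) x (W x) := by
    intro Z W hZ
    rw [← h.cov_add (h.cov_smooth hZ hs) (h.cov_smooth hZ ht)]
    exact h.cov_congr (h.add (h.cov_smooth hZ hs) (h.cov_smooth hZ ht))
      (key.mono fun y hy => hy _) _
  simp only [curvOp]
  rw [e hX, e hY, h.cov_add hs ht]
  abel

end IsLocalConn

/-! ### Curvature as a derivation of parallel pairings -/

section Pairing

variable {V₁ V₂ V₃ : M → Type*} [∀ x, AddCommGroup (V₁ x)] [∀ x, Module ℝ (V₁ x)]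
  [∀ x, AddCommGroup (V₂ x)] [∀ x, Module ℝ (V₂ x)]
  [∀ x, AddCommGroup (V₃ x)] [∀ x, Module ℝ (V₃ x)]
  {Sm₁ : (∀ x, V₁ x) → M → Prop} {Sm₂ : (∀ x, V₂ x) → M → Prop} {Sm₃ : (∀ x, V₃ x) → M → Prop}
  {cov₁ : (∀ x, V₁ x) → ∀ x : M, TangentSpace (𝓡 4) x → V₁ x}
  {cov₂ : (∀ x, V₂ x) → ∀ x : M, TangentSpace (𝓡 4) x → V₂ x}
  {cov₃ : (∀ x, V₃ x) → ∀ x : M, TangentSpace (𝓡 4) x → V₃ x}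

/-- Curvature operators are derivations with respect to parallel pairings. -/
lemma curvOp_pairing (h₁ : IsLocalConn Sm₁ cov₁) (h₂ : IsLocalConn Sm₂ cov₂)
    (h₃ : IsLocalConn Sm₃ cov₃) (β : ∀ x, V₁ x → V₂ x → V₃ x)
    (addl : ∀ x a a' b, β x (a + a') b = β x a b + β x a' b)
    (addr : ∀ x a b b', β x a (b + b') = β x a b + β x a b')
    (hsm : ∀ {s t x}, Sm₁ s x → Sm₂ t x → Sm₃ (fun y => β y (s y) (t y)) x)
    (hβ : ∀ {s t x}, Sm₁ s x → Sm₂ t x → ∀ v, cov₃ (fun y => β y (s y) (t y)) x v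
      = β x (cov₁ s x v) (t x) + β x (s x) (cov₂ t x v))
    {s t} {x : M} {X Y : ∀ x : M, TangentSpace (𝓡 4) x} (hX : SmoothVF X x) (hY : SmoothVF Y x)
    (hs : Sm₁ s x) (ht : Sm₂ t x) :
    curvOp cov₃ X Y (fun y => β y (s y) (t y)) x
      = β x (curvOp cov₁ X Y s x) (t x) + β x (s x) (curvOp cov₂ X Y t x) := by
  have subl : ∀ x a a' b, β x (a - a') b = β x a b - β x a' b := fun x a a' b =>
    eq_sub_of_add_eq (by rw [← addl, sub_add_cancel])
  have subr : ∀ x a b b', β x a (b - b') = β x a b - β x a b' := fun x a b b' =>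
    eq_sub_of_add_eq (by rw [← addr, sub_add_cancel])
  -- The two mixed terms are exchanged when `Z` and `W` are, so they cancel in the
  -- antisymmetrisation that defines the curvature.
  have key : ∀ {Z W : ∀ x : M, TangentSpace (𝓡 4) x}, SmoothVF Z x →
      cov₃ (fun y => cov₃ (fun y => β y (s y) (t y)) y (Z y)) x (W x) =
      (β x (cov₁ (fun y => cov₁ s y (Z y)) x (W x)) (t x)
        + β x (cov₁ s x (Z x)) (cov₂ t x (W x)))
      + (β x (cov₁ s x (W x)) (cov₂ t x (Z x))
        + β x (s x) (cov₂ (fun y => cov₂ t y (Z y)) x (W x))) := by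
    intro Z W hZ
    have a1 := h₁.cov_smooth hZ hs
    have a2 := h₂.cov_smooth hZ ht
    rw [← hβ a1 ht, ← hβ hs a2, ← h₃.cov_add (hsm a1 ht) (hsm hs a2)]
    refine h₃.cov_congr (h₃.add (hsm a1 ht) (hsm hs a2)) ?_ _
    filter_upwards [h₁.eventually hs, h₂.eventually ht] with y b1 b2 using hβ b1 b2 _
  simp only [curvOp]
  rw [key hX, key hY, hβ hs ht]
  simp only [subl, subr]
  abel

end Pairing

end Abstract

end LocalConnections

/-! ### Functions and sections of vector bundles -/

section Bundles

variable {M : Type*} [TopologicalSpace M] [ChartedSpace E4 M] [IsManifold (𝓡 4) ∞ M]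

/-- Functions are sections of a trivial bundle with the trivial connection. This makes scalar
multiplication and metrics into parallel pairings to which `curvOp_pairing` applies. -/
lemma isLocalConn_mvfderiv (G : Type*) [NormedAddCommGroup G] [NormedSpace ℝ G] :
    IsLocalConn (M := M) (V := fun _ => G) SmFun (fun f x v => mvfderiv (𝓡 4) f x v) where
  eventually h := h.eventually
  congr h h' := h.congr h'
  zero x := SmFun.const 0
  add h h' := h.add h'
  smul h h' := h.smul h'
  cov_congr h h' v := by rw [mvfderiv_congr h h']
  cov_add h h' v := by
    rw [mvfderiv_fun_add h.mdiff h'.mdiff]; rfl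
  cov_smul h h' v := by
    rw [mvfderiv_fun_smul h.mdiff h'.mdiff]; simp
  cov_vadd s x v w := map_add _ v w
  cov_vsmul s x c v := map_smul _ c v
  cov_smooth {X f x} hX hf := by
    obtain ⟨U, hU, hUo, hxU⟩ := eventually_nhds_iff.1 hf
    have h1 : ContMDiffOn (𝓡 4) 𝓘(ℝ, G) ∞ f U := fun y hy => (hU y hy).contMDiffWithinAt
    -- The derivative of `f` along `X` is the fibre component of the tangent map of `f` composed
    -- with the smooth section `X`.
    have h2 := h1.contMDiffOn_tangentMapWithin (m := ∞) (by simp) hUo.uniqueMDiffOn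
    filter_upwards [hX, hUo.mem_nhds hxU] with y hy hyU
    have h3 := ((h2 _ (show (⟨y, X y⟩ : TangentBundle (𝓡 4) M) ∈ _ from hyU)).contMDiffAt
      ((hUo.preimage (FiberBundle.continuous_proj _ _)).mem_nhds hyU)).comp y hy
    have h4 := (contMDiff_snd_tangentBundle_modelSpace G 𝓘(ℝ, G) (n := ∞)).contMDiffAt.comp y h3
    refine h4.congr_of_eventuallyEq ?_
    filter_upwards [hUo.mem_nhds hyU] with z hz
    simp only [Function.comp, tangentMapWithin, mfderivWithin_of_isOpen hUo hz]
    rfl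

variable {F : Type*} [NormedAddCommGroup F] [NormedSpace ℝ F] {V : M → Type*}
  [TopologicalSpace (TotalSpace F V)] [∀ x, AddCommGroup (V x)] [∀ x, Module ℝ (V x)]
  [∀ x, TopologicalSpace (V x)] [FiberBundle F V] [VectorBundle ℝ F V] {x : M}

lemma SmoothSec.mdiff {s : ∀ x, V x} (h : SmoothSec F s x) :
    MDifferentiableAt (𝓡 4) ((𝓡 4).prod 𝓘(ℝ, F)) (fun y => (TotalSpace.mk' F y (s y))) x :=
  h.self_of_nhds.mdifferentiableAt (by simp)

lemma SmoothSec.extend [ContMDiffVectorBundle ∞ F V (𝓡 4)] (b : V x) :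
    SmoothSec F (FiberBundle.extend F b : ∀ y, V y) x := by
  obtain ⟨U, hU, h⟩ := FiberBundle.exists_contMDiffOn_extend (𝓡 4) F b (k := ∞)
  filter_upwards [eventually_mem_nhds_iff.2 hU] with y hy
  exact (h y (mem_of_mem_nhds hy)).contMDiffAt hy

lemma isSmoothClass_smoothSec : IsSmoothClass (SmoothSec F (V := V)) where
  eventually h := Filter.Eventually.eventually_nhds h
  congr h h' := by
    filter_upwards [h, h'.eventually_nhds] with y hy hy'
    refine hy.congr_of_eventuallyEq ?_
    filter_upwards [hy'] with z hz
    rw [hz]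
  zero x := Filter.Eventually.of_forall fun y => (contMDiff_zeroSection ℝ V).contMDiffAt
  add h h' := by
    filter_upwards [h, h'] with y hy hy' using hy.add_section hy'
  smul h h' := by
    filter_upwards [h, h'] with y hy hy' using hy.smul_section hy'

lemma exists_bump [T2Space M] {U : Set M} (hU : U ∈ 𝓝 x) :
    ∃ χ : M → ℝ, ContMDiff (𝓡 4) 𝓘(ℝ, ℝ) ∞ χ ∧ (∀ᶠ y in 𝓝 x, χ y = 1) ∧ tsupport χ ⊆ U := by
  obtain ⟨f, -, hf⟩ := (SmoothBumpFunction.nhds_basis_tsupport (I := 𝓡 4) x).mem_iff.1 hU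
  exact ⟨f, f.contMDiff, f.eventuallyEq_one, hf⟩

/-- A section that is smooth near a point agrees near that point with a globally smooth one. -/
lemma SmoothSec.exists_global [T2Space M] {s : ∀ x, V x} (h : SmoothSec F s x) :
    ∃ t : ∀ x, V x, (∀ y, SmoothSec F t y) ∧ ∀ᶠ y in 𝓝 x, t y = s y := by
  obtain ⟨U, hU, hUo, hxU⟩ := eventually_nhds_iff.1 h
  obtain ⟨χ, hχ, h1, hχU⟩ := exists_bump (hUo.mem_nhds hxU)
  have h2 := ContMDiffOn.smul_section_of_tsupport (F := F) (V := V) (s := s) hχ.contMDiffOn hUo hχU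
    fun y hy => (hU y hy).contMDiffWithinAt
  refine ⟨fun y => χ y • s y, fun y => Filter.Eventually.of_forall fun z => h2 z, ?_⟩
  filter_upwards [h1] with y hy
  simp [hy]

/-- The smoothness hypothesis on `n` is used on globally smooth sections. Locality of `n` lets a
germ be replaced by a global section, obtained with a bump function. -/
lemma isLocalConn_covariantDerivative [T2Space M] [∀ x, IsTopologicalAddGroup (V x)]
    [∀ x, ContinuousSMul ℝ (V x)] {n : CovariantDerivative (𝓡 4) F V}
    (hn : CovariantDerivative.ContMDiffCovariantDerivative n ∞) :
    IsLocalConn (SmoothSec F (V := V)) (fun s x v => n s x v) := by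
  have hcongr : ∀ {s t : ∀ x, V x} {x}, SmoothSec F s x → (∀ᶠ y in 𝓝 x, t y = s y) →
      n t x = n s x := by
    intro s t x hs hst
    exact n.isCovariantDerivativeOn.congr_of_eventuallyEq
      (isSmoothClass_smoothSec.congr hs hst).mdiff hs.mdiff (Filter.univ_mem) hst
  refine ⟨isSmoothClass_smoothSec, ?_, ?_, ?_, ?_, ?_, ?_⟩
  · intro s t x hs hst v
    rw [hcongr hs hst]
  · intro s t x hs ht v
    exact congrArg (fun A => A v) (n.isCovariantDerivativeOn.add hs.mdiff ht.mdiff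
      (Set.mem_univ x))
  · intro f s x hf hs v
    exact congrArg (fun A => A v) (n.isCovariantDerivativeOn.leibniz hs.mdiff hf.mdiff
      (Set.mem_univ x))
  · intro s x v w
    exact map_add _ v w
  · intro s x c v
    exact map_smul _ c v
  · intro X s x hX hs
    obtain ⟨t, ht, hts⟩ := hs.exists_global
    have h1 := hn.contMDiff.contMDiff (σ := t) (fun y _ => by
      simpa using (ht y).self_of_nhds.contMDiffWithinAt)
    have h2 : SmoothSec F (fun y => n t y (X y)) x := by
      filter_upwards [hX] with y hy
      exact ((h1 y (Set.mem_univ y)).contMDiffAt Filter.univ_mem).clm_bundle_apply hy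
    refine isSmoothClass_smoothSec.congr h2 ?_
    filter_upwards [hts.eventually_nhds] with y hy
    rw [hcongr (ht y) (hy.mono fun z hz => hz.symm)]

/-- An operation on smooth sections that is local, additive and linear over smooth functions
depends on the value at a single point only. -/
lemma tensorial_eq [FiniteDimensional ℝ F] [ContMDiffVectorBundle ∞ F V (𝓡 4)]
    {A : Type*} [AddCommGroup A] [Module ℝ A] (Φ : (∀ x, V x) → A)
    (hloc : ∀ {s t : ∀ x, V x}, SmoothSec F s x → (∀ᶠ y in 𝓝 x, t y = s y) → Φ t = Φ s)
    (hadd : ∀ {s t : ∀ x, V x}, SmoothSec F s x → SmoothSec F t x →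
      Φ (fun y => s y + t y) = Φ s + Φ t)
    (hsmul : ∀ {f : M → ℝ} {s : ∀ x, V x}, SmFun f x → SmoothSec F s x →
      Φ (fun y => f y • s y) = f x • Φ s)
    {s t : ∀ x, V x} (hs : SmoothSec F s x) (ht : SmoothSec F t x) (hst : s x = t x) :
    Φ s = Φ t := by
  have : ContMDiffVectorBundle 1 F V (𝓡 4) := ContMDiffVectorBundle.of_le (n := ∞) (by simp)
  let e := trivializationAt F V x
  have x_mem : x ∈ e.baseSet := FiberBundle.mem_baseSet_trivializationAt F V x
  let b := Module.finBasis ℝ F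
  let c := e.localFrameCoeff (𝓡 4) b
  have hb : ∀ i, SmoothSec F (e.localFrame b i) x := fun i => by
    filter_upwards [e.open_baseSet.mem_nhds x_mem] with y hy
    exact contMDiffAt_localFrame_of_mem ∞ _ b i hy
  have hc : ∀ {s : ∀ x, V x}, SmoothSec F s x → ∀ i, SmFun (fun y => c i y (s y)) x := by
    intro s hs i
    filter_upwards [hs, e.open_baseSet.mem_nhds x_mem] with y hy hy'
    exact contMDiffAt_localFrameCoeff b hy' hy i
  have hC := isSmoothClass_smoothSec (M := M) (F := F) (V := V)
  have hzero : Φ (fun _ => 0) = 0 := by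
    have := hadd (hC.zero x) (hC.zero x)
    simpa using this
  have hsum : ∀ (I : Finset (Fin (Module.finrank ℝ F))) {s : ∀ x, V x}, SmoothSec F s x →
      Φ (fun y => ∑ i ∈ I, c i y (s y) • e.localFrame b i y)
        = ∑ i ∈ I, c i x (s x) • Φ (e.localFrame b i) := by
    intro I s hs
    classical
    induction I using Finset.induction_on with
    | empty => simpa using hzero
    | insert a I ha ih =>
      simp only [Finset.sum_insert ha]
      rw [hadd (hC.smul (hc hs a) (hb a)) (hC.sum I fun i _ => hC.smul (hc hs i) (hb i)), ih,
        hsmul (hc hs a) (hb a)]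
  -- Expansion in a local frame shows that the values of the coefficients at `x` determine
  -- everything.
  have key : ∀ {s : ∀ x, V x}, SmoothSec F s x →
      Φ s = ∑ i, c i x (s x) • Φ (e.localFrame b i) := by
    intro s hs
    rw [← hsum Finset.univ hs]
    exact (hloc hs ((e.eventually_eq_localFrame_sum_coeff_smul b x_mem (s := s)).mono
      fun y hy => hy.symm)).symm
  rw [key hs, key ht, hst]

end Bundles

/-! ### Curvature and second covariant derivatives -/

section Curvature

variable {M : Type*} [TopologicalSpace M] [ChartedSpace E4 M] [IsManifold (𝓡 4) ∞ M]

open VectorField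

lemma SmoothVF.contMDiffAt {X : ∀ x : M, TangentSpace (𝓡 4) x} {x : M} (h : SmoothVF X x) :
    ContMDiffAt (𝓡 4) ((𝓡 4).prod 𝓘(ℝ, E4)) ∞
      (fun y => (TotalSpace.mk' E4 y (X y) : TangentBundle (𝓡 4) M)) x :=
  h.self_of_nhds

lemma smoothVF_extVF {x : M} (v : TangentSpace (𝓡 4) x) : SmoothVF (extVF v) x :=
  SmoothSec.extend v

@[simp] lemma extVF_self {x : M} (v : TangentSpace (𝓡 4) x) : extVF v x = v :=
  FiberBundle.extend_apply_self ..

lemma isSmoothClass_smoothVF : IsSmoothClass (SmoothVF (M := M)) := isSmoothClass_smoothSec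

lemma natCast_le_infty (n : ℕ) : (n : WithTop ℕ∞) ≤ ∞ :=
  WithTop.coe_le_coe.2 (le_top : (n : ℕ∞) ≤ ⊤)

lemma isManifold_natCast (n : ℕ) : IsManifold (𝓡 4) (minSmoothness ℝ n) M := by
  rw [minSmoothness_of_isRCLikeNormedField]
  exact IsManifold.of_le (natCast_le_infty n)

lemma SmoothVF.mlieBracket {X Y : ∀ x : M, TangentSpace (𝓡 4) x} {x : M} (hX : SmoothVF X x)
    (hY : SmoothVF Y x) : SmoothVF (mlieBracket (𝓡 4) X Y) x := by
  have : IsManifold (𝓡 4) (((⊤ : ℕ∞) : WithTop ℕ∞) + 1) M := by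
    simpa using ‹IsManifold (𝓡 4) ∞ M›
  have : IsManifold (𝓡 4) (minSmoothness ℝ 2) M := isManifold_natCast 2
  filter_upwards [hX, hY] with y h1 h2
  exact ContMDiffAt.mlieBracket_vectorField (m := ⊤) (n := ⊤) h1 h2 (by simp)

lemma leibniz_mlieBracket {X Y Z : ∀ x : M, TangentSpace (𝓡 4) x} {x : M} (hX : SmoothVF X x)
    (hY : SmoothVF Y x) (hZ : SmoothVF Z x) :
    mlieBracket (𝓡 4) X (mlieBracket (𝓡 4) Y Z) x
      = mlieBracket (𝓡 4) (mlieBracket (𝓡 4) X Y) Z x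
        + mlieBracket (𝓡 4) Y (mlieBracket (𝓡 4) X Z) x := by
  have h2 : minSmoothness ℝ 2 ≤ ∞ := by
    rw [minSmoothness_of_isRCLikeNormedField]
    exact natCast_le_infty 2
  have : IsManifold (𝓡 4) (minSmoothness ℝ 3) M := isManifold_natCast 3
  exact leibniz_identity_mlieBracket_apply (hX.contMDiffAt.of_le h2) (hY.contMDiffAt.of_le h2)
    (hZ.contMDiffAt.of_le h2)

lemma mlieBracket_fun_smul {X Y : ∀ x : M, TangentSpace (𝓡 4) x} {f : M → ℝ} {x : M}
    (hf : SmFun f x) (hY : SmoothVF Y x) :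
    mlieBracket (𝓡 4) X (fun y => f y • Y y) x
      = mvfderiv (𝓡 4) f x (X x) • Y x + f x • mlieBracket (𝓡 4) X Y x :=
  mlieBracket_smul_right hf.mdiff hY.mdiff

/-- The bracket of vector fields is tied to its action on functions by the Jacobi identity.
Subtracting `f` times the identity for `X, Y, Z` from the one for `X, Y, fZ` leaves `(XYf - YXf -
[X,Y]f) Z = 0`, and `Z` is chosen nonzero at `x`. -/
lemma curvOp_mvfderiv_real {X Y : ∀ x : M, TangentSpace (𝓡 4) x} {f : M → ℝ} {x : M}
    (hX : SmoothVF X x) (hY : SmoothVF Y x) (hf : SmFun f x) :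
    curvOp (V := fun _ => ℝ) (fun f x v => mvfderiv (𝓡 4) f x v) X Y f x = 0 := by
  have hF := isLocalConn_mvfderiv (M := M) ℝ
  have hV := isSmoothClass_smoothVF (M := M)
  obtain ⟨z, hz⟩ : ∃ z : TangentSpace (𝓡 4) x, z ≠ 0 :=
    ⟨(EuclideanSpace.single 0 1 : E4), fun h => by
      have := congrArg (fun v : E4 => v 0) (show (EuclideanSpace.single 0 1 : E4) = 0 from h)
      simp at this⟩
  set Z := extVF z with hZdef
  have hZ : SmoothVF Z x := smoothVF_extVF z
  have expand : ∀ {A B : ∀ x : M, TangentSpace (𝓡 4) x}, SmoothVF A x → SmoothVF B x →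
      mlieBracket (𝓡 4) B (mlieBracket (𝓡 4) A (fun y => f y • Z y)) x
        = (mvfderiv (𝓡 4) (fun y => mvfderiv (𝓡 4) f y (A y)) x (B x) • Z x
          + mvfderiv (𝓡 4) f x (A x) • mlieBracket (𝓡 4) B Z x)
          + (mvfderiv (𝓡 4) f x (B x) • mlieBracket (𝓡 4) A Z x
          + f x • mlieBracket (𝓡 4) B (mlieBracket (𝓡 4) A Z) x) := by
    intro A B hA hB
    have e1 : mlieBracket (𝓡 4) A (fun y => f y • Z y) =ᶠ[𝓝 x]
        (fun y => mvfderiv (𝓡 4) f y (A y) • Z y) + (fun y => f y • mlieBracket (𝓡 4) A Z y) := by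
      filter_upwards [hf.eventually, hV.eventually hZ] with y h1 h2
      exact mlieBracket_fun_smul h1 h2
    have h1 : SmFun (fun y => mvfderiv (𝓡 4) f y (A y)) x := hF.cov_smooth hA hf
    have h2 : SmoothVF (mlieBracket (𝓡 4) A Z) x := hA.mlieBracket hZ
    rw [Filter.EventuallyEq.mlieBracket_vectorField_eq (Filter.EventuallyEq.refl _ B) e1,
      mlieBracket_add_right (hV.smul h1 hZ).mdiff (hV.smul hf h2).mdiff,
      mlieBracket_fun_smul h1 hZ, mlieBracket_fun_smul hf h2]
  have hJ := leibniz_mlieBracket hX hY (hV.smul hf hZ)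
  rw [expand hY hX, expand hX hY, mlieBracket_fun_smul hf hZ, leibniz_mlieBracket hX hY hZ] at hJ
  have hc : curvOp (V := fun _ => ℝ) (fun f x v => mvfderiv (𝓡 4) f x v) X Y f x • z = 0 := by
    have hzx : Z x = z := extVF_self z
    rw [hzx] at hJ
    simp only [curvOp]
    rw [← sub_eq_zero] at hJ
    rw [← hJ]
    module
  exact (smul_eq_zero.1 hc).resolve_right hz

/-- The trivial connection is flat. -/
lemma curvOp_mvfderiv {G : Type*} [NormedAddCommGroup G] [NormedSpace ℝ G]
    {X Y : ∀ x : M, TangentSpace (𝓡 4) x} {f : M → G} {x : M}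
    (hX : SmoothVF X x) (hY : SmoothVF Y x) (hf : SmFun f x) :
    curvOp (V := fun _ => G) (fun f x v => mvfderiv (𝓡 4) f x v) X Y f x = 0 := by
  -- Real continuous functionals separate the points of `G`, which reduces the claim to real-valued
  -- functions.
  refine SeparatingDual.eq_zero_of_forall_dual_eq_zero (R := ℝ) fun L => ?_
  rw [← curvOp_mvfderiv_real hX hY (hf.clm L)]
  have hF := isLocalConn_mvfderiv (M := M) G
  have key : ∀ {A B : ∀ x : M, TangentSpace (𝓡 4) x}, SmoothVF A x →
      mvfderiv (𝓡 4) (fun y => mvfderiv (𝓡 4) (fun y => L (f y)) y (A y)) x (B x)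
        = L (mvfderiv (𝓡 4) (fun y => mvfderiv (𝓡 4) f y (A y)) x (B x)) := by
    intro A B hA
    have h1 : SmFun (fun y => mvfderiv (𝓡 4) f y (A y)) x := hF.cov_smooth hA hf
    rw [← mvfderiv_clm L h1, mvfderiv_congr (h1.clm L)]
    filter_upwards [hf.eventually] with y hy
    exact mvfderiv_clm L hy _
  simp only [curvOp]
  rw [key hX, key hY, mvfderiv_clm L hf]
  simp

variable [RiemannianBundle (fun x : M => TangentSpace (𝓡 4) x)]
  [IsContMDiffRiemannianBundle (𝓡 4) ∞ E4 (fun x : M => TangentSpace (𝓡 4) x)]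

/-- Smooth vector fields form a Riemannian bundle with smooth inner products. -/
lemma SmoothVF.inner {X Y : ∀ x : M, TangentSpace (𝓡 4) x} {x : M} (hX : SmoothVF X x)
    (hY : SmoothVF Y x) : SmFun (fun y => inner ℝ (X y) (Y y)) x := by
  filter_upwards [hX, hY] with y h1 h2
  exact ContMDiffAt.inner_bundle h1 h2

variable [T2Space M] {LC : CovariantDerivative (𝓡 4) E4 (fun x : M => TangentSpace (𝓡 4) x)}
  (hLC : IsLeviCivita LC)
include hLC

namespace IsLeviCivita

lemma isLocalConn : IsLocalConn (SmoothVF (M := M)) (fun s x v => LC s x v) :=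
  isLocalConn_covariantDerivative hLC.smooth

lemma bracket {X Y : ∀ x : M, TangentSpace (𝓡 4) x} {x : M} (hX : SmoothVF X x)
    (hY : SmoothVF Y x) : mlieBracket (𝓡 4) X Y x = LC Y x (X x) - LC X x (Y x) :=
  ((LC.torsion_eq_zero_iff.1 hLC.torsion) hX.mdiff hY.mdiff).symm

lemma mvfderiv_inner {X Y : ∀ x : M, TangentSpace (𝓡 4) x} {x : M} (hX : SmoothVF X x)
    (hY : SmoothVF Y x) (v : TangentSpace (𝓡 4) x) :
    mvfderiv (𝓡 4) (fun y => inner ℝ (X y) (Y y)) x v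
      = inner ℝ (LC X x v) (Y x) + inner ℝ (X x) (LC Y x v) := by
  have := CovariantDerivative.IsMetricCompatible.mvfderiv_inner_eq hLC.metric (extVF v)
    hX.mdiff hY.mdiff
  simpa using this

end IsLeviCivita

variable {V : M → Type*} [∀ x, AddCommGroup (V x)] [∀ x, Module ℝ (V x)]
  {Sm : (∀ x, V x) → M → Prop} {cov : (∀ x, V x) → ∀ x : M, TangentSpace (𝓡 4) x → V x}
  (h : IsLocalConn Sm cov) {x : M}
include h

/-- `∇_v ∇_Y s - ∇_{∇_v Y} s` depends only on the value of `Y` at the point. -/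
lemma secondCov_eq {s : ∀ x, V x} (hs : Sm s x) {Y Z : ∀ x : M, TangentSpace (𝓡 4) x}
    (hY : SmoothVF Y x) (hZ : SmoothVF Z x) (hYZ : Y x = Z x) (v : TangentSpace (𝓡 4) x) :
    cov (fun y => cov s y (Y y)) x v - cov s x (LC Y x v)
      = cov (fun y => cov s y (Z y)) x v - cov s x (LC Z x v) := by
  have hL := hLC.isLocalConn
  refine tensorial_eq (F := E4) (V := fun x : M => TangentSpace (𝓡 4) x) (x := x)
    (fun Y => cov (fun y => cov s y (Y y)) x v - cov s x (LC Y x v)) ?_ ?_ ?_ hY hZ hYZ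
  · intro Y Z hY hZY
    have h1 := h.cov_smooth hY hs
    rw [hL.cov_congr hY hZY, h.cov_congr h1]
    filter_upwards [hZY] with y hy
    rw [hy]
  · intro Y Z hY hZ
    have e1 := h.cov_smooth hY hs
    have e2 := h.cov_smooth hZ hs
    simp only [h.cov_vadd]
    rw [hL.cov_add hY hZ, h.cov_add e1 e2, h.cov_vadd]
    abel
  -- Both terms produce `v(f) ∇_Y s`, and these cancel; hence the expression is linear over
  -- functions in `Y`.
  · intro f Y hf hY
    have e1 := h.cov_smooth hY hs
    simp only [h.cov_vsmul]
    rw [hL.cov_smul hf hY, h.cov_smul hf e1, h.cov_vadd, h.cov_vsmul, h.cov_vsmul]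
    module

/-- The second covariant derivative `∇²_{v,w} s` at a point. -/
def secondCov (s : ∀ x, V x) (hs : Sm s x) :
    TangentSpace (𝓡 4) x →ₗ[ℝ] TangentSpace (𝓡 4) x →ₗ[ℝ] V x :=
  LinearMap.mk₂ ℝ
    (fun v w => cov (fun y => cov s y (extVF w y)) x v - cov s x (LC (extVF w) x v))
    (by
      intro v v' w
      simp only [map_add, h.cov_vadd]
      abel)
    (by
      intro c v w
      simp only [map_smul, h.cov_vsmul, smul_sub])
    (by
      intro v w w'
      have h1 := smoothVF_extVF w
      have h2 := smoothVF_extVF w'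
      -- The extension of `w + w'` need not be the sum of the extensions, but the two agree at `x`,
      -- which is all that matters.
      rw [secondCov_eq hLC h hs (smoothVF_extVF (w + w'))
        (isSmoothClass_smoothVF.add h1 h2) (by simp)]
      simp only [h.cov_vadd]
      rw [hLC.isLocalConn.cov_add h1 h2, h.cov_add (h.cov_smooth h1 hs) (h.cov_smooth h2 hs),
        h.cov_vadd]
      abel)
    (by
      intro c v w
      have h1 := smoothVF_extVF w
      rw [secondCov_eq hLC h hs (smoothVF_extVF (c • w))
        (isSmoothClass_smoothVF.const_smul c h1) (by simp)]
      simp only [h.cov_vsmul]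
      rw [hLC.isLocalConn.cov_const_smul c h1, h.cov_const_smul c (h.cov_smooth h1 hs),
        h.cov_vsmul, smul_sub])

lemma secondCov_apply {s : ∀ x, V x} (hs : Sm s x) (v w : TangentSpace (𝓡 4) x) :
    secondCov hLC h s hs v w
      = cov (fun y => cov s y (extVF w y)) x v - cov s x (LC (extVF w) x v) := rfl

lemma secondCov_vf {s : ∀ x, V x} (hs : Sm s x) (v : TangentSpace (𝓡 4) x)
    {Y : ∀ x : M, TangentSpace (𝓡 4) x} (hY : SmoothVF Y x) :
    secondCov hLC h s hs v (Y x)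
      = cov (fun y => cov s y (Y y)) x v - cov s x (LC Y x v) :=
  secondCov_eq hLC h hs (smoothVF_extVF _) hY (by simp) v

/-- Since the torsion vanishes, `[X,Y] = ∇_X Y - ∇_Y X`, so the bracket term of the curvature
supplies exactly the corrections in the two second covariant derivatives. In particular the
curvature depends on `X` and `Y` only through their values at the point. -/
lemma curvOp_eq_secondCov {s : ∀ x, V x} (hs : Sm s x) {X Y : ∀ x : M, TangentSpace (𝓡 4) x}
    (hX : SmoothVF X x) (hY : SmoothVF Y x) :
    curvOp cov X Y s x
      = secondCov hLC h s hs (X x) (Y x) - secondCov hLC h s hs (Y x) (X x) := by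
  rw [secondCov_vf hLC h hs _ hY, secondCov_vf hLC h hs _ hX]
  simp only [curvOp]
  rw [hLC.bracket hX hY, h.cov_vsub]
  abel

lemma secondCov_add {s t : ∀ x, V x} (hs : Sm s x) (ht : Sm t x) (v w : TangentSpace (𝓡 4) x) :
    secondCov hLC h (fun y => s y + t y) (h.add hs ht) v w
      = secondCov hLC h s hs v w + secondCov hLC h t ht v w := by
  simp only [secondCov_apply]
  have e1 := h.cov_smooth (smoothVF_extVF w) hs
  have e2 := h.cov_smooth (smoothVF_extVF w) ht
  rw [h.cov_congr (h.add e1 e2), h.cov_add e1 e2, h.cov_add hs ht]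
  · abel
  · filter_upwards [h.eventually hs, h.eventually ht] with y h1 h2 using h.cov_add h1 h2 _

end Curvature

/-! ### The curvature tensor -/

section CurvatureTensor

variable {M : Type*} [TopologicalSpace M] [ChartedSpace E4 M] [IsManifold (𝓡 4) ∞ M]
  [RiemannianBundle (fun x : M => TangentSpace (𝓡 4) x)]
  [IsContMDiffRiemannianBundle (𝓡 4) ∞ E4 (fun x : M => TangentSpace (𝓡 4) x)]
  [T2Space M] {LC : CovariantDerivative (𝓡 4) E4 (fun x : M => TangentSpace (𝓡 4) x)}
  (hLC : IsLeviCivita LC)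

open VectorField

/-! ### Tensoriality of the curvature on a vector bundle -/

section VectorBundle

variable {F : Type*} [NormedAddCommGroup F] [NormedSpace ℝ F] [FiniteDimensional ℝ F]
  {V : M → Type*} [TopologicalSpace (TotalSpace F V)] [∀ x, AddCommGroup (V x)]
  [∀ x, Module ℝ (V x)] [∀ x, TopologicalSpace (V x)] [FiberBundle F V] [VectorBundle ℝ F V]
  [ContMDiffVectorBundle ∞ F V (𝓡 4)]
  {cov : (∀ x, V x) → ∀ x : M, TangentSpace (𝓡 4) x → V x}
  (h : IsLocalConn (SmoothSec F (V := V)) cov) {x : M}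
include h

/-- Scalar multiplication is a parallel pairing of the trivial line bundle with `V`, and the trivial
connection is flat. -/
lemma curvOp_smul {X Y : ∀ x : M, TangentSpace (𝓡 4) x} (hX : SmoothVF X x) (hY : SmoothVF Y x)
    {f : M → ℝ} {s : ∀ x, V x} (hf : SmFun f x) (hs : SmoothSec F s x) :
    curvOp cov X Y (fun y => f y • s y) x = f x • curvOp cov X Y s x := by
  have := curvOp_pairing (isLocalConn_mvfderiv (M := M) ℝ) h h (fun x (c : ℝ) (b : V x) => c • b)
    (fun x a a' b => add_smul a a' b) (fun x a b b' => smul_add a b b')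
    (fun h1 h2 => h.smul h1 h2) (fun h1 h2 v => by rw [h.cov_smul h1 h2, add_comm]) hX hY hf hs
  rw [this, curvOp_mvfderiv hX hY hf, zero_smul, zero_add]

lemma curvOp_tensorial {X Y : ∀ x : M, TangentSpace (𝓡 4) x} (hX : SmoothVF X x)
    (hY : SmoothVF Y x) {s t : ∀ x, V x} (hs : SmoothSec F s x) (ht : SmoothSec F t x)
    (hst : s x = t x) : curvOp cov X Y s x = curvOp cov X Y t x :=
  tensorial_eq (fun s => curvOp cov X Y s x) (fun hs hst => h.curvOp_congr hX hY hs hst)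
    (fun hs ht => h.curvOp_add hX hY hs ht) (fun hf hs => curvOp_smul h hX hY hf hs) hs ht hst

include hLC

/-- Linearity over functions handles the section, and the expression through `secondCov` handles the
vector fields. This is what frees `curv` from the extensions used to define it. -/
lemma curvOp_eq_curv {X Y : ∀ x : M, TangentSpace (𝓡 4) x} (hX : SmoothVF X x)
    (hY : SmoothVF Y x) {s : ∀ x, V x} (hs : SmoothSec F s x) :
    curvOp cov X Y s x = curv F cov (X x) (Y x) (s x) := by
  rw [curv, curvOp_tensorial h hX hY hs (SmoothSec.extend (s x)) (by simp),
    curvOp_eq_secondCov hLC h (SmoothSec.extend (s x)) hX hY,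
    curvOp_eq_secondCov hLC h (SmoothSec.extend (s x)) (smoothVF_extVF (X x))
      (smoothVF_extVF (Y x))]
  simp

/-- The curvature tensor as a trilinear map. -/
def curvForm (x : M) :
    TangentSpace (𝓡 4) x →ₗ[ℝ] TangentSpace (𝓡 4) x →ₗ[ℝ] V x →ₗ[ℝ] V x :=
  LinearMap.mk₂ ℝ
    (fun v w =>
      { toFun := fun b => curv F cov v w b
        map_add' := fun b b' => by
          have hb : SmoothSec F (FiberBundle.extend F b : ∀ y, V y) x := SmoothSec.extend b
          have hb' : SmoothSec F (FiberBundle.extend F b' : ∀ y, V y) x := SmoothSec.extend b'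
          have := curvOp_eq_curv hLC h (smoothVF_extVF v) (smoothVF_extVF w) (h.add hb hb')
          simp only [extVF_self, FiberBundle.extend_apply_self] at this
          rw [← this, h.curvOp_add (smoothVF_extVF v) (smoothVF_extVF w) hb hb']
          rfl
        map_smul' := fun c b => by
          have hb : SmoothSec F (FiberBundle.extend F b : ∀ y, V y) x := SmoothSec.extend b
          have := curvOp_eq_curv hLC h (smoothVF_extVF v) (smoothVF_extVF w) (h.const_smul c hb)
          simp only [extVF_self, FiberBundle.extend_apply_self] at this
          rw [← this, curvOp_smul h (smoothVF_extVF v) (smoothVF_extVF w) (SmFun.const c) hb]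
          rfl })
    (by
      intro v v' w
      ext b
      have hb : SmoothSec F (FiberBundle.extend F b : ∀ y, V y) x := SmoothSec.extend b
      simp only [LinearMap.coe_mk, AddHom.coe_mk, LinearMap.add_apply, curv]
      simp only [curvOp_eq_secondCov hLC h hb (smoothVF_extVF _) (smoothVF_extVF _), extVF_self,
        map_add, LinearMap.add_apply]
      abel)
    (by
      intro c v w
      ext b
      have hb : SmoothSec F (FiberBundle.extend F b : ∀ y, V y) x := SmoothSec.extend b
      simp only [LinearMap.coe_mk, AddHom.coe_mk, LinearMap.smul_apply, curv]
      simp only [curvOp_eq_secondCov hLC h hb (smoothVF_extVF _) (smoothVF_extVF _), extVF_self,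
        map_smul, LinearMap.smul_apply, smul_sub])
    (by
      intro v w w'
      ext b
      have hb : SmoothSec F (FiberBundle.extend F b : ∀ y, V y) x := SmoothSec.extend b
      simp only [LinearMap.coe_mk, AddHom.coe_mk, LinearMap.add_apply, curv]
      simp only [curvOp_eq_secondCov hLC h hb (smoothVF_extVF _) (smoothVF_extVF _), extVF_self,
        map_add, LinearMap.add_apply]
      abel)
    (by
      intro c v w
      ext b
      have hb : SmoothSec F (FiberBundle.extend F b : ∀ y, V y) x := SmoothSec.extend b
      simp only [LinearMap.coe_mk, AddHom.coe_mk, LinearMap.smul_apply, curv]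
      simp only [curvOp_eq_secondCov hLC h hb (smoothVF_extVF _) (smoothVF_extVF _), extVF_self,
        map_smul, LinearMap.smul_apply, smul_sub])

lemma curv_antisymm (v w : TangentSpace (𝓡 4) x) (b : V x) :
    curv F cov v w b = -curv F cov w v b := by
  have hb : SmoothSec F (FiberBundle.extend F b : ∀ y, V y) x := SmoothSec.extend b
  simp only [curv]
  simp only [curvOp_eq_secondCov hLC h hb (smoothVF_extVF _) (smoothVF_extVF _), extVF_self,
    neg_sub]

end VectorBundle

/-! ### Symmetries of the Riemann tensor -/

section Riemann

include hLC

variable {x : M}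

lemma riem_antisymm (v w u : TangentSpace (𝓡 4) x) : riem LC v w u = -riem LC w v u :=
  curv_antisymm hLC hLC.isLocalConn v w u

/-- The metric is a parallel pairing of `TM` with itself into the flat trivial bundle. -/
lemma riem_skew (v w u z : TangentSpace (𝓡 4) x) :
    inner ℝ (riem LC v w u) z = -inner ℝ (riem LC v w z) u := by
  have hv := smoothVF_extVF v
  have hw := smoothVF_extVF w
  have hu := smoothVF_extVF u
  have hz := smoothVF_extVF z
  have h := hLC.isLocalConn
  have := curvOp_pairing h h (isLocalConn_mvfderiv (M := M) ℝ)
    (fun x (v w : TangentSpace (𝓡 4) x) => inner ℝ v w) (fun x a a' b => inner_add_left a a' b)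
    (fun x a b b' => inner_add_right a b b') (fun h1 h2 => h1.inner h2)
    (fun h1 h2 v => hLC.mvfderiv_inner h1 h2 v) hv hw hu hz
  rw [curvOp_mvfderiv hv hw (hu.inner hz), curvOp_eq_curv hLC h hv hw hu,
    curvOp_eq_curv hLC h hv hw hz] at this
  simp only [extVF_self] at this
  rw [riem, riem, eq_neg_iff_add_eq_zero, this,
    real_inner_comm u]

/-- The first Bianchi identity. -/
lemma riem_bianchi (u v w : TangentSpace (𝓡 4) x) :
    riem LC u v w + riem LC v w u + riem LC w u v = 0 := by
  have h := hLC.isLocalConn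
  have hu := smoothVF_extVF u
  have hv := smoothVF_extVF v
  have hw := smoothVF_extVF w
  -- Two uses of vanishing torsion: `∇_X ∇_Y Z - ∇_X ∇_Z Y = ∇_X [Y,Z] = [X,[Y,Z]] + ∇_{[Y,Z]} X`.
  -- In the cyclic sum the last terms cancel those of the curvature, and the Jacobi identity removes
  -- the double brackets.
  have key : ∀ {X Y Z : ∀ x : M, TangentSpace (𝓡 4) x}, SmoothVF X x → SmoothVF Y x →
      SmoothVF Z x → LC (fun y => LC Z y (Y y)) x (X x) - LC (fun y => LC Y y (Z y)) x (X x)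
        = mlieBracket (𝓡 4) X (mlieBracket (𝓡 4) Y Z) x
          + LC X x (mlieBracket (𝓡 4) Y Z x) := by
    intro X Y Z hX hY hZ
    rw [hLC.bracket hX (hY.mlieBracket hZ), sub_add_cancel,
      ← h.cov_sub (h.cov_smooth hY hZ) (h.cov_smooth hZ hY)]
    refine h.cov_congr (hY.mlieBracket hZ) ?_ _
    filter_upwards [isSmoothClass_smoothVF.eventually hY, isSmoothClass_smoothVF.eventually hZ]
      with y h1 h2
    exact (hLC.bracket h1 h2).symm
  have k1 := key hu hv hw
  have k2 := key hv hw hu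
  have k3 := key hw hu hv
  have hJ := leibniz_mlieBracket hu hv hw
  rw [mlieBracket_swap_apply (V := mlieBracket (𝓡 4) (extVF u) (extVF v)),
    show mlieBracket (𝓡 4) (extVF u) (extVF w) = -mlieBracket (𝓡 4) (extVF w) (extVF u) from
      mlieBracket_swap] at hJ
  have hneg : mlieBracket (𝓡 4) (extVF v) (-mlieBracket (𝓡 4) (extVF w) (extVF u)) x
      = -mlieBracket (𝓡 4) (extVF v) (mlieBracket (𝓡 4) (extVF w) (extVF u)) x := by
    have := mlieBracket_const_smul_right (I := 𝓡 4) (V := extVF v) (c := (-1 : ℝ))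
      (hw.mlieBracket hu).mdiff
    simpa using this
  rw [hneg] at hJ
  simp only [riem, curv]
  rw [show (FiberBundle.extend E4 w : ∀ y, TangentSpace (𝓡 4) y) = extVF w from rfl,
    show (FiberBundle.extend E4 v : ∀ y, TangentSpace (𝓡 4) y) = extVF v from rfl,
    show (FiberBundle.extend E4 u : ∀ y, TangentSpace (𝓡 4) y) = extVF u from rfl]
  simp only [curvOp]
  rw [← sub_eq_zero] at k1 k2 k3 hJ
  have := congrArg₂ (· + ·) (congrArg₂ (· + ·) k1 k2) (congrArg₂ (· + ·) k3 hJ)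
  simp only [add_zero] at this
  rw [← this]
  abel

/-- The classical octahedron argument: a combination of the four Bianchi identities, one for each
cyclic rotation of `u, v, w, z`, in which the two antisymmetries cancel all but the required terms.
-/
lemma riem_pair_symm (u v w z : TangentSpace (𝓡 4) x) :
    inner ℝ (riem LC u v w) z = inner ℝ (riem LC w z u) v := by
  have a1 : ∀ a b c d : TangentSpace (𝓡 4) x,
      inner ℝ (riem LC a b c) d = -inner ℝ (riem LC b a c) d := fun a b c d => by
    rw [riem_antisymm hLC, inner_neg_left]
  have a2 := fun a b c d : TangentSpace (𝓡 4) x => riem_skew hLC a b c d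
  have a3 : ∀ a b c d : TangentSpace (𝓡 4) x, inner ℝ (riem LC a b c) d
      + inner ℝ (riem LC b c a) d + inner ℝ (riem LC c a b) d = 0 := fun a b c d => by
    rw [← inner_add_left, ← inner_add_left, riem_bianchi hLC, inner_zero_left]
  linarith [a3 u v w z, a3 v w z u, a3 w z u v, a3 z u v w, a1 u v w z, a1 v w z u, a1 w z u v,
    a1 z u v w, a1 u w v z, a1 v z w u, a2 u v w z, a2 v w z u, a2 w z u v, a2 z u v w,
    a2 u w v z, a2 w u v z, a2 v z w u, a2 z v w u, a2 v w u z, a2 w z v u, a2 z u w v,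
    a2 u v z w, a2 w u z v, a1 w u v z, a2 z v u w, a1 u w z v, a1 v z u w]

end Riemann

end CurvatureTensor

/-! ### The algebraic Lichnerowicz identity -/

section Lichnerowicz

variable {A : Type*} [Ring A] [Algebra ℝ A] {ι : Type*} [Fintype ι] [DecidableEq ι]

lemma sum_comm_cycle {N : Type*} [AddCommMonoid N] (f : ι → ι → ι → N) :
    ∑ j, ∑ a, ∑ b, f a b j = ∑ j, ∑ a, ∑ b, f j a b := by
  rw [Finset.sum_comm]
  refine Finset.sum_congr rfl fun a _ => ?_
  rw [Finset.sum_comm]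

/-- Contraction of an algebraic curvature tensor with four Clifford generators. -/
lemma clifford_contract (c : ι → A)
    (hc : ∀ i j, c i * c j + c j * c i = if i = j then -2 else 0)
    (R : ι → ι → ι → ι → ℝ) (h2 : ∀ i j a b, R i j a b = -R i j b a)
    (hp : ∀ i j a b, R i j a b = R a b i j)
    (hb : ∀ i j a b, R i j a b + R j a i b + R a i j b = 0) :
    ∑ i, ∑ j, ∑ a, ∑ b, R i j a b • (c i * c j * c a * c b)
      = (2 * ∑ i, ∑ j, R i j j i) • (1 : A) := by
  -- The Bianchi identity moved to the last three indices by means of the pair symmetry.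
  have hb' : ∀ i j a b, R i j a b + R i a b j + R i b j a = 0 := fun i j a b => by
    linarith [hb j a b i, hp i j a b, hp i a b j, hp i b j a, h2 j a b i, h2 a b j i,
      h2 b j a i, h2 a b i j, h2 b j i a, h2 j a i b]
  have swap : ∀ i j, c i * c j = -(c j * c i) + if i = j then -2 else 0 := fun i j =>
    eq_neg_add_of_add_eq (by rw [add_comm]; exact hc i j)
  -- Fix `i`, write `T` for the left side and `S = ∑ R i j j a • c a`. Contracting the cyclic
  -- Bianchi sum with `c j * c a * c b` and relabelling gives the three cyclic orders of the
  -- product. Brought back to the order `j, a, b` they contribute `T`, `T + 2S` and `T + 4S`, so `3T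
  -- + 6S = 0`.
  have T : ∀ i, ∑ j, ∑ a, ∑ b, R i j a b • (c j * c a * c b)
      = (-2 : ℝ) • ∑ j, ∑ a, R i j j a • c a := by
    intro i
    have z : ∑ j, ∑ a, ∑ b, (R i j a b + R i a b j + R i b j a) • (c j * c a * c b) = 0 := by
      simp [hb']
    have e1 : ∑ j, ∑ a, ∑ b, R i a b j • (c j * c a * c b)
        = ∑ j, ∑ a, ∑ b, R i j a b • (c b * c j * c a) :=
      sum_comm_cycle fun j a b => R i j a b • (c b * c j * c a)
    have e2 : ∑ j, ∑ a, ∑ b, R i b j a • (c j * c a * c b)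
        = ∑ j, ∑ a, ∑ b, R i j a b • (c a * c b * c j) :=
      (sum_comm_cycle fun j a b => R i b j a • (c j * c a * c b)).symm
    have f1 : ∀ j a b, c b * c j * c a
        = -(c b * c a * c j) + if j = a then (-2 : ℝ) • c b else 0 := by
      intro j a b
      rw [mul_assoc, swap j a, mul_add, mul_assoc]
      split_ifs <;> simp [mul_two, two_smul]
    have f2 : ∀ j a b, c a * c b * c j = c j * c a * c b
        + ((if j = b then (-2 : ℝ) • c a else 0) - if j = a then (-2 : ℝ) • c b else 0) := by
      intro j a b
      rw [mul_assoc, swap b j, mul_add, mul_neg, ← mul_assoc, swap a j, add_mul]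
      simp only [eq_comm (a := b) (b := j), eq_comm (a := a) (b := j)]
      split_ifs <;> simp [mul_two, two_mul, two_smul] <;> abel
    have e3 : ∑ j, ∑ a, ∑ b, R i j a b • (c b * c a * c j)
        = -∑ j, ∑ a, ∑ b, R i j a b • (c a * c b * c j) := by
      rw [← Finset.sum_neg_distrib]
      refine Finset.sum_congr rfl fun j _ => ?_
      rw [Finset.sum_comm, ← Finset.sum_neg_distrib]
      refine Finset.sum_congr rfl fun a _ => ?_
      rw [← Finset.sum_neg_distrib]
      refine Finset.sum_congr rfl fun b _ => ?_
      rw [h2 i j b a, neg_smul]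
    have d1 : ∑ j, ∑ a, ∑ b, R i j a b • (if j = a then (-2 : ℝ) • c b else 0)
        = (-2 : ℝ) • ∑ j, ∑ a, R i j j a • c a := by
      simp only [smul_ite, smul_zero, Finset.smul_sum]
      refine Finset.sum_congr rfl fun j _ => ?_
      rw [Finset.sum_comm]
      refine Finset.sum_congr rfl fun b _ => ?_
      rw [Finset.sum_ite_eq, if_pos (Finset.mem_univ _), smul_comm]
    have d2 : ∑ j, ∑ a, ∑ b, R i j a b • (if j = b then (-2 : ℝ) • c a else 0)
        = (2 : ℝ) • ∑ j, ∑ a, R i j j a • c a := by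
      simp only [smul_ite, smul_zero, Finset.smul_sum]
      refine Finset.sum_congr rfl fun j _ => Finset.sum_congr rfl fun a _ => ?_
      simp only [Finset.sum_ite_eq, Finset.mem_univ, if_true]
      rw [h2 i j a j]
      module
    have g2 : ∑ j, ∑ a, ∑ b, R i j a b • (c a * c b * c j)
        = (∑ j, ∑ a, ∑ b, R i j a b • (c j * c a * c b))
          + ((2 : ℝ) • (∑ j, ∑ a, R i j j a • c a)
            - (-2 : ℝ) • (∑ j, ∑ a, R i j j a • c a)) := by
      rw [← d1, ← d2]
      simp only [← Finset.sum_add_distrib, ← Finset.sum_sub_distrib, ← smul_add, ← smul_sub]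
      refine Finset.sum_congr rfl fun j _ => Finset.sum_congr rfl fun a _ =>
        Finset.sum_congr rfl fun b _ => ?_
      rw [f2]
    have g1 : ∑ j, ∑ a, ∑ b, R i j a b • (c b * c j * c a)
        = (∑ j, ∑ a, ∑ b, R i j a b • (c a * c b * c j))
          + (-2 : ℝ) • ∑ j, ∑ a, R i j j a • c a := by
      rw [← d1, ← neg_neg (∑ j, ∑ a, ∑ b, R i j a b • (c a * c b * c j)), ← e3]
      simp only [← Finset.sum_neg_distrib, ← Finset.sum_add_distrib, ← smul_neg, ← smul_add]
      refine Finset.sum_congr rfl fun j _ => Finset.sum_congr rfl fun a _ =>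
        Finset.sum_congr rfl fun b _ => ?_
      rw [f1]
    simp only [add_smul, Finset.sum_add_distrib, e1, e2, g1] at z
    rw [g2] at z
    have z' : (3 : ℝ) • (∑ j, ∑ a, ∑ b, R i j a b • (c j * c a * c b))
        = (3 : ℝ) • ((-2 : ℝ) • ∑ j, ∑ a, R i j j a • c a) := by
      rw [← sub_eq_zero, ← z]
      module
    exact smul_right_injective A (by norm_num : (3 : ℝ) ≠ 0) z'
  have hT : ∑ i, ∑ j, ∑ a, ∑ b, R i j a b • (c i * c j * c a * c b)
      = (-2 : ℝ) • ∑ i, ∑ j, ∑ a, R i j j a • (c i * c a) := by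
    have : ∀ i, ∑ j, ∑ a, ∑ b, R i j a b • (c i * c j * c a * c b)
        = c i * ∑ j, ∑ a, ∑ b, R i j a b • (c j * c a * c b) := fun i => by
      simp only [Finset.mul_sum, mul_smul_comm, mul_assoc]
    simp only [this, T, mul_smul_comm, Finset.mul_sum, Finset.smul_sum]
  -- The Ricci contraction `∑ j, R i j j a` is symmetric in `i` and `a`.
  have hs : ∑ i, ∑ j, ∑ a, R i j j a • (c i * c a)
      = ∑ i, ∑ j, ∑ a, R i j j a • (c a * c i) := by
    have : ∀ f : ι → ι → ι → A, ∑ i, ∑ j, ∑ a, f i j a = ∑ i, ∑ j, ∑ a, f a j i := by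
      intro f
      rw [Finset.sum_comm]
      conv_rhs => rw [Finset.sum_comm]
      exact Finset.sum_congr rfl fun j _ => Finset.sum_comm
    rw [this]
    refine Finset.sum_congr rfl fun i _ => Finset.sum_congr rfl fun j _ =>
      Finset.sum_congr rfl fun a _ => ?_
    have e : R a j j i = R i j j a := by
      linarith [h2 a j j i, hp a j i j, h2 i j a j]
    rw [e]
  -- By this symmetry only the anticommutator of `c i` and `c a` enters, and it is `-2` on the
  -- diagonal and zero elsewhere.
  have hd : (2 : ℝ) • ∑ i, ∑ j, ∑ a, R i j j a • (c i * c a)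
      = (-2 : ℝ) • (∑ i, ∑ j, R i j j i) • (1 : A) := by
    rw [two_smul]
    nth_rw 2 [hs]
    simp only [← Finset.sum_add_distrib, ← smul_add, hc, smul_ite, smul_zero, Finset.sum_ite_eq,
      Finset.mem_univ, if_true, Finset.sum_smul, Finset.smul_sum]
    refine Finset.sum_congr rfl fun i _ => Finset.sum_congr rfl fun j _ => ?_
    rw [smul_comm]
    congr 1
    rw [neg_smul, two_smul, one_add_one_eq_two]
  rw [hT, neg_smul, hd]
  module

end Lichnerowicz

/-! ### Orthonormal frames -/

section Frames

variable {M : Type*} [TopologicalSpace M] [ChartedSpace E4 M] [IsManifold (𝓡 4) ∞ M]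
  [RiemannianBundle (fun x : M => TangentSpace (𝓡 4) x)]
  [IsContMDiffRiemannianBundle (𝓡 4) ∞ E4 (fun x : M => TangentSpace (𝓡 4) x)] {x : M}

/-- Expand `e'` in `e` and apply Parseval's identity for `e'`. It allows the pointwise choice `onb`
to be replaced by any basis adapted to the computation. -/
lemma trace_eq {T : Type*} [NormedAddCommGroup T] [InnerProductSpace ℝ T] {ι : Type*} [Fintype ι]
    {A : Type*} [AddCommGroup A] [Module ℝ A] (F : T →ₗ[ℝ] T →ₗ[ℝ] A)
    (e e' : OrthonormalBasis ι ℝ T) : ∑ i, F (e' i) (e' i) = ∑ i, F (e i) (e i) := by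
  classical
  have h : ∀ i, F (e' i) (e' i)
      = ∑ k, ∑ l, (inner ℝ (e k) (e' i) * inner ℝ (e' i) (e l)) • F (e k) (e l) := by
    intro i
    conv_lhs => rw [← e.sum_repr' (e' i)]
    simp only [map_sum, LinearMap.sum_apply, map_smul, LinearMap.smul_apply, smul_smul,
      Finset.smul_sum]
    rw [Finset.sum_comm]
    refine Finset.sum_congr rfl fun k _ => Finset.sum_congr rfl fun l _ => ?_
    rw [real_inner_comm (e l), mul_comm]
  simp only [h]
  rw [Finset.sum_comm]
  refine Finset.sum_congr rfl fun k _ => ?_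
  rw [Finset.sum_comm]
  simp only [← Finset.sum_smul, e'.sum_inner_mul_inner, orthonormal_iff_ite.1 e.orthonormal,
    ite_smul, one_smul, zero_smul, Finset.sum_ite_eq, Finset.mem_univ, if_true]

lemma SmFun.comp_contDiffAt {f : M → ℝ} {g : ℝ → ℝ} (hf : SmFun f x)
    (hg : ∀ᶠ t in 𝓝 (f x), ContDiffAt ℝ ∞ g t) : SmFun (fun y => g (f y)) x := by
  filter_upwards [hf, hf.contMDiffAt.continuousAt.eventually hg] with y h1 h2
  exact h2.contMDiffAt.comp y h1

/-- An orthonormal basis of a tangent space extends to a smooth local orthonormal frame. -/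
lemma exists_orthonormal_frame (e : OrthonormalBasis (Fin 4) ℝ (TangentSpace (𝓡 4) x)) :
    ∃ E : Fin 4 → ∀ y : M, TangentSpace (𝓡 4) y, (∀ i, SmoothVF (E i) x) ∧ (∀ i, E i x = e i) ∧
      ∀ᶠ y in 𝓝 x, Orthonormal ℝ (fun i => E i y) := by
  have hV := isSmoothClass_smoothVF (M := M)
  -- Gram–Schmidt, one field at a time: orthonormality near `x` is required only of the first `n`
  -- fields, while smoothness and the prescribed values at `x` are kept for all four.
  suffices h : ∀ n : ℕ, n ≤ 4 → ∃ E : Fin 4 → ∀ y : M, TangentSpace (𝓡 4) y,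
      (∀ i, SmoothVF (E i) x) ∧ (∀ i, E i x = e i) ∧
      ∀ i j : Fin 4, i.1 < n → j.1 < n →
        ∀ᶠ y in 𝓝 x, inner ℝ (E i y) (E j y) = if i = j then (1 : ℝ) else 0 by
    obtain ⟨E, h1, h2, h3⟩ := h 4 le_rfl
    refine ⟨E, h1, h2, ?_⟩
    have := Filter.eventually_all.2 fun i => Filter.eventually_all.2 fun j => h3 i j i.2 j.2
    filter_upwards [this] with y hy
    exact orthonormal_iff_ite.2 hy
  intro n
  induction n with
  | zero =>
    intro _
    exact ⟨fun i => extVF (e i), fun i => smoothVF_extVF _, fun i => by simp,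
      fun i j hi => absurd hi (Nat.not_lt_zero _)⟩
  | succ n ih =>
    intro hn
    obtain ⟨E, h1, h2, h3⟩ := ih (by omega)
    let k : Fin 4 := ⟨n, by omega⟩
    let u : ∀ y : M, TangentSpace (𝓡 4) y := fun y =>
      E k y - ∑ i ∈ Finset.univ.filter (fun i : Fin 4 => i.1 < n),
        (inner ℝ (E i y) (E k y) : ℝ) • E i y
    have hu : SmoothVF u x := hV.sub (h1 k) (hV.sum _ fun i _ => hV.smul ((h1 i).inner (h1 k)) (h1 i))
    -- As `e` is orthonormal, the projection correction vanishes at `x` and the normalising factor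
    -- there is `1`, so the prescribed values survive.
    have hux : u x = e k := by
      have : ∑ i ∈ Finset.univ.filter (fun i : Fin 4 => i.1 < n),
          (inner ℝ (E i x) (E k x) : ℝ) • E i x = 0 := by
        refine Finset.sum_eq_zero fun i hi => ?_
        have hik : i ≠ k := by
          rintro rfl
          simp [k] at hi
        rw [h2, h2, e.inner_eq_zero hik, zero_smul]
      simp only [u]
      rw [this, sub_zero, h2]
    let q : M → ℝ := fun y => inner ℝ (u y) (u y)
    have hq : SmFun q x := hu.inner hu
    have hqx : q x = 1 := by
      simp [q, hux]
    have hqpos : ∀ᶠ y in 𝓝 x, 0 < q y :=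
      hq.contMDiffAt.continuousAt.eventually (lt_mem_nhds (by rw [hqx]; exact one_pos))
    have hg : SmFun (fun y => (Real.sqrt (q y))⁻¹) x := by
      refine hq.comp_contDiffAt (g := fun t => (Real.sqrt t)⁻¹) ?_
      filter_upwards [lt_mem_nhds (show (0 : ℝ) < q x by rw [hqx]; exact one_pos)] with t ht
      exact (Real.contDiffAt_sqrt ht.ne').inv (Real.sqrt_pos.2 ht).ne'
    refine ⟨Function.update E k (fun y => (Real.sqrt (q y))⁻¹ • u y), ?_, ?_, ?_⟩
    · intro i
      by_cases hi : i = k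
      · subst hi
        simpa using hV.smul hg hu
      · simpa [hi] using h1 i
    · intro i
      by_cases hi : i = k
      · subst hi
        simp [hqx, hux]
      · simpa [hi] using h2 i
    · have horth : ∀ i : Fin 4, i.1 < n → ∀ᶠ y in 𝓝 x, inner ℝ (E i y) (u y) = (0 : ℝ) := by
        intro i hi
        have : ∀ᶠ y in 𝓝 x, ∀ j : Fin 4, j.1 < n →
            inner ℝ (E i y) (E j y) = if i = j then (1 : ℝ) else 0 :=
          Filter.eventually_all.2 fun j => by
            by_cases hj : j.1 < n
            · filter_upwards [h3 i j hi hj] with y hy _ using hy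
            · exact Filter.Eventually.of_forall fun y h => absurd h hj
        filter_upwards [this] with y hy
        simp only [u, inner_sub_right, inner_sum, inner_smul_right]
        rw [Finset.sum_congr rfl fun j hj => by rw [hy j (by simpa using hj)]]
        simp [hi]
      have hlt : ∀ i : Fin 4, i.1 < n + 1 → i ≠ k → i.1 < n := fun i hi hik => by
        have : i.1 ≠ n := fun h => hik (Fin.ext h)
        omega
      intro i j hi hj
      by_cases hik : i = k <;> by_cases hjk : j = k
      · filter_upwards [hqpos] with y hy
        simp only [hik, hjk, Function.update_self, inner_smul_left, inner_smul_right, if_true]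
        change _ * (_ * q y) = 1
        have := Real.sq_sqrt hy.le
        have h0 := (Real.sqrt_pos.2 hy).ne'
        simp only [conj_trivial]
        field_simp
        exact this.symm
      · have hjn := hlt j hj hjk
        filter_upwards [horth j hjn] with y hy
        rw [hik, Function.update_self, Function.update_of_ne hjk, inner_smul_left,
          real_inner_comm, hy, mul_zero, if_neg (Ne.symm hjk)]
      · have hin := hlt i hi hik
        filter_upwards [horth i hin] with y hy
        rw [hjk, Function.update_self, Function.update_of_ne hik, inner_smul_right, hy, mul_zero,
          if_neg hik]
      · rw [Function.update_of_ne hik, Function.update_of_ne hjk]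
        exact h3 i j (hlt i hi hik) (hlt j hj hjk)

lemma exists_orthonormalBasis_eq {y : M} {E : Fin 4 → TangentSpace (𝓡 4) y}
    (hE : Orthonormal ℝ E) :
    ∃ b : OrthonormalBasis (Fin 4) ℝ (TangentSpace (𝓡 4) y), ∀ i, b i = E i := by
  have hc : Fintype.card (Fin 4) = Module.finrank ℝ (TangentSpace (𝓡 4) y) := by
    rw [show Module.finrank ℝ (TangentSpace (𝓡 4) y) = Module.finrank ℝ E4 from rfl]
    simp
  refine ⟨OrthonormalBasis.mk hE (hE.linearIndependent.span_eq_top_of_card_eq_finrank' hc).ge,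
    fun i => by simp⟩

end Frames

/-! ### The square of a Dirac operator -/

section DiracSquare

variable {M : Type*} [TopologicalSpace M] [ChartedSpace E4 M] [IsManifold (𝓡 4) ∞ M]
  [RiemannianBundle (fun x : M => TangentSpace (𝓡 4) x)]
  [IsContMDiffRiemannianBundle (𝓡 4) ∞ E4 (fun x : M => TangentSpace (𝓡 4) x)]
  {W : M → Type*} [∀ x, AddCommGroup (W x)] [∀ x, Module ℝ (W x)]

/-- Clifford multiplication `c` on `W` is parallel for the connection `cov`. -/
structure IsCliffordConn
    (LC : CovariantDerivative (𝓡 4) E4 (fun x : M => TangentSpace (𝓡 4) x))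
    (Sm : (∀ x, W x) → M → Prop) (cov : (∀ x, W x) → ∀ x : M, TangentSpace (𝓡 4) x → W x)
    (c : ∀ x : M, TangentSpace (𝓡 4) x →ₗ[ℝ] W x →ₗ[ℝ] W x) : Prop extends
    IsLocalConn Sm cov where
  c_sq : ∀ x v w, c x v (c x v w) = -(inner ℝ v v : ℝ) • w
  c_smooth : ∀ {X ξ x}, SmoothVF X x → Sm ξ x → Sm (fun y => c y (X y) (ξ y)) x
  c_cov : ∀ {X ξ x}, SmoothVF X x → Sm ξ x → ∀ v,
    cov (fun y => c y (X y) (ξ y)) x v = c x (LC X x v) (ξ x) + c x (X x) (cov ξ x v)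

/-- The Dirac operator of a connection. -/
def diracOp (cov : (∀ x, W x) → ∀ x : M, TangentSpace (𝓡 4) x → W x)
    (c : ∀ x : M, TangentSpace (𝓡 4) x →ₗ[ℝ] W x →ₗ[ℝ] W x) (ξ : ∀ x, W x) (x : M) : W x :=
  ∑ i, c x (onb x i) (cov ξ x (onb x i))

namespace IsCliffordConn

variable {LC : CovariantDerivative (𝓡 4) E4 (fun x : M => TangentSpace (𝓡 4) x)}
  {Sm : (∀ x, W x) → M → Prop} {cov : (∀ x, W x) → ∀ x : M, TangentSpace (𝓡 4) x → W x}
  {c : ∀ x : M, TangentSpace (𝓡 4) x →ₗ[ℝ] W x →ₗ[ℝ] W x} (h : IsCliffordConn LC Sm cov c) {x : M}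

include h

lemma diracOp_eq (ξ : ∀ x, W x) (e : OrthonormalBasis (Fin 4) ℝ (TangentSpace (𝓡 4) x)) :
    diracOp cov c ξ x = ∑ i, c x (e i) (cov ξ x (e i)) :=
  trace_eq ((c x).compl₂ (h.covL ξ x)) e (onb x)

lemma anticomm (v w : TangentSpace (𝓡 4) x) (ξ : W x) :
    c x v (c x w ξ) + c x w (c x v ξ) = (-2 * inner ℝ v w : ℝ) • ξ := by
  have h1 := h.c_sq x (v + w) ξ
  simp only [map_add, LinearMap.add_apply, h.c_sq, inner_add_left, inner_add_right,
    real_inner_comm v w] at h1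
  have h2 : c x v (c x w ξ) + c x w (c x v ξ)
      = (-(inner ℝ v v : ℝ) • ξ + c x w (c x v ξ) + (c x v (c x w ξ) + -(inner ℝ w w : ℝ) • ξ))
        + (inner ℝ v v + inner ℝ w w : ℝ) • ξ := by module
  rw [h2, h1]
  module

/-- The bases `onb y` at different points are unrelated, so the Dirac operator can be differentiated
only after it has been rewritten in a smooth orthonormal frame. -/
lemma diracOp_eventually {E : Fin 4 → ∀ y : M, TangentSpace (𝓡 4) y}
    (hE : ∀ᶠ y in 𝓝 x, Orthonormal ℝ (fun i => E i y)) (ξ : ∀ x, W x) :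
    ∀ᶠ y in 𝓝 x, diracOp cov c ξ y = ∑ i, c y (E i y) (cov ξ y (E i y)) := by
  filter_upwards [hE] with y hy
  obtain ⟨b, hb⟩ := exists_orthonormalBasis_eq hy
  rw [h.diracOp_eq ξ b]
  simp only [hb]

lemma diracOp_smooth {ξ : ∀ x, W x} (hξ : Sm ξ x) : Sm (diracOp cov c ξ) x := by
  obtain ⟨E, h1, h2, h3⟩ := exists_orthonormal_frame (onb x)
  exact h.congr (h.sum _ fun i _ => h.c_smooth (h1 i) (h.cov_smooth (h1 i) hξ))
    (h.diracOp_eventually h3 ξ)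

variable [T2Space M] (hLC : IsLeviCivita LC)

include hLC

/-- Differentiating `∑ c(E_j) ∇_{E_j} ξ` in a smooth frame gives second covariant derivatives plus
terms containing `∇E_j`. The frame is not assumed parallel at `x`; these terms match because the
connection matrix of an orthonormal frame is skew. -/
lemma diracOp_sq {ξ : ∀ x, W x} (hξ : Sm ξ x)
    (e : OrthonormalBasis (Fin 4) ℝ (TangentSpace (𝓡 4) x)) :
    diracOp cov c (diracOp cov c ξ) x = ∑ i, ∑ j, c x (e i) (c x (e j)
      (secondCov hLC h.toIsLocalConn ξ hξ (e i) (e j))) := by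
  obtain ⟨E, h1, h2, h3⟩ := exists_orthonormal_frame e
  have hE : ∀ j, Sm (fun y => cov ξ y (E j y)) x := fun j => h.cov_smooth (h1 j) hξ
  have hterm : ∀ j, Sm (fun y => c y (E j y) (cov ξ y (E j y))) x := fun j =>
    h.c_smooth (h1 j) (hE j)
  have hcov : ∀ v, cov (diracOp cov c ξ) x v = ∑ j, (c x (LC (E j) x v) (cov ξ x (e j))
      + c x (e j) (cov (fun y => cov ξ y (E j y)) x v)) := by
    intro v
    rw [h.cov_congr (h.sum Finset.univ fun i _ => hterm i) (h.diracOp_eventually h3 ξ),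
      h.cov_sum _ fun i _ => hterm i]
    refine Finset.sum_congr rfl fun j _ => ?_
    rw [h.c_cov (h1 j) (hE j), h2]
  have hskew : ∀ v j k, inner ℝ (LC (E j) x v) (e k) = -inner ℝ (LC (E k) x v) (e j) := by
    intro v j k
    have a := hLC.mvfderiv_inner (h1 j) (h1 k) v
    have b : mvfderiv (𝓡 4) (fun y => inner ℝ (E j y) (E k y)) x v = 0 := by
      rw [mvfderiv_congr (SmFun.const (if j = k then (1 : ℝ) else 0))
        (h3.mono fun y hy => orthonormal_iff_ite.1 hy j k)]
      simp [mvfderiv_const]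
    rw [b, h2, h2, real_inner_comm (LC (E k) x v)] at a
    linarith
  -- Both sides are expanded with the coefficients `⟨∇_v E_j, e_k⟩`; the sign comes from their
  -- skewness after exchanging `j` and `k`.
  have hcancel : ∀ v, ∑ j, c x (LC (E j) x v) (cov ξ x (e j))
      = -∑ j, c x (e j) (cov ξ x (LC (E j) x v)) := by
    intro v
    have ex : ∀ j, LC (E j) x v = ∑ k, (inner ℝ (LC (E j) x v) (e k) : ℝ) • e k := fun j => by
      conv_lhs => rw [← e.sum_repr' (LC (E j) x v)]
      exact Finset.sum_congr rfl fun k _ => by rw [real_inner_comm]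
    have l1 : ∀ j, c x (LC (E j) x v) (cov ξ x (e j))
        = ∑ k, (inner ℝ (LC (E j) x v) (e k) : ℝ) • c x (e k) (cov ξ x (e j)) := fun j => by
      conv_lhs => rw [ex j]
      simp only [map_sum, LinearMap.sum_apply, map_smul, LinearMap.smul_apply]
    have l2 : ∀ j, c x (e j) (cov ξ x (LC (E j) x v))
        = ∑ k, (inner ℝ (LC (E j) x v) (e k) : ℝ) • c x (e j) (cov ξ x (e k)) := fun j => by
      rw [show cov ξ x (LC (E j) x v)
          = ∑ k, (inner ℝ (LC (E j) x v) (e k) : ℝ) • cov ξ x (e k) by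
        conv_lhs => rw [ex j, ← h.covL_apply, map_sum]
        simp only [h.covL_apply, h.cov_vsmul]]
      simp only [map_sum, map_smul]
    simp only [l1, l2]
    rw [Finset.sum_comm, ← Finset.sum_neg_distrib]
    refine Finset.sum_congr rfl fun j _ => ?_
    rw [← Finset.sum_neg_distrib]
    refine Finset.sum_congr rfl fun k _ => ?_
    rw [hskew v k j, neg_smul]
  rw [h.diracOp_eq _ e]
  refine Finset.sum_congr rfl fun i _ => ?_
  rw [hcov, Finset.sum_add_distrib, hcancel, neg_add_eq_sub, ← Finset.sum_sub_distrib, map_sum]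
  refine Finset.sum_congr rfl fun j _ => ?_
  have := secondCov_vf hLC h.toIsLocalConn hξ (e i) (h1 j)
  rw [h2] at this
  simp only [this, map_sub]

/-- The Weitzenböck formula. -/
lemma diracOp_sq_eq {ξ : ∀ x, W x} (hξ : Sm ξ x)
    (e : OrthonormalBasis (Fin 4) ℝ (TangentSpace (𝓡 4) x)) :
    diracOp cov c (diracOp cov c ξ) x
      = -∑ i, secondCov hLC h.toIsLocalConn ξ hξ (e i) (e i)
        + (1 / 2 : ℝ) • ∑ i, ∑ j, c x (e i) (c x (e j)
          (curvOp cov (extVF (e i)) (extVF (e j)) ξ x)) := by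
  set H := secondCov hLC h.toIsLocalConn ξ hξ with hH
  have hR : ∀ i j, curvOp cov (extVF (e i)) (extVF (e j)) ξ x = H (e i) (e j) - H (e j) (e i) :=
    fun i j => by
      rw [curvOp_eq_secondCov hLC h.toIsLocalConn hξ (smoothVF_extVF _) (smoothVF_extVF _)]
      simp [hH]
  -- With `H` the second covariant derivative, the Clifford relation turns the exchanged sum into
  -- `-2 ∑ H(e_i, e_i)` minus the sum that equals `D²`. Hence `½ ∑ c c Ω = D² + ∑ H(e_i, e_i)`.
  have hsw : ∑ i, ∑ j, c x (e i) (c x (e j) (H (e j) (e i)))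
      = ∑ i, ∑ j, ((-2 * inner ℝ (e j) (e i) : ℝ) • H (e i) (e j)
        - c x (e i) (c x (e j) (H (e i) (e j)))) := by
    rw [Finset.sum_comm]
    refine Finset.sum_congr rfl fun i _ => Finset.sum_congr rfl fun j _ => ?_
    rw [← h.anticomm, add_sub_cancel_right]
  have hd : ∑ i, ∑ j, (-2 * inner ℝ (e j) (e i) : ℝ) • H (e i) (e j)
      = (-2 : ℝ) • ∑ i, H (e i) (e i) := by
    simp only [orthonormal_iff_ite.1 e.orthonormal, mul_ite, mul_one, mul_zero, ite_smul, zero_smul,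
      Finset.sum_ite_eq', Finset.mem_univ, if_true, Finset.smul_sum]
  rw [h.diracOp_sq hLC hξ e]
  simp only [hR, map_sub, Finset.sum_sub_distrib]
  rw [hsw]
  simp only [Finset.sum_sub_distrib]
  rw [hd]
  module

end IsCliffordConn

end DiracSquare

/-! ### Complex connections -/

section ComplexConnections

variable {M : Type*} [TopologicalSpace M] [ChartedSpace E4 M] [IsManifold (𝓡 4) ∞ M]

section Abstract

variable {V : M → Type*} [∀ x, AddCommGroup (V x)] [∀ x, Module ℝ (V x)] [∀ x, Module ℂ (V x)]
  [∀ x, IsScalarTower ℝ ℂ (V x)]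

lemma real_smul_eq {W : Type*} [AddCommGroup W] [Module ℝ W] [Module ℂ W] [IsScalarTower ℝ ℂ W]
    (r : ℝ) (w : W) : r • w = (r : ℂ) • w := by
  have := smul_assoc r (1 : ℂ) w
  rw [one_smul] at this
  rw [← this]
  simp

lemma complex_smul_eq {W : Type*} [AddCommGroup W] [Module ℝ W] [Module ℂ W] [IsScalarTower ℝ ℂ W]
    (z : ℂ) (w : W) : z • w = z.re • w + z.im • (Complex.I • w) := by
  rw [real_smul_eq, real_smul_eq, ← mul_smul, ← add_smul, Complex.re_add_im]

/-- `cov` is a complex linear connection on the smooth sections described by `Sm`. -/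
structure IsComplexConn (Sm : (∀ x, V x) → M → Prop)
    (cov : (∀ x, V x) → ∀ x : M, TangentSpace (𝓡 4) x → V x) : Prop extends
    IsLocalConn Sm cov where
  I_smul : ∀ {s x}, Sm s x → Sm (fun y => Complex.I • s y) x
  cov_I : ∀ {s x}, Sm s x → ∀ v, cov (fun y => Complex.I • s y) x v = Complex.I • cov s x v

namespace IsComplexConn

variable {Sm : (∀ x, V x) → M → Prop}
  {cov : (∀ x, V x) → ∀ x : M, TangentSpace (𝓡 4) x → V x} (h : IsComplexConn Sm cov) {x : M}
include h

lemma csmul {f : M → ℂ} {s} (hf : SmFun f x) (hs : Sm s x) : Sm (fun y => f y • s y) x := by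
  simp only [complex_smul_eq (f _) (s _)]
  exact h.add (h.smul (hf.clm Complex.reCLM) hs) (h.smul (hf.clm Complex.imCLM) (h.I_smul hs))

lemma cov_csmul {f : M → ℂ} {s} (hf : SmFun f x) (hs : Sm s x) (v : TangentSpace (𝓡 4) x) :
    cov (fun y => f y • s y) x v = f x • cov s x v + mvfderiv (𝓡 4) f x v • s x := by
  simp only [complex_smul_eq (f _) (s _)]
  have h1 : SmFun (fun y => (f y).re) x := hf.clm Complex.reCLM
  have h2 : SmFun (fun y => (f y).im) x := hf.clm Complex.imCLM
  have e1 : mvfderiv (𝓡 4) (fun y => (f y).re) x v = (mvfderiv (𝓡 4) f x v).re :=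
    mvfderiv_clm Complex.reCLM hf v
  have e2 : mvfderiv (𝓡 4) (fun y => (f y).im) x v = (mvfderiv (𝓡 4) f x v).im :=
    mvfderiv_clm Complex.imCLM hf v
  rw [h.cov_add (h.smul h1 hs) (h.smul h2 (h.I_smul hs)), h.cov_smul h1 hs,
    h.cov_smul h2 (h.I_smul hs), h.cov_I hs, e1, e2, complex_smul_eq (f x),
    complex_smul_eq (mvfderiv (𝓡 4) f x v)]
  abel

lemma cov_const_csmul {s} (c : ℂ) (hs : Sm s x) (v : TangentSpace (𝓡 4) x) :
    cov (fun y => c • s y) x v = c • cov s x v := by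
  rw [h.cov_csmul (SmFun.const c) hs]
  simp [mvfderiv_const]

lemma curvOp_const_csmul {X Y : ∀ x : M, TangentSpace (𝓡 4) x} (hX : SmoothVF X x)
    (hY : SmoothVF Y x) {s} (c : ℂ) (hs : Sm s x) :
    curvOp cov X Y (fun y => c • s y) x = c • curvOp cov X Y s x := by
  have key : ∀ {A B : ∀ x : M, TangentSpace (𝓡 4) x}, SmoothVF A x →
      cov (fun y => cov (fun y => c • s y) y (A y)) x (B x)
        = c • cov (fun y => cov s y (A y)) x (B x) := by
    intro A B hA
    have h1 := h.cov_smooth hA hs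
    rw [← h.cov_const_csmul c h1, h.cov_congr (h.csmul (SmFun.const c) h1)]
    filter_upwards [h.eventually hs] with y hy
    exact h.cov_const_csmul c hy _
  simp only [curvOp]
  rw [key hX, key hY, h.cov_const_csmul c hs, smul_sub, smul_sub]

end IsComplexConn

end Abstract

lemma SmFun.csmul {G : Type*} [NormedAddCommGroup G] [NormedSpace ℂ G] {f : M → ℂ} {g : M → G}
    {x : M} (hf : SmFun f x) (hg : SmFun g x) : SmFun (fun y => f y • g y) x :=
  hf.bilin (ContinuousLinearMap.lsmul ℝ ℂ) hg

lemma SmFun.mul {f g : M → ℂ} {x : M} (hf : SmFun f x) (hg : SmFun g x) :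
    SmFun (fun y => f y * g y) x := hf.csmul hg

lemma mvfderiv_mul {f g : M → ℂ} {x : M} (hf : SmFun f x) (hg : SmFun g x)
    (v : TangentSpace (𝓡 4) x) : mvfderiv (𝓡 4) (fun y => f y * g y) x v
      = mvfderiv (𝓡 4) f x v * g x + f x * mvfderiv (𝓡 4) g x v :=
  mvfderiv_bilin (ContinuousLinearMap.mul ℝ ℂ) hf hg v

lemma SmFun.sum {G : Type*} [NormedAddCommGroup G] [NormedSpace ℝ G] {ι : Type*} (I : Finset ι)
    {f : ι → M → G} {x : M} (hf : ∀ i ∈ I, SmFun (f i) x) : SmFun (fun y => ∑ i ∈ I, f i y) x :=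
  (isLocalConn_mvfderiv (M := M) G).sum I hf

lemma SmFun.conj {f : M → ℂ} {x : M} (hf : SmFun f x) : SmFun (fun y => conj (f y)) x :=
  hf.clm (Complex.conjCLE : ℂ →L[ℝ] ℂ)

lemma SmFun.ofReal {f : M → ℝ} {x : M} (hf : SmFun f x) : SmFun (fun y => (f y : ℂ)) x :=
  hf.clm Complex.ofRealCLM

lemma SmFun.pi {ι : Type*} [Fintype ι] {f : ι → M → ℂ} {x : M} (hf : ∀ i, SmFun (f i) x) :
    SmFun (fun y i => f i y) x := by
  filter_upwards [Filter.eventually_all.2 hf] with y hy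
  exact contMDiffAt_pi_space.2 hy

/-- The coefficients of a smooth function in a smooth moving basis are smooth. -/
lemma smFun_coeff {G : Type*} [NormedAddCommGroup G] [NormedSpace ℂ G] [FiniteDimensional ℂ G]
    {ι : Type*} [Fintype ι] {x : M} {g : ι → M → G} (hg : ∀ i, SmFun (g i) x)
    (hb : ∀ᶠ y in 𝓝 x, ∃ b : Module.Basis ι ℂ G, ∀ i, b i = g i y) {u : M → G} (hu : SmFun u x)
    {t : ι → M → ℂ} (ht : ∀ᶠ y in 𝓝 x, ∑ i, t i y • g i y = u y) (i : ι) : SmFun (t i) x := by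
  classical
  let L : ι → G →L[ℝ] ((ι → ℂ) →L[ℝ] G) := fun i =>
    ((ContinuousLinearMap.compL ℝ (ι → ℂ) ℂ G).flip (ContinuousLinearMap.proj i)).comp
      (ContinuousLinearMap.lsmul ℝ ℂ).flip
  -- Near `x` the coefficient vector is `A(y)⁻¹ u(y)`, and inversion is smooth at invertible
  -- operators.
  let A : M → ((ι → ℂ) →L[ℝ] G) := fun y => ∑ i, L i (g i y)
  have hA : SmFun A x := SmFun.sum _ fun i _ => (hg i).clm (L i)
  have hAa : ∀ y c, A y c = ∑ i, c i • g i y := fun y c => by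
    simp [A, L]
  have : FiniteDimensional ℝ G := FiniteDimensional.complexToReal G
  have hinv : ∀ᶠ y in 𝓝 x, ContMDiffAt (𝓡 4) 𝓘(ℝ, ι → ℂ) ∞
      (fun z => (A z).inverse (u z)) y ∧ (A y).inverse (u y) = fun i => t i y := by
    filter_upwards [hA, hu, hb, ht] with y h1 h2 ⟨b, hbg⟩ hty
    let e : (ι → ℂ) ≃L[ℝ] G := (b.equivFun.symm.restrictScalars ℝ).toContinuousLinearEquiv
    have he : A y = e := by
      ext1 c
      rw [hAa]
      simp [e, Module.Basis.equivFun_symm_apply, hbg]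
    refine ⟨?_, ?_⟩
    · have h3 : ContDiffAt ℝ ∞ ContinuousLinearMap.inverse (A y) := by
        rw [he]
        exact contDiffAt_map_inverse e
      exact ContMDiffAt.clm_apply (h3.contMDiffAt.comp y h1) h2
    · rw [← hty, ← hAa y (fun i => t i y), he, ContinuousLinearMap.inverse_equiv]
      simp
  have : SmFun (fun y i => t i y) x := by
    filter_upwards [hinv.eventually_nhds] with y hy
    refine hy.self_of_nhds.1.congr_of_eventuallyEq ?_
    filter_upwards [hy] with z hz
    exact hz.2.symm
  exact this.clm (ContinuousLinearMap.proj i : (ι → ℂ) →L[ℝ] ℂ)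

/-! ### Local frames of complex vector bundles -/

section Bundle

variable {F : Type*} [NormedAddCommGroup F] [NormedSpace ℂ F] {V : M → Type*}
  [TopologicalSpace (TotalSpace F V)] [∀ x, AddCommGroup (V x)] [∀ x, Module ℝ (V x)]
  [∀ x, Module ℂ (V x)] [∀ x, IsScalarTower ℝ ℂ (V x)]
  [∀ x, TopologicalSpace (V x)] [FiberBundle F V] [VectorBundle ℂ F V] [VectorBundle ℝ F V]
  [ContMDiffVectorBundle ∞ F V (𝓡 4)] {x : M}

lemma smoothSec_iff {s : ∀ x, V x} :
    SmoothSec F s x ↔ SmFun (fun y => (trivializationAt F V x).linearMapAt ℂ y (s y)) x := by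
  have hx := (trivializationAt F V x).open_baseSet.mem_nhds
    (FiberBundle.mem_baseSet_trivializationAt F V x)
  refine Filter.eventually_congr ?_
  filter_upwards [hx] with y hy
  rw [(trivializationAt F V x).contMDiffAt_section_iff hy]
  refine Filter.EventuallyEq.contMDiffAt_iff ?_
  filter_upwards [(trivializationAt F V x).open_baseSet.mem_nhds hy] with z hz
  rw [Trivialization.coe_linearMapAt_of_mem _ hz]

lemma SmoothSec.csmul {f : M → ℂ} {s : ∀ x, V x} (hf : SmFun f x) (hs : SmoothSec F s x) :
    SmoothSec F (fun y => f y • s y) x := by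
  rw [smoothSec_iff] at hs ⊢
  simpa using hf.csmul hs

/-- The local frame of a complex vector bundle given by its preferred trivialization at `x`. -/
def frameAt (F : Type*) [NormedAddCommGroup F] [NormedSpace ℂ F] {V : M → Type*}
    [TopologicalSpace (TotalSpace F V)] [∀ x, AddCommGroup (V x)]
    [∀ x, TopologicalSpace (V x)] [FiberBundle F V] (x : M)
    (k : Fin (Module.finrank ℂ F)) [FiniteDimensional ℂ F] (y : M) : V y :=
  (trivializationAt F V x).symm y (Module.finBasis ℂ F k)

/-- The coefficients of a section in the frame `frameAt`. -/
def frameCoeff (F : Type*) [NormedAddCommGroup F] [NormedSpace ℂ F] {V : M → Type*}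
    [TopologicalSpace (TotalSpace F V)] [∀ x, AddCommGroup (V x)] [∀ x, Module ℂ (V x)]
    [∀ x, TopologicalSpace (V x)] [FiberBundle F V] [VectorBundle ℂ F V] (x : M)
    (k : Fin (Module.finrank ℂ F)) [FiniteDimensional ℂ F] (y : M) : V y →ₗ[ℂ] ℂ :=
  (Module.finBasis ℂ F).coord k ∘ₗ (trivializationAt F V x).linearMapAt ℂ y

variable [FiniteDimensional ℂ F]

lemma smoothSec_frameAt (k : Fin (Module.finrank ℂ F)) :
    SmoothSec F (frameAt F x k : ∀ y, V y) x := by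
  rw [smoothSec_iff]
  refine (SmFun.const (Module.finBasis ℂ F k)).congr ?_
  filter_upwards [(trivializationAt F V x).open_baseSet.mem_nhds
    (FiberBundle.mem_baseSet_trivializationAt F V x)] with y hy
  exact Trivialization.linearMapAt_symm _ hy _

lemma SmoothSec.frameCoeff {s : ∀ x, V x} (hs : SmoothSec F s x) (k : Fin (Module.finrank ℂ F)) :
    SmFun (fun y => frameCoeff F x k y (s y)) x :=
  (smoothSec_iff.1 hs).clm
    ((((Module.finBasis ℂ F).coord k).toContinuousLinearMap).restrictScalars ℝ)

lemma eventually_eq_sum_frame (F : Type*) [NormedAddCommGroup F] [NormedSpace ℂ F] (V : M → Type*)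
    [TopologicalSpace (TotalSpace F V)] [∀ x, AddCommGroup (V x)]
    [∀ x, Module ℂ (V x)] [∀ x, TopologicalSpace (V x)] [FiberBundle F V] [VectorBundle ℂ F V]
    [FiniteDimensional ℂ F] (x : M) :
    ∀ᶠ y in 𝓝 x, ∀ b : V y, b = ∑ k, EYM.frameCoeff F x k y b • frameAt F x k y := by
  filter_upwards [(trivializationAt F V x).open_baseSet.mem_nhds
    (FiberBundle.mem_baseSet_trivializationAt F V x)] with y hy b
  have h1 := (Module.finBasis ℂ F).sum_repr ((trivializationAt F V x).linearMapAt ℂ y b)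
  conv_lhs => rw [← Trivialization.symm_linearMapAt _ (R := ℂ) hy b, ← h1,
    ← Trivialization.symmₗ_apply (R := ℂ) _ hy, map_sum]
  refine Finset.sum_congr rfl fun k _ => ?_
  rw [map_smul, Trivialization.symmₗ_apply (R := ℂ) _ hy]
  rfl

end Bundle

end ComplexConnections

/-! ### Smooth sections and connections on the tensor product -/

section TensorConnections

variable {M : Type*} [TopologicalSpace M] [ChartedSpace E4 M] [IsManifold (𝓡 4) ∞ M]
  [RiemannianBundle (fun x : M => TangentSpace (𝓡 4) x)]
  [IsContMDiffRiemannianBundle (𝓡 4) ∞ E4 (fun x : M => TangentSpace (𝓡 4) x)]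
  {FB : Type*} [NormedAddCommGroup FB] [NormedSpace ℂ FB] [FiniteDimensional ℂ FB]
  {B : M → Type*} [TopologicalSpace (TotalSpace FB B)]
  [∀ x, Ring (B x)] [∀ x, Algebra ℂ (B x)] [∀ x, StarRing (B x)] [∀ x, StarModule ℂ (B x)]
  [∀ x, TopologicalSpace (B x)] [∀ x, IsTopologicalAddGroup (B x)]
  [∀ x, ContinuousSMul ℝ (B x)] [FiberBundle FB B]
  [VectorBundle ℂ FB B] [VectorBundle ℝ FB B] [ContMDiffVectorBundle ∞ FB B (𝓡 4)]
  {FS : Type*} [NormedAddCommGroup FS] [NormedSpace ℂ FS] [FiniteDimensional ℂ FS]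
  {S : M → Type*} [TopologicalSpace (TotalSpace FS S)]
  [∀ x, NormedAddCommGroup (S x)] [∀ x, InnerProductSpace ℂ (S x)] [FiberBundle FS S]
  [VectorBundle ℂ FS S] [VectorBundle ℝ FS S] [ContMDiffVectorBundle ∞ FS S (𝓡 4)]
  {x : M}

lemma smoothTensor_of_fintype {ι : Type*} [Fintype ι] {ξ : ∀ x, B x ⊗[ℂ] S x}
    {s : ι → ∀ x, B x} {ψ : ι → ∀ x, S x} (hs : ∀ i, SmoothSec FB (s i) x)
    (hψ : ∀ i, SmoothSec FS (ψ i) x) (h : ∀ᶠ y in 𝓝 x, ξ y = ∑ i, s i y ⊗ₜ[ℂ] ψ i y) :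
    SmoothTensor FB FS ξ x := by
  refine ⟨Fintype.card ι, fun i => s ((Fintype.equivFin ι).symm i),
    fun i => ψ ((Fintype.equivFin ι).symm i), fun i => hs _, fun i => hψ _, ?_⟩
  filter_upwards [h] with y hy
  rw [hy, ← (Fintype.equivFin ι).symm.sum_comp]

lemma SmoothTensor.tmul {s : ∀ x, B x} {ψ : ∀ x, S x} (hs : SmoothSec FB s x)
    (hψ : SmoothSec FS ψ x) : SmoothTensor FB FS (fun y => s y ⊗ₜ[ℂ] ψ y) x :=
  smoothTensor_of_fintype (ι := Unit) (fun _ => hs) (fun _ => hψ)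
    (Filter.Eventually.of_forall fun y => by simp)

lemma isSmoothClass_smoothTensor : IsSmoothClass (SmoothTensor FB FS (B := B) (S := S)) where
  eventually := by
    rintro ξ x ⟨n, s, ψ, h1, h2, h3⟩
    filter_upwards [Filter.eventually_all.2 fun i => isSmoothClass_smoothSec.eventually (h1 i),
      Filter.eventually_all.2 fun i => isSmoothClass_smoothSec.eventually (h2 i),
      h3.eventually_nhds] with y e1 e2 e3
    exact ⟨n, s, ψ, e1, e2, e3⟩
  congr := by
    rintro ξ η x ⟨n, s, ψ, h1, h2, h3⟩ h
    refine ⟨n, s, ψ, h1, h2, ?_⟩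
    filter_upwards [h3, h] with y e1 e2
    rw [e2, e1]
  zero x := smoothTensor_of_fintype (ι := Empty) (s := fun i => i.elim) (ψ := fun i => i.elim)
    (fun i => i.elim) (fun i => i.elim) (Filter.Eventually.of_forall fun y => by simp)
  add := by
    rintro ξ η x ⟨n, s, ψ, h1, h2, h3⟩ ⟨n', s', ψ', h1', h2', h3'⟩
    refine smoothTensor_of_fintype (ι := Fin n ⊕ Fin n') (s := Sum.elim s s')
      (ψ := Sum.elim ψ ψ') (fun i => ?_) (fun i => ?_) ?_
    · rcases i with i | i
      exacts [h1 i, h1' i]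
    · rcases i with i | i
      exacts [h2 i, h2' i]
    · filter_upwards [h3, h3'] with y e1 e2
      simp [e1, e2]
  smul := by
    rintro f ξ x hf ⟨n, s, ψ, h1, h2, h3⟩
    refine ⟨n, fun i y => f y • s i y, ψ, fun i => isSmoothClass_smoothSec.smul hf (h1 i), h2, ?_⟩
    filter_upwards [h3] with y e1
    rw [e1, Finset.smul_sum]
    exact Finset.sum_congr rfl fun i _ => (TensorProduct.smul_tmul' _ _ _).symm

lemma SmoothTensor.csmul {f : M → ℂ} {ξ : ∀ x, B x ⊗[ℂ] S x} (hf : SmFun f x)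
    (hξ : SmoothTensor FB FS ξ x) : SmoothTensor FB FS (fun y => f y • ξ y) x := by
  obtain ⟨n, s, ψ, h1, h2, h3⟩ := hξ
  refine ⟨n, fun i y => f y • s i y, ψ, fun i => (h1 i).csmul hf, h2, ?_⟩
  filter_upwards [h3] with y e1
  rw [e1, Finset.smul_sum]
  exact Finset.sum_congr rfl fun i _ => (TensorProduct.smul_tmul' _ _ _).symm

lemma SmoothTensor.map {f : ∀ x, B x →ₗ[ℂ] B x} {g : ∀ x, S x →ₗ[ℂ] S x}
    (hf : ∀ {s}, SmoothSec FB s x → SmoothSec FB (fun y => f y (s y)) x)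
    (hg : ∀ {ψ}, SmoothSec FS ψ x → SmoothSec FS (fun y => g y (ψ y)) x)
    {ξ : ∀ x, B x ⊗[ℂ] S x} (hξ : SmoothTensor FB FS ξ x) :
    SmoothTensor FB FS (fun y => TensorProduct.map (f y) (g y) (ξ y)) x := by
  obtain ⟨n, s, ψ, h1, h2, h3⟩ := hξ
  refine ⟨n, fun i y => f y (s i y), fun i y => g y (ψ i y), fun i => hf (h1 i), fun i => hg (h2 i),
    ?_⟩
  filter_upwards [h3] with y e1
  rw [e1, map_sum]
  rfl

/-- The coefficients of a section of `B ⊗ S` in the product of the frames at `x`. -/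
def tensorCoeff (FB FS : Type*) [NormedAddCommGroup FB] [NormedSpace ℂ FB]
    [FiniteDimensional ℂ FB] [NormedAddCommGroup FS] [NormedSpace ℂ FS] [FiniteDimensional ℂ FS]
    [TopologicalSpace (TotalSpace FB B)] [FiberBundle FB B] [VectorBundle ℂ FB B]
    [TopologicalSpace (TotalSpace FS S)] [FiberBundle FS S] [VectorBundle ℂ FS S]
    (x : M) (k : Fin (Module.finrank ℂ FB)) (a : Fin (Module.finrank ℂ FS)) (y : M) :
    B y ⊗[ℂ] S y →ₗ[ℂ] ℂ :=
  ((Module.finBasis ℂ FB).tensorProduct (Module.finBasis ℂ FS)).coord (k, a) ∘ₗ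
    TensorProduct.map ((trivializationAt FB B x).linearMapAt ℂ y)
      ((trivializationAt FS S x).linearMapAt ℂ y)

lemma tensorCoeff_tmul (k : Fin (Module.finrank ℂ FB)) (a : Fin (Module.finrank ℂ FS)) (y : M)
    (b : B y) (ψ : S y) :
    tensorCoeff FB FS x k a y (b ⊗ₜ ψ) = frameCoeff FB x k y b * frameCoeff FS x a y ψ := by
  simp [tensorCoeff, frameCoeff, mul_comm]

variable (FB B FS S x) in
lemma eventually_eq_sum_tensor : ∀ᶠ y in 𝓝 x, ∀ z : B y ⊗[ℂ] S y,
      z = ∑ k, ∑ a, tensorCoeff FB FS x k a y z • (frameAt FB x k y ⊗ₜ[ℂ] frameAt FS x a y) := by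
  filter_upwards [eventually_eq_sum_frame FB B x, eventually_eq_sum_frame FS S x] with y h1 h2 z
  induction z using TensorProduct.induction_on with
  | zero => simp
  | tmul b ψ =>
    conv_lhs => rw [h1 b, h2 ψ]
    rw [TensorProduct.sum_tmul]
    refine Finset.sum_congr rfl fun k _ => ?_
    rw [TensorProduct.tmul_sum]
    refine Finset.sum_congr rfl fun a _ => ?_
    rw [TensorProduct.smul_tmul_smul, tensorCoeff_tmul]
  | add z w hz hw =>
    conv_lhs => rw [hz, hw]
    simp only [map_add, add_smul, Finset.sum_add_distrib]

lemma SmoothTensor.tensorCoeff {ξ : ∀ x, B x ⊗[ℂ] S x} (hξ : SmoothTensor FB FS ξ x)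
    (k : Fin (Module.finrank ℂ FB)) (a : Fin (Module.finrank ℂ FS)) :
    SmFun (fun y => tensorCoeff FB FS x k a y (ξ y)) x := by
  obtain ⟨n, s, ψ, h1, h2, h3⟩ := hξ
  refine SmFun.congr (SmFun.sum Finset.univ fun i _ =>
    ((h1 i).frameCoeff k).mul ((h2 i).frameCoeff a)) ?_
  filter_upwards [h3] with y e1
  rw [e1, map_sum]
  exact Finset.sum_congr rfl fun i _ => tensorCoeff_tmul ..

lemma SmoothTensor.exists_global [T2Space M] {ξ : ∀ x, B x ⊗[ℂ] S x}
    (hξ : SmoothTensor FB FS ξ x) :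
    ∃ η : ∀ x, B x ⊗[ℂ] S x, (∀ y, SmoothTensor FB FS η y) ∧ ∀ᶠ y in 𝓝 x, η y = ξ y := by
  obtain ⟨n, s, ψ, h1, h2, h3⟩ := hξ
  choose s' hs' hs using fun i => (h1 i).exists_global
  choose ψ' hψ' hψ using fun i => (h2 i).exists_global
  refine ⟨fun y => ∑ i, s' i y ⊗ₜ ψ' i y, fun y => ⟨n, s', ψ', fun i => hs' i y, fun i => hψ' i y,
    Filter.Eventually.of_forall fun _ => rfl⟩, ?_⟩
  filter_upwards [h3, Filter.eventually_all.2 hs, Filter.eventually_all.2 hψ] with y e1 e2 e3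
  rw [e1]
  exact Finset.sum_congr rfl fun i _ => by rw [e2, e3]

variable (FB FS) in
-- Provides global sections with prescribed value at a point, so that identities between operators
-- on sections can be read off fibrewise.
lemma SmoothTensor.exists_eq [T2Space M]
    (z : B x ⊗[ℂ] S x) : ∃ ξ : ∀ x, B x ⊗[ℂ] S x, (∀ y, SmoothTensor FB FS ξ y) ∧ ξ x = z := by
  suffices h : ∃ ξ : ∀ x, B x ⊗[ℂ] S x, SmoothTensor FB FS ξ x ∧ ξ x = z by
    obtain ⟨ξ, h1, h2⟩ := h
    obtain ⟨η, h3, h4⟩ := h1.exists_global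
    exact ⟨η, h3, h4.self_of_nhds.trans h2⟩
  have hC := isSmoothClass_smoothTensor (FB := FB) (B := B) (FS := FS) (S := S)
  induction z using TensorProduct.induction_on with
  | zero => exact ⟨fun _ => 0, hC.zero x, rfl⟩
  | tmul b ψ => exact ⟨fun y => FiberBundle.extend FB b y ⊗ₜ FiberBundle.extend FS ψ y,
      SmoothTensor.tmul (SmoothSec.extend b) (SmoothSec.extend ψ), by simp⟩
  | add z w hz hw =>
    obtain ⟨ξ, h1, h2⟩ := hz
    obtain ⟨η, h3, h4⟩ := hw
    exact ⟨fun y => ξ y + η y, hC.add h1 h3, by simp [h2, h4]⟩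

/-- The tensor product of two connections. -/
def tensorConn (FB FS : Type*) [NormedAddCommGroup FB] [NormedSpace ℂ FB]
    [FiniteDimensional ℂ FB] [NormedAddCommGroup FS] [NormedSpace ℂ FS] [FiniteDimensional ℂ FS]
    [TopologicalSpace (TotalSpace FB B)] [FiberBundle FB B] [VectorBundle ℂ FB B]
    [TopologicalSpace (TotalSpace FS S)] [FiberBundle FS S] [VectorBundle ℂ FS S]
    (covB : (∀ x, B x) → ∀ x : M, TangentSpace (𝓡 4) x → B x)
    (covS : (∀ x, S x) → ∀ x : M, TangentSpace (𝓡 4) x → S x)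
    (ξ : ∀ x, B x ⊗[ℂ] S x) (x : M) (v : TangentSpace (𝓡 4) x) : B x ⊗[ℂ] S x :=
  ∑ k, ∑ a, (mvfderiv (𝓡 4) (fun y => tensorCoeff FB FS x k a y (ξ y)) x v •
      (frameAt FB x k x ⊗ₜ[ℂ] frameAt FS x a x)
    + tensorCoeff FB FS x k a x (ξ x) • (covB (frameAt FB x k) x v ⊗ₜ[ℂ] frameAt FS x a x
      + frameAt FB x k x ⊗ₜ[ℂ] covS (frameAt FS x a) x v))

lemma tensorNabla_eq (nB : CovariantDerivative (𝓡 4) FB B) (nS : CovariantDerivative (𝓡 4) FS S) :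
    tensorNabla nB nS = tensorConn FB FS (fun s x v => nB s x v) (fun ψ x v => nS ψ x v) := rfl

/-! ### The tensor product connection -/

section Conn

variable {covB : (∀ x, B x) → ∀ x : M, TangentSpace (𝓡 4) x → B x}
  {covS : (∀ x, S x) → ∀ x : M, TangentSpace (𝓡 4) x → S x}
  (hB : IsComplexConn (SmoothSec FB (V := B)) covB)
  (hS : IsComplexConn (SmoothSec FS (V := S)) covS)

lemma tensorConn_congr {ξ η : ∀ x, B x ⊗[ℂ] S x} (hξ : SmoothTensor FB FS ξ x)
    (h : ∀ᶠ y in 𝓝 x, η y = ξ y) (v : TangentSpace (𝓡 4) x) :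
    tensorConn FB FS covB covS η x v = tensorConn FB FS covB covS ξ x v := by
  simp only [tensorConn, h.self_of_nhds]
  refine Finset.sum_congr rfl fun k _ => Finset.sum_congr rfl fun a _ => ?_
  rw [mvfderiv_congr (hξ.tensorCoeff k a) (h.mono fun y hy => by rw [hy])]

lemma tensorConn_add {ξ η : ∀ x, B x ⊗[ℂ] S x} (hξ : SmoothTensor FB FS ξ x)
    (hη : SmoothTensor FB FS η x) (v : TangentSpace (𝓡 4) x) :
    tensorConn FB FS covB covS (fun y => ξ y + η y) x v
      = tensorConn FB FS covB covS ξ x v + tensorConn FB FS covB covS η x v := by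
  simp only [tensorConn, ← Finset.sum_add_distrib, map_add]
  refine Finset.sum_congr rfl fun k _ => Finset.sum_congr rfl fun a _ => ?_
  rw [(isLocalConn_mvfderiv (M := M) ℂ).cov_add (hξ.tensorCoeff k a) (hη.tensorCoeff k a)]
  module

include hB hS

/-- Expanding both factors in the frames at `x` reduces this to the product rule for the
coefficients. It also shows that the frames used in the definition do not matter. -/
lemma tensorConn_tmul {s : ∀ x, B x} {ψ : ∀ x, S x} (hs : SmoothSec FB s x)
    (hψ : SmoothSec FS ψ x) (v : TangentSpace (𝓡 4) x) :
    tensorConn FB FS covB covS (fun y => s y ⊗ₜ[ℂ] ψ y) x v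
      = covB s x v ⊗ₜ[ℂ] ψ x + s x ⊗ₜ[ℂ] covS ψ x v := by
  have h1 := eventually_eq_sum_frame FB B x
  have h2 := eventually_eq_sum_frame FS S x
  have ks : ∀ k, SmoothSec FB (fun y => frameCoeff FB x k y (s y) • (frameAt FB x k y : B y)) x :=
    fun k => (smoothSec_frameAt k).csmul (hs.frameCoeff k)
  have kψ : ∀ k, SmoothSec FS (fun y => frameCoeff FS x k y (ψ y) • (frameAt FS x k y : S y)) x :=
    fun k => (smoothSec_frameAt k).csmul (hψ.frameCoeff k)
  have e1 : covB s x v = ∑ k, (frameCoeff FB x k x (s x) • covB (frameAt FB x k) x v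
      + mvfderiv (𝓡 4) (fun y => frameCoeff FB x k y (s y)) x v • frameAt FB x k x) := by
    rw [hB.cov_congr (hB.sum Finset.univ fun k _ => ks k) (h1.mono fun y hy => hy (s y)),
      hB.cov_sum _ fun k _ => ks k]
    exact Finset.sum_congr rfl fun k _ => hB.cov_csmul (hs.frameCoeff k) (smoothSec_frameAt k) v
  have e2 : covS ψ x v = ∑ k, (frameCoeff FS x k x (ψ x) • covS (frameAt FS x k) x v
      + mvfderiv (𝓡 4) (fun y => frameCoeff FS x k y (ψ y)) x v • frameAt FS x k x) := by
    rw [hS.cov_congr (hS.sum Finset.univ fun k _ => kψ k) (h2.mono fun y hy => hy (ψ y)),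
      hS.cov_sum _ fun k _ => kψ k]
    exact Finset.sum_congr rfl fun k _ => hS.cov_csmul (hψ.frameCoeff k) (smoothSec_frameAt k) v
  rw [e1, e2, h1.self_of_nhds (s x), h2.self_of_nhds (ψ x)]
  simp only [TensorProduct.sum_tmul, TensorProduct.tmul_sum, tensorConn, tensorCoeff_tmul]
  rw [Finset.sum_comm (s := (Finset.univ : Finset (Fin (Module.finrank ℂ FS))))
    (t := (Finset.univ : Finset (Fin (Module.finrank ℂ FB)))),
    Finset.sum_comm (s := (Finset.univ : Finset (Fin (Module.finrank ℂ FS))))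
    (t := (Finset.univ : Finset (Fin (Module.finrank ℂ FB)))), ← Finset.sum_add_distrib]
  refine Finset.sum_congr rfl fun k _ => ?_
  rw [← Finset.sum_add_distrib]
  refine Finset.sum_congr rfl fun a _ => ?_
  rw [mvfderiv_mul (hs.frameCoeff k) (hψ.frameCoeff a)]
  simp only [← h1.self_of_nhds (s x), ← h2.self_of_nhds (ψ x), TensorProduct.add_tmul,
    TensorProduct.tmul_add, TensorProduct.smul_tmul_smul]
  module

lemma tensorConn_sum {ι : Type*} [Fintype ι] {ξ : ∀ x, B x ⊗[ℂ] S x} {s : ι → ∀ x, B x}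
    {ψ : ι → ∀ x, S x} (hs : ∀ i, SmoothSec FB (s i) x) (hψ : ∀ i, SmoothSec FS (ψ i) x)
    (h : ∀ᶠ y in 𝓝 x, ξ y = ∑ i, s i y ⊗ₜ[ℂ] ψ i y) (v : TangentSpace (𝓡 4) x) :
    tensorConn FB FS covB covS ξ x v
      = ∑ i, (covB (s i) x v ⊗ₜ[ℂ] ψ i x + s i x ⊗ₜ[ℂ] covS (ψ i) x v) := by
  classical
  have hC := isSmoothClass_smoothTensor (FB := FB) (B := B) (FS := FS) (S := S)
  have ht : ∀ i, SmoothTensor FB FS (fun y => s i y ⊗ₜ[ℂ] ψ i y) x := fun i =>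
    SmoothTensor.tmul (hs i) (hψ i)
  rw [tensorConn_congr (hC.sum Finset.univ fun i _ => ht i) h]
  have : ∀ I : Finset ι, tensorConn FB FS covB covS (fun y => ∑ i ∈ I, s i y ⊗ₜ[ℂ] ψ i y) x v
      = ∑ i ∈ I, (covB (s i) x v ⊗ₜ[ℂ] ψ i x + s i x ⊗ₜ[ℂ] covS (ψ i) x v) := by
    intro I
    induction I using Finset.induction_on with
    | empty =>
      have := tensorConn_add (covB := covB) (covS := covS) (hC.zero x) (hC.zero x) v
      simpa using this
    | insert a I ha ih =>
      simp only [Finset.sum_insert ha]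
      rw [tensorConn_add (ht a) (hC.sum I fun i _ => ht i), ih, tensorConn_tmul hB hS (hs a) (hψ a)]
  exact this _

/-- A smooth section is near the point a finite sum of elementary tensors, so `tensorConn_sum`
transfers each property from the two factors. -/
lemma isComplexConn_tensorConn :
    IsComplexConn (SmoothTensor FB FS (B := B) (S := S)) (tensorConn FB FS covB covS) where
  toIsSmoothClass := isSmoothClass_smoothTensor
  cov_congr hξ h v := tensorConn_congr hξ h v
  cov_add hξ hη v := tensorConn_add hξ hη v
  cov_smul := by
    rintro f ξ x hf ⟨n, s, ψ, h1, h2, h3⟩ v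
    have hfs : ∀ i, SmoothSec FB (fun y => f y • s i y) x := fun i => hB.smul hf (h1 i)
    rw [tensorConn_sum hB hS h1 h2 h3, h3.self_of_nhds, tensorConn_sum hB hS hfs h2, Finset.smul_sum,
      Finset.smul_sum, ← Finset.sum_add_distrib]
    · refine Finset.sum_congr rfl fun i _ => ?_
      rw [hB.cov_smul hf (h1 i), TensorProduct.add_tmul, ← TensorProduct.smul_tmul',
        ← TensorProduct.smul_tmul', ← TensorProduct.smul_tmul']
      module
    · filter_upwards [h3] with y hy
      rw [hy, Finset.smul_sum]
      exact Finset.sum_congr rfl fun i _ => TensorProduct.smul_tmul' ..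
  cov_vadd ξ x v w := by
    simp only [tensorConn, ← Finset.sum_add_distrib, map_add, hB.cov_vadd, hS.cov_vadd]
    refine Finset.sum_congr rfl fun k _ => Finset.sum_congr rfl fun a _ => ?_
    simp only [TensorProduct.add_tmul, TensorProduct.tmul_add]
    module
  cov_vsmul ξ x c v := by
    simp only [tensorConn, Finset.smul_sum, map_smul, hB.cov_vsmul, hS.cov_vsmul]
    refine Finset.sum_congr rfl fun k _ => Finset.sum_congr rfl fun a _ => ?_
    simp only [real_smul_eq c, TensorProduct.tmul_smul, ← TensorProduct.smul_tmul']
    module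
  cov_smooth := by
    rintro X ξ x hX ⟨n, s, ψ, h1, h2, h3⟩
    have hC := isSmoothClass_smoothTensor (FB := FB) (B := B) (FS := FS) (S := S)
    refine hC.congr (hC.sum Finset.univ fun i _ => hC.add
      (SmoothTensor.tmul (hB.cov_smooth hX (h1 i)) (h2 i))
      (SmoothTensor.tmul (h1 i) (hS.cov_smooth hX (h2 i)))) ?_
    filter_upwards [Filter.eventually_all.2 fun i => isSmoothClass_smoothSec.eventually (h1 i),
      Filter.eventually_all.2 fun i => isSmoothClass_smoothSec.eventually (h2 i),
      h3.eventually_nhds] with y e1 e2 e3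
    exact tensorConn_sum hB hS e1 e2 e3 _
  I_smul hξ := hξ.csmul (SmFun.const Complex.I)
  cov_I := by
    rintro ξ x ⟨n, s, ψ, h1, h2, h3⟩ v
    rw [tensorConn_sum hB hS h1 h2 h3, tensorConn_sum hB hS (fun i => hB.I_smul (h1 i)) h2,
      Finset.smul_sum]
    · refine Finset.sum_congr rfl fun i _ => ?_
      rw [hB.cov_I (h1 i), ← TensorProduct.smul_tmul', ← TensorProduct.smul_tmul', smul_add]
    · filter_upwards [h3] with y hy
      rw [hy, Finset.smul_sum]
      exact Finset.sum_congr rfl fun i _ => TensorProduct.smul_tmul' ..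

end Conn

end TensorConnections

/-! ### The algebra bundle and the perturbed connection -/

section AlgebraBundleConnections

variable {M : Type*} [TopologicalSpace M] [ChartedSpace E4 M] [IsManifold (𝓡 4) ∞ M]
  [RiemannianBundle (fun x : M => TangentSpace (𝓡 4) x)]
  [IsContMDiffRiemannianBundle (𝓡 4) ∞ E4 (fun x : M => TangentSpace (𝓡 4) x)]
  {FB : Type*} [NormedAddCommGroup FB] [NormedSpace ℂ FB] [FiniteDimensional ℂ FB]
  {B : M → Type*} [TopologicalSpace (TotalSpace FB B)]
  [∀ x, Ring (B x)] [∀ x, Algebra ℂ (B x)] [∀ x, StarRing (B x)] [∀ x, StarModule ℂ (B x)]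
  [∀ x, TopologicalSpace (B x)] [∀ x, IsTopologicalAddGroup (B x)]
  [∀ x, ContinuousSMul ℝ (B x)] [FiberBundle FB B]
  [VectorBundle ℂ FB B] [VectorBundle ℝ FB B] [ContMDiffVectorBundle ∞ FB B (𝓡 4)]
  {FS : Type*} [NormedAddCommGroup FS] [NormedSpace ℂ FS] [FiniteDimensional ℂ FS]
  {S : M → Type*} [TopologicalSpace (TotalSpace FS S)]
  [∀ x, NormedAddCommGroup (S x)] [∀ x, InnerProductSpace ℂ (S x)] [FiberBundle FS S]
  [VectorBundle ℂ FS S] [VectorBundle ℝ FS S] [ContMDiffVectorBundle ∞ FS S (𝓡 4)]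
  {x : M}

/-- In a local `*`-isomorphism with `M_N(ℂ)` a section is smooth exactly when its matrix entries
are. Hence products and adjoints of smooth sections are smooth. -/
lemma IsMatrixAlgebraBundle.exists_coord {N : ℕ} (hB : IsMatrixAlgebraBundle FB B N) (x : M) :
    ∃ Φ : ∀ y, Matrix (Fin N) (Fin N) ℂ ≃⋆ₐ[ℂ] B y,
      ∀ s : ∀ y, B y, SmoothSec FB s x ↔ ∀ i j, SmFun (fun y => (Φ y).symm (s y) i j) x := by
  obtain ⟨Φ, hΦ⟩ := hB x
  refine ⟨Φ, fun s => ⟨fun hs i j => ?_, fun h => ?_⟩⟩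
  · refine smFun_coeff (ι := Fin N × Fin N)
      (g := fun p y => (trivializationAt FB B x).linearMapAt ℂ y (Φ y (Matrix.single p.1 p.2 1)))
      (t := fun p y => (Φ y).symm (s y) p.1 p.2) (fun p => smoothSec_iff.1 (hΦ _)) ?_
      (smoothSec_iff.1 hs) ?_ (i, j)
    · filter_upwards [(trivializationAt FB B x).open_baseSet.mem_nhds
        (FiberBundle.mem_baseSet_trivializationAt FB B x)] with y hy
      refine ⟨((Matrix.stdBasis ℂ (Fin N) (Fin N)).map (Φ y).toAlgEquiv.toLinearEquiv).map
        ((trivializationAt FB B x).linearEquivAt ℂ y hy), fun ⟨k, l⟩ => ?_⟩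
      simp [Matrix.stdBasis_eq_single, Trivialization.coe_linearMapAt_of_mem _ hy]
    · refine Filter.Eventually.of_forall fun y => ?_
      conv_rhs => rw [← (Φ y).apply_symm_apply (s y), Matrix.matrix_eq_sum_single ((Φ y).symm (s y))]
      rw [Fintype.sum_prod_type]
      simp only [map_sum]
      refine Finset.sum_congr rfl fun k _ => Finset.sum_congr rfl fun l _ => ?_
      rw [← map_smul, ← map_smul, Matrix.smul_single, smul_eq_mul, mul_one]
  · have : ∀ y, s y = ∑ i, ∑ j, (Φ y).symm (s y) i j • Φ y (Matrix.single i j 1) := by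
      intro y
      conv_lhs => rw [← (Φ y).apply_symm_apply (s y), Matrix.matrix_eq_sum_single ((Φ y).symm (s y))]
      simp only [map_sum]
      refine Finset.sum_congr rfl fun k _ => Finset.sum_congr rfl fun l _ => ?_
      rw [← map_smul, Matrix.smul_single, smul_eq_mul, mul_one]
    have hC := isSmoothClass_smoothSec (M := M) (F := FB) (V := B)
    exact hC.congr (hC.sum Finset.univ fun i _ => hC.sum Finset.univ fun j _ =>
      (hΦ (Matrix.single i j 1)).csmul (h i j)) (Filter.Eventually.of_forall this)

lemma SmoothSec.mul {N : ℕ} (hB : IsMatrixAlgebraBundle FB B N) {s s' : ∀ y, B y}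
    (hs : SmoothSec FB s x) (hs' : SmoothSec FB s' x) : SmoothSec FB (fun y => s y * s' y) x := by
  obtain ⟨Φ, hΦ⟩ := hB.exists_coord x
  rw [hΦ] at hs hs' ⊢
  intro i j
  simp only [map_mul, Matrix.mul_apply]
  exact SmFun.sum _ fun k _ => (hs i k).mul (hs' k j)

lemma SmoothSec.star {N : ℕ} (hB : IsMatrixAlgebraBundle FB B N) {s : ∀ y, B y}
    (hs : SmoothSec FB s x) : SmoothSec FB (fun y => star (s y)) x := by
  obtain ⟨Φ, hΦ⟩ := hB.exists_coord x
  rw [hΦ] at hs ⊢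
  intro i j
  simp only [map_star, Matrix.star_apply]
  exact (hs j i).conj

variable [T2Space M]

lemma IsHermitianStarAlgebraConnection.isComplexConn {t : TracialState FB B}
    {nB : CovariantDerivative (𝓡 4) FB B} (h : IsHermitianStarAlgebraConnection t nB) :
    IsComplexConn (SmoothSec FB (V := B)) (fun s x v => nB s x v) where
  toIsLocalConn := isLocalConn_covariantDerivative h.smooth
  I_smul hs := hs.csmul (SmFun.const Complex.I)
  cov_I hs v := h.complex _ _ v hs

lemma IsSpinConnection.isComplexConn
    {LC : CovariantDerivative (𝓡 4) E4 (fun x : M => TangentSpace (𝓡 4) x)}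
    {σ : SpinorStructure FS S}
    {nS : CovariantDerivative (𝓡 4) FS S} (h : IsSpinConnection LC σ nS) :
    IsComplexConn (SmoothSec FS (V := S)) (fun s x v => nS s x v) where
  toIsLocalConn := isLocalConn_covariantDerivative h.smooth
  I_smul hs := hs.csmul (SmFun.const Complex.I)
  cov_I hs v := h.complex _ _ v hs

/-! ### The perturbed connection on the algebra bundle -/

section Pert

variable {t : TracialState FB B} {nB : CovariantDerivative (𝓡 4) FB B}
  (hnB : IsHermitianStarAlgebraConnection t nB) {m : ℕ} {a b : Fin m → ∀ x, B x}

lemma pertForm_add (v w : TangentSpace (𝓡 4) x) :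
    pertForm nB a b x (v + w) = pertForm nB a b x v + pertForm nB a b x w := by
  simp [pertForm, mul_add, Finset.sum_add_distrib]

lemma pertForm_smul (c : ℝ) (v : TangentSpace (𝓡 4) x) :
    pertForm nB a b x (c • v) = c • pertForm nB a b x v := by
  simp [pertForm, Finset.smul_sum]

variable {N : ℕ} (hB : IsMatrixAlgebraBundle FB B N) (ha : ∀ j x, SmoothSec FB (a j) x)
  (hb : ∀ j x, SmoothSec FB (b j) x)

include hnB hB ha hb

lemma smoothSec_pertForm {X : ∀ x : M, TangentSpace (𝓡 4) x} (hX : SmoothVF X x) :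
    SmoothSec FB (fun y => pertForm nB a b y (X y)) x :=
  hnB.isComplexConn.sum Finset.univ fun j _ =>
    SmoothSec.mul hB (ha j x) (hnB.isComplexConn.cov_smooth hX (hb j x))

lemma isComplexConn_nablaPert :
    IsComplexConn (SmoothSec FB (V := B)) (nablaPert nB a b) where
  toIsSmoothClass := isSmoothClass_smoothSec
  cov_congr hs h v := by
    simp only [nablaPert]
    rw [hnB.isComplexConn.cov_congr hs h, h.self_of_nhds]
  cov_add hs ht v := by
    simp only [nablaPert]
    rw [hnB.isComplexConn.cov_add hs ht, mul_add, add_mul]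
    abel
  cov_smul hf hs v := by
    simp only [nablaPert]
    rw [hnB.isComplexConn.cov_smul hf hs, mul_smul_comm, smul_mul_assoc]
    module
  cov_vadd s x v w := by
    simp only [nablaPert, map_add, pertForm_add, mul_add, add_mul]
    abel
  cov_vsmul s x c v := by
    simp only [nablaPert, map_smul, pertForm_smul, mul_smul_comm, smul_mul_assoc]
    module
  cov_smooth hX hs := by
    have hC := isSmoothClass_smoothSec (M := M) (F := FB) (V := B)
    have hω := smoothSec_pertForm hnB hB ha hb hX
    exact hC.add (hnB.isComplexConn.cov_smooth hX hs)
      (hC.sub (SmoothSec.mul hB hω hs) (SmoothSec.mul hB hs hω))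
  I_smul hs := hs.csmul (SmFun.const Complex.I)
  cov_I hs v := by
    simp only [nablaPert]
    rw [hnB.isComplexConn.cov_I hs, mul_smul_comm, smul_mul_assoc]
    module

end Pert

/-- Right multiplication by `b` on a fibre of `B ⊗ S`. -/
def rightMul (b : B x) : (B x ⊗[ℂ] S x) →ₗ[ℂ] (B x ⊗[ℂ] S x) :=
  TensorProduct.map (LinearMap.mulRight ℂ b) LinearMap.id

@[simp] lemma leftMul_tmul (b s : B x) (ψ : S x) :
    leftMul b (s ⊗ₜ[ℂ] ψ) = (b * s) ⊗ₜ[ℂ] ψ := rfl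

@[simp] lemma rightMul_tmul (b s : B x) (ψ : S x) :
    rightMul b (s ⊗ₜ[ℂ] ψ) = (s * b) ⊗ₜ[ℂ] ψ := rfl

@[simp] lemma cliff_tmul (σ : SpinorStructure FS S) (v : TangentSpace (𝓡 4) x) (s : B x) (ψ : S x) :
    cliff σ v (s ⊗ₜ[ℂ] ψ) = s ⊗ₜ[ℂ] σ.c x v ψ := rfl

@[simp] lemma realStr_tmul (σ : SpinorStructure FS S) (s : B x) (ψ : S x) :
    realStr σ x (s ⊗ₜ[ℂ] ψ) = star s ⊗ₜ[ℂ] σ.J x ψ := rfl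

@[simp] lemma realStr_symm_tmul (σ : SpinorStructure FS S) (s : B x) (ψ : S x) :
    (realStr σ x).symm (s ⊗ₜ[ℂ] ψ) = star s ⊗ₜ[ℂ] (σ.J x).symm ψ := rfl

@[simp] lemma tensorInner_tmul (t : TracialState FB B) (s s' : B x) (ψ ψ' : S x) :
    tensorInner t x (s ⊗ₜ[ℂ] ψ) (s' ⊗ₜ[ℂ] ψ') = t.hs x s s' * inner ℂ ψ ψ' := rfl

lemma cliff_comm_leftMul (σ : SpinorStructure FS S) (v : TangentSpace (𝓡 4) x) (b : B x)
    (z : B x ⊗[ℂ] S x) : cliff σ v (leftMul b z) = leftMul b (cliff σ v z) := by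
  induction z using TensorProduct.induction_on with
  | zero => simp
  | tmul s ψ => simp
  | add z w hz hw => simp [hz, hw]

lemma leftMul_mul (b b' : B x) (z : B x ⊗[ℂ] S x) :
    leftMul (b * b') z = leftMul b (leftMul b' z) := by
  induction z using TensorProduct.induction_on with
  | zero => simp
  | tmul s ψ => simp [mul_assoc]
  | add z w hz hw => simp [hz, hw]

lemma leftMul_sum {ι : Type*} (I : Finset ι) (b : ι → B x) (z : B x ⊗[ℂ] S x) :
    leftMul (∑ i ∈ I, b i) z = ∑ i ∈ I, leftMul (b i) z := by
  induction z using TensorProduct.induction_on with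
  | zero => simp
  | tmul s ψ => simp [Finset.sum_mul, TensorProduct.sum_tmul]
  | add z w hz hw => simp [hz, hw, Finset.sum_add_distrib]

lemma SmoothTensor.cliff (σ : SpinorStructure FS S) {X : ∀ x : M, TangentSpace (𝓡 4) x}
    (hX : SmoothVF X x) {ξ : ∀ x, B x ⊗[ℂ] S x} (hξ : SmoothTensor FB FS ξ x) :
    SmoothTensor FB FS (fun y => cliff σ (X y) (ξ y)) x :=
  hξ.map (fun hs => hs) (fun hψ => σ.c_smooth _ _ _ hX hψ)

lemma SmoothTensor.realStr_symm {N : ℕ} (hB : IsMatrixAlgebraBundle FB B N)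
    (σ : SpinorStructure FS S) {ξ : ∀ x, B x ⊗[ℂ] S x} (hξ : SmoothTensor FB FS ξ x) :
    SmoothTensor FB FS (fun y => (realStr σ y).symm (ξ y)) x := by
  obtain ⟨n, s, ψ, h1, h2, h3⟩ := hξ
  -- Charge conjugation squares to `-1`, so its inverse is `-σ.J`.
  refine ⟨n, fun i y => star (s i y), fun i y => -σ.J y (ψ i y),
    fun i => SmoothSec.star hB (h1 i),
    fun i => isSmoothClass_smoothSec.neg (σ.J_smooth _ _ (h2 i)), ?_⟩
  filter_upwards [h3] with y e1
  rw [e1, map_sum]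
  refine Finset.sum_congr rfl fun i _ => ?_
  rw [realStr_symm_tmul]
  congr 1
  rw [LinearEquiv.symm_apply_eq, map_neg, σ.J_sq, neg_neg]

/-- The adjoint reverses products, so it turns left multiplication by `b` into right multiplication
by `star b`. Clifford multiplication passes through `J` unchanged because it commutes with `σ.J`. -/
lemma realStr_conj (σ : SpinorStructure FS S) (v : TangentSpace (𝓡 4) x) (b : B x)
    (z : B x ⊗[ℂ] S x) :
    realStr σ x (EYM.cliff σ v (EYM.leftMul b ((realStr σ x).symm z)))
      = EYM.cliff σ v (rightMul (star b) z) := by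
  induction z using TensorProduct.induction_on with
  | zero => simp
  | tmul s ψ => simp [σ.J_c]
  | add z w hz hw => simp [hz, hw]

/-! ### The fluctuation as a one-form with Clifford multiplication -/

section Fluctuation

variable {LC : CovariantDerivative (𝓡 4) E4 (fun x : M => TangentSpace (𝓡 4) x)}
  {σ : SpinorStructure FS S} {nS : CovariantDerivative (𝓡 4) FS S}
  (hnS : IsSpinConnection LC σ nS)
  {N : ℕ} (hB : IsMatrixAlgebraBundle FB B N) {t : TracialState FB B}
  {nB : CovariantDerivative (𝓡 4) FB B} (hnB : IsHermitianStarAlgebraConnection t nB)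
  {m : ℕ} {a b : Fin m → ∀ x, B x}
  (ha : ∀ j x, SmoothSec FB (a j) x) (hb : ∀ j x, SmoothSec FB (b j) x)

include hnS hB hnB hb

lemma tensorNabla_leftMul (j : Fin m) {ξ : ∀ x, B x ⊗[ℂ] S x} (hξ : SmoothTensor FB FS ξ x)
    (v : TangentSpace (𝓡 4) x) :
    tensorNabla nB nS (fun y => leftMul (b j y) (ξ y)) x v
      = leftMul (nB (b j) x v) (ξ x) + leftMul (b j x) (tensorNabla nB nS ξ x v) := by
  obtain ⟨n, s, ψ, h1, h2, h3⟩ := hξ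
  have c1 := hnB.isComplexConn
  have c2 := hnS.isComplexConn
  rw [tensorNabla_eq, tensorConn_sum c1 c2 h1 h2 h3, tensorConn_sum c1 c2
    (s := fun i y => b j y * s i y) (fun i => SmoothSec.mul hB (hb j x) (h1 i)) h2,
    h3.self_of_nhds]
  · simp only [map_sum, map_add, leftMul_tmul, ← Finset.sum_add_distrib]
    refine Finset.sum_congr rfl fun i _ => ?_
    rw [hnB.mul _ _ _ _ (hb j x) (h1 i), TensorProduct.add_tmul]
    abel
  · filter_upwards [h3] with y hy
    rw [hy, map_sum]
    rfl

/-- The commutator with `b_j` removes the derivative of `ξ` and keeps only `∇^B b_j`; hence `A` is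
an operator of order zero. -/
lemma fluct_eq {ξ : ∀ x, B x ⊗[ℂ] S x} (hξ : SmoothTensor FB FS ξ x) :
    fluct σ nB nS a b ξ x
      = ∑ i, cliff σ (onb x i) (leftMul (pertForm nB a b x (onb x i)) (ξ x)) := by
  simp only [fluct, dirac, tensorNabla_leftMul hnS hB hnB hb _ hξ, pertForm, leftMul_sum,
    leftMul_mul, map_sum, map_add, Finset.sum_add_distrib]
  simp only [cliff_comm_leftMul, add_sub_cancel_right, map_sum]
  exact Finset.sum_comm

lemma diracA_eq {ξ : ∀ x, B x ⊗[ℂ] S x} (hξ : SmoothTensor FB FS ξ x) :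
    diracA σ nB nS a b ξ x = ∑ i, cliff σ (onb x i) (tensorNabla nB nS ξ x (onb x i)
      + leftMul (pertForm nB a b x (onb x i)) (ξ x)
      + rightMul (star (pertForm nB a b x (onb x i))) (ξ x)) := by
  simp only [diracA, dirac, fluct_eq hnS hB hnB hb hξ,
    fluct_eq hnS hB hnB hb (hξ.realStr_symm hB σ), map_sum, realStr_conj, map_add,
    Finset.sum_add_distrib]

include ha in
-- Here the right multiplication carries `-θ`, while `diracA_eq` has `star θ`. The two agree once
-- `θ` is known to be skew.
lemma tensorConn_nablaPert {ξ : ∀ x, B x ⊗[ℂ] S x} (hξ : SmoothTensor FB FS ξ x)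
    (v : TangentSpace (𝓡 4) x) :
    tensorConn FB FS (nablaPert nB a b) (fun ψ x v => nS ψ x v) ξ x v
      = tensorNabla nB nS ξ x v + leftMul (pertForm nB a b x v) (ξ x)
        - rightMul (pertForm nB a b x v) (ξ x) := by
  obtain ⟨n, s, ψ, h1, h2, h3⟩ := hξ
  have c1 := hnB.isComplexConn
  have c2 := hnS.isComplexConn
  have c3 := isComplexConn_nablaPert hnB hB ha hb
  rw [tensorNabla_eq, tensorConn_sum c1 c2 h1 h2 h3, tensorConn_sum c3 c2 h1 h2 h3,
    h3.self_of_nhds]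
  simp only [map_sum, leftMul_tmul, rightMul_tmul, ← Finset.sum_add_distrib,
    ← Finset.sum_sub_distrib]
  refine Finset.sum_congr rfl fun i _ => ?_
  simp only [nablaPert, TensorProduct.add_tmul, TensorProduct.sub_tmul]
  abel

end Fluctuation

end AlgebraBundleConnections

/-! ### The fluctuated Dirac operator -/

section FluctuatedDirac

variable {M : Type*} [TopologicalSpace M] [ChartedSpace E4 M] [IsManifold (𝓡 4) ∞ M]
  [RiemannianBundle (fun x : M => TangentSpace (𝓡 4) x)]
  [IsContMDiffRiemannianBundle (𝓡 4) ∞ E4 (fun x : M => TangentSpace (𝓡 4) x)]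
  {FB : Type*} [NormedAddCommGroup FB] [NormedSpace ℂ FB] [FiniteDimensional ℂ FB]
  {B : M → Type*} [TopologicalSpace (TotalSpace FB B)]
  [∀ x, Ring (B x)] [∀ x, Algebra ℂ (B x)] [∀ x, StarRing (B x)] [∀ x, StarModule ℂ (B x)]
  [∀ x, TopologicalSpace (B x)] [∀ x, IsTopologicalAddGroup (B x)]
  [∀ x, ContinuousSMul ℝ (B x)] [FiberBundle FB B]
  [VectorBundle ℂ FB B] [VectorBundle ℝ FB B] [ContMDiffVectorBundle ∞ FB B (𝓡 4)]
  {FS : Type*} [NormedAddCommGroup FS] [NormedSpace ℂ FS] [FiniteDimensional ℂ FS]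
  {S : M → Type*} [TopologicalSpace (TotalSpace FS S)]
  [∀ x, NormedAddCommGroup (S x)] [∀ x, InnerProductSpace ℂ (S x)] [FiberBundle FS S]
  [VectorBundle ℂ FS S] [VectorBundle ℝ FS S] [ContMDiffVectorBundle ∞ FS S (𝓡 4)]
  {x : M} [T2Space M]

lemma TracialState.hs_apply (t : TracialState FB B) (s s' : B x) :
    t.hs x s s' = t.τ x (star s * s') := rfl

lemma SpinorStructure.finrank_eq (σ : SpinorStructure FS S) (x : M) :
    Module.finrank ℂ (S x) = 4 := by
  rw [← σ.rank]
  exact ((trivializationAt FS S x).linearEquivAt ℂ x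
    (FiberBundle.mem_baseSet_trivializationAt FS S x)).finrank_eq

lemma SpinorStructure.c_anticomm (σ : SpinorStructure FS S) (v w : TangentSpace (𝓡 4) x)
    (ψ : S x) : σ.c x v (σ.c x w ψ) + σ.c x w (σ.c x v ψ)
      = (-2 * inner ℝ v w : ℝ) • ψ := by
  have h1 := σ.c_sq x (v + w) ψ
  have h2 := σ.c_sq x v ψ
  have h3 := σ.c_sq x w ψ
  simp only [map_add, LinearMap.add_apply, inner_add_left, inner_add_right,
    real_inner_comm v w, h2, h3] at h1
  have h4 : σ.c x v (σ.c x w ψ) + σ.c x w (σ.c x v ψ)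
      = (-((inner ℝ v v : ℝ) : ℂ) • ψ + σ.c x w (σ.c x v ψ)
          + (σ.c x v (σ.c x w ψ) + -((inner ℝ w w : ℝ) : ℂ) • ψ))
        + ((inner ℝ v v : ℝ) + (inner ℝ w w : ℝ) : ℂ) • ψ := by module
  rw [h4, h1, real_smul_eq]
  push_cast
  module

/-! ### Consequences of self-adjointness of the fluctuation -/

section SelfAdjoint

variable {LC : CovariantDerivative (𝓡 4) E4 (fun x : M => TangentSpace (𝓡 4) x)}
  {σ : SpinorStructure FS S} {nS : CovariantDerivative (𝓡 4) FS S}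
  (hnS : IsSpinConnection LC σ nS)
  {N : ℕ} (hB : IsMatrixAlgebraBundle FB B N) {t : TracialState FB B}
  {nB : CovariantDerivative (𝓡 4) FB B} (hnB : IsHermitianStarAlgebraConnection t nB)
  {m : ℕ} {a b : Fin m → ∀ x, B x}
  (ha : ∀ j x, SmoothSec FB (a j) x) (hb : ∀ j x, SmoothSec FB (b j) x)
  (hA : ∀ ξ η : (∀ x, B x ⊗[ℂ] S x),
      (∀ x, SmoothTensor FB FS ξ x) → (∀ x, SmoothTensor FB FS η x) →
      ∀ x, tensorInner t x (fluct σ nB nS a b ξ x) (η x)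
        = tensorInner t x (ξ x) (fluct σ nB nS a b η x))

include hnS hB hnB hb hA

/-- Self-adjointness of the fluctuation makes its one-form skew-hermitian. -/
lemma star_pertForm (x : M) (v : TangentSpace (𝓡 4) x) :
    star (pertForm nB a b x v) = -pertForm nB a b x v := by
  set θ := pertForm nB a b x with hθ
  -- Self-adjointness is tested on sections with prescribed elementary tensors at `x`. Moving
  -- `c(e_i)` to the other side of the inner product costs a sign, which produces `star θ + θ`.
  have h1 : ∀ (s s' : B x) (ψ φ : S x),
      ∑ i, t.τ x (star s * (star (θ (onb x i)) + θ (onb x i)) * s')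
        * inner ℂ (σ.c x (onb x i) ψ) φ = 0 := by
    intro s s' ψ φ
    obtain ⟨ξ, hξ, hξx⟩ := SmoothTensor.exists_eq FB FS (s ⊗ₜ[ℂ] ψ)
    obtain ⟨η, hη, hηx⟩ := SmoothTensor.exists_eq FB FS (s' ⊗ₜ[ℂ] φ)
    have := hA ξ η hξ hη x
    rw [fluct_eq hnS hB hnB hb (hξ x), fluct_eq hnS hB hnB hb (hη x), hξx, hηx, ← sub_eq_zero] at this
    rw [← this]
    simp only [map_sum, LinearMap.sum_apply, leftMul_tmul, cliff_tmul, tensorInner_tmul,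
      ← Finset.sum_sub_distrib]
    refine Finset.sum_congr rfl fun i _ => ?_
    have e : inner ℂ ψ (σ.c x (onb x i) φ) = -inner ℂ (σ.c x (onb x i) ψ) φ := by
      rw [σ.c_skew, neg_neg]
    rw [e]
    simp only [TracialState.hs_apply, star_mul, mul_add, add_mul, map_add, mul_assoc, ← hθ]
    ring
  have h2 : ∀ (s s' : B x) (ψ : S x),
      ∑ i, conj (t.τ x (star s * (star (θ (onb x i)) + θ (onb x i)) * s')) • σ.c x (onb x i) ψ
        = 0 := by
    intro s s' ψ
    refine ext_inner_right ℂ fun φ => ?_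
    rw [inner_zero_left, sum_inner, ← h1 s s' ψ φ]
    refine Finset.sum_congr rfl fun i _ => ?_
    rw [inner_smul_left, Complex.conj_conj]
  -- Taking the anticommutator of the relation `h2` with `c(e_k)` kills all terms except the `k`-th.
  have h3 : ∀ (s s' : B x) k, t.τ x (star s * (star (θ (onb x k)) + θ (onb x k)) * s') = 0 := by
    intro s s' k
    obtain ⟨ψ, hψ⟩ : ∃ ψ : S x, ψ ≠ 0 := by
      have : Nontrivial (S x) := Module.nontrivial_of_finrank_pos (R := ℂ) (by
        rw [σ.finrank_eq x]; norm_num)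
      exact exists_ne 0
    have e1 := congrArg (σ.c x (onb x k)) (h2 s s' ψ)
    have e2 := h2 s s' (σ.c x (onb x k) ψ)
    rw [map_zero, map_sum] at e1
    have e3 := congrArg₂ (· + ·) e1 e2
    simp only [map_smul, ← Finset.sum_add_distrib, ← smul_add, σ.c_anticomm, add_zero,
      orthonormal_iff_ite.1 (onb x).orthonormal, mul_ite, mul_one, mul_zero, ite_smul, zero_smul,
      smul_ite, smul_zero, Finset.sum_ite_eq, Finset.mem_univ, if_true] at e3
    rw [real_smul_eq, smul_smul] at e3
    rcases smul_eq_zero.1 e3 with h | h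
    · simpa using h
    · exact absurd h hψ
  -- With `s = star θ + θ` and `s' = 1` the trace becomes that of `star s * s`, and faithfulness
  -- applies.
  have h4 : ∀ k, star (θ (onb x k)) + θ (onb x k) = 0 := fun k =>
    t.faithful x _ (by simpa using h3 (star (θ (onb x k)) + θ (onb x k)) 1 k)
  have h5 : ∀ w, θ w = ∑ k, (inner ℝ (onb x k) w : ℝ) • θ (onb x k) := by
    intro w
    let L : TangentSpace (𝓡 4) x →ₗ[ℝ] B x :=
      ⟨⟨θ, fun v w => pertForm_add v w⟩, fun c v => pertForm_smul c v⟩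
    have := congrArg L ((onb x).sum_repr' w)
    rw [map_sum] at this
    simp only [map_smul] at this
    exact this.symm
  have hr : ∀ (r : ℝ) (z : B x), star (r • z) = r • star z := fun r z => by
    rw [real_smul_eq, real_smul_eq, star_smul]
    simp
  rw [eq_neg_iff_add_eq_zero, h5 v, star_sum]
  simp only [hr, ← Finset.sum_add_distrib, ← smul_add, h4, smul_zero, Finset.sum_const_zero]

include ha

/-- The fluctuated Dirac operator is the Dirac operator of the perturbed connection. -/
lemma diracA_eq_diracOp {ξ : ∀ x, B x ⊗[ℂ] S x} (hξ : SmoothTensor FB FS ξ x) :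
    diracA σ nB nS a b ξ x = ∑ i, cliff σ (onb x i)
      (tensorConn FB FS (nablaPert nB a b) (fun ψ x v => nS ψ x v) ξ x (onb x i)) := by
  rw [diracA_eq hnS hB hnB hb hξ]
  refine Finset.sum_congr rfl fun i _ => ?_
  rw [tensorConn_nablaPert hnS hB hnB ha hb hξ, star_pertForm hnS hB hnB hb hA]
  congr 1
  have : ∀ (c : B x) (z : B x ⊗[ℂ] S x), rightMul (-c) z = -rightMul c z := by
    intro c z
    induction z using TensorProduct.induction_on with
    | zero => simp
    | tmul s ψ => simp [TensorProduct.neg_tmul]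
    | add z w hz hw => rw [map_add, hz, hw, map_add, neg_add]
  rw [this]
  abel

/-- The commutator with a skew element is skew for `τ(s^* s')` because `τ` is a trace. -/
lemma nablaPert_hermitian {s s' : ∀ x, B x} (hs : SmoothSec FB s x) (hs' : SmoothSec FB s' x)
    (v : TangentSpace (𝓡 4) x) :
    mvfderiv (𝓡 4) (fun y => t.hs y (s y) (s' y)) x v
      = t.hs x (nablaPert nB a b s x v) (s' x) + t.hs x (s x) (nablaPert nB a b s' x v) := by
  have h := hnB.hermitian s s' x v hs hs'
  rw [dC] at h
  rw [h]
  have hθ := star_pertForm hnS hB hnB hb hA x v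
  simp only [nablaPert, TracialState.hs_apply]
  simp only [star_add, star_sub, star_mul, hθ, mul_add, add_mul, mul_sub, sub_mul, map_add, map_sub, mul_neg, neg_mul, map_neg]
  have e : t.τ x (pertForm nB a b x v * star (s x) * s' x)
      = t.τ x (star (s x) * (s' x * pertForm nB a b x v)) := by
    rw [mul_assoc, t.trace_comm, mul_assoc]
  rw [e, ← mul_assoc (star (s x)) (pertForm nB a b x v)]
  ring

lemma tensorConn_hermitian {ξ η : ∀ x, B x ⊗[ℂ] S x} (hξ : SmoothTensor FB FS ξ x)
    (hη : SmoothTensor FB FS η x) (v : TangentSpace (𝓡 4) x) :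
    dC (fun y => tensorInner t y (ξ y) (η y)) x v
      = tensorInner t x
          (tensorConn FB FS (nablaPert nB a b) (fun ψ x v => nS ψ x v) ξ x v) (η x)
        + tensorInner t x (ξ x)
          (tensorConn FB FS (nablaPert nB a b) (fun ψ x v => nS ψ x v) η x v) := by
  obtain ⟨n, s, ψ, h1, h2, h3⟩ := hξ
  obtain ⟨n', s', ψ', h1', h2', h3'⟩ := hη
  have c2 := hnS.isComplexConn
  have c3 := isComplexConn_nablaPert hnB hB ha hb
  have k1 : ∀ i j, SmFun (fun y => t.hs y (s i y) (s' j y)) x := fun i j =>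
    t.smooth _ _ (SmoothSec.mul hB (SmoothSec.star hB (h1 i)) (h1' j))
  have k2 : ∀ i j, SmFun (fun y => inner ℂ (ψ i y) (ψ' j y)) x := fun i j =>
    σ.inner_smooth _ _ _ (h2 i) (h2' j)
  have k3 : ∀ i j, SmFun (fun y => t.hs y (s i y) (s' j y) * inner ℂ (ψ i y) (ψ' j y)) x :=
    fun i j => (k1 i j).mul (k2 i j)
  have hF := isLocalConn_mvfderiv (M := M) ℂ
  have e : ∀ᶠ y in 𝓝 x, tensorInner t y (ξ y) (η y)
      = ∑ i, ∑ j, t.hs y (s i y) (s' j y) * inner ℂ (ψ i y) (ψ' j y) := by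
    filter_upwards [h3, h3'] with y e1 e2
    rw [e1, e2]
    simp only [map_sum, LinearMap.sum_apply, tensorInner_tmul]
    exact Finset.sum_comm
  have hd : ∀ i j, mvfderiv (𝓡 4) (fun y => inner ℂ (ψ i y) (ψ' j y)) x v
      = inner ℂ (nS (ψ i) x v) (ψ' j x) + inner ℂ (ψ i x) (nS (ψ' j) x v) := fun i j =>
    hnS.hermitian _ _ _ _ (h2 i) (h2' j)
  rw [tensorConn_sum c3 c2 h1 h2 h3, tensorConn_sum c3 c2 h1' h2' h3', h3.self_of_nhds,
    h3'.self_of_nhds, dC, mvfderiv_congr (SmFun.sum _ fun i _ => SmFun.sum _ fun j _ => k3 i j) e,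
    hF.cov_sum _ fun i _ => SmFun.sum _ fun j _ => k3 i j]
  simp only [map_sum, LinearMap.sum_apply, map_add, LinearMap.add_apply, tensorInner_tmul]
  rw [Finset.sum_comm (s := (Finset.univ : Finset (Fin n')))]
  simp only [← Finset.sum_add_distrib]
  rw [Finset.sum_comm (s := (Finset.univ : Finset (Fin n')))]
  rw [← Finset.sum_add_distrib]
  refine Finset.sum_congr rfl fun i _ => ?_
  rw [hF.cov_sum _ fun j _ => k3 i j, ← Finset.sum_add_distrib]
  refine Finset.sum_congr rfl fun j _ => ?_
  rw [mvfderiv_mul (k1 i j) (k2 i j), hd,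
    nablaPert_hermitian hnS hB hnB ha hb hA (h1 i) (h1' j)]
  ring

end SelfAdjoint

end FluctuatedDirac

/-! ### Irreducibility of the spin representation -/

section Schur

variable {W : Type*} [AddCommGroup W] [Module ℂ W] [FiniteDimensional ℂ W]

/-- An involution on a subspace has an eigenvector. -/
lemma exists_eigenvector_involution {K : Submodule ℂ W} (a : W →ₗ[ℂ] W) (ha : ∀ w, a (a w) = w)
    (haK : ∀ w ∈ K, a w ∈ K) {w : W} (hw : w ∈ K) (hw0 : w ≠ 0) :
    ∃ (u : W) (ε : ℂ), u ∈ K ∧ u ≠ 0 ∧ ε ≠ 0 ∧ a u = ε • u ∧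
      ∀ b : W →ₗ[ℂ] W, (∀ z, b (a z) = a (b z)) → ∀ δ : ℂ, b w = δ • w → b u = δ • u := by
  -- Either `w` has eigenvalue `-1`, or `w + a w` is a nonzero vector with eigenvalue `1`. Both
  -- choices keep the eigenvalue of an operator commuting with `a`, so the construction can be
  -- repeated to obtain a joint eigenvector.
  by_cases h : w + a w = 0
  · refine ⟨w, -1, hw, hw0, by norm_num, ?_, fun b _ δ hδ => hδ⟩
    rw [neg_one_smul]
    exact eq_neg_of_add_eq_zero_right h
  · refine ⟨w + a w, 1, K.add_mem hw (haK w hw), h, one_ne_zero, ?_, fun b hb δ hδ => ?_⟩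
    · rw [map_add, ha, one_smul, add_comm]
    · rw [map_add, hb, hδ, map_smul, smul_add]

/-- Eigenvectors for the distinct eigenvalues `ε` and `-ε` are independent. -/
lemma eq_zero_of_add_eq_zero_of_eigen {ε : ℂ} (hε : ε ≠ 0) {p q : W} (a : W →ₗ[ℂ] W)
    (hp : a p = ε • p) (hq : a q = -(ε • q)) (h : p + q = 0) : p = 0 ∧ q = 0 := by
  have h1 := congrArg a h
  rw [map_add, hp, hq, map_zero, ← sub_eq_add_neg, ← smul_sub, smul_eq_zero_iff_right hε] at h1
  have h2 : (2 : ℂ) • p = 0 := by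
    rw [two_smul]
    nth_rw 2 [sub_eq_zero.1 h1]
    exact h
  have h3 : p = 0 := (smul_eq_zero.1 h2).resolve_left two_ne_zero
  exact ⟨h3, by rw [h3, zero_add] at h; exact h⟩

variable (hW : Module.finrank ℂ W = 4) (c : Fin 4 → W →ₗ[ℂ] W)
  (hc : ∀ i j w, c i (c j w) + c j (c i w) = if i = j then (-2 : ℂ) • w else 0)

include hW hc

/-- A joint eigenvector of two commuting involutions in `K` is moved by Clifford generators through
all four pairs of eigenvalue signs. The four vectors are independent and lie in `K`, and the
dimension is four. -/
lemma clifford_invariant_eq_top {K : Submodule ℂ W} (hK : ∀ i, ∀ w ∈ K, c i w ∈ K)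
    (hK0 : K ≠ ⊥) : K = ⊤ := by
  obtain ⟨w₀, hw₀, hw₀0⟩ := K.exists_mem_ne_zero_of_ne_bot hK0
  have sq : ∀ i w, c i (c i w) = -w := fun i w => by
    have := hc i i w
    rw [if_pos rfl, ← two_smul ℂ] at this
    have h2 : (2 : ℂ) • (c i (c i w) + w) = 0 := by
      rw [smul_add, this]
      module
    exact eq_neg_of_add_eq_zero_left ((smul_eq_zero.1 h2).resolve_left two_ne_zero)
  have anti : ∀ i j, i ≠ j → ∀ w, c i (c j w) = -c j (c i w) := fun i j hij w =>
    eq_neg_of_add_eq_zero_left (by rw [hc, if_neg hij])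
  -- The factor `I` makes the products square to `+1`. Multiplication by `c 0` reverses the sign of
  -- the eigenvalue of `a` and keeps that of `b`; multiplication by `c 2` does the opposite.
  let a : W →ₗ[ℂ] W := Complex.I • (c 0 ∘ₗ c 1)
  let b : W →ₗ[ℂ] W := Complex.I • (c 2 ∘ₗ c 3)
  have a_def : ∀ w, a w = Complex.I • c 0 (c 1 w) := fun w => rfl
  have b_def : ∀ w, b w = Complex.I • c 2 (c 3 w) := fun w => rfl
  have ha : ∀ w, a (a w) = w := fun w => by
    simp only [a_def, map_smul, smul_smul, Complex.I_mul_I]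
    rw [anti 1 0 (by decide), map_neg, sq, sq]
    simp
  have hb : ∀ w, b (b w) = w := fun w => by
    simp only [b_def, map_smul, smul_smul, Complex.I_mul_I]
    rw [anti 3 2 (by decide), map_neg, sq, sq]
    simp
  have hab : ∀ w, a (b w) = b (a w) := fun w => by
    simp only [a_def, b_def, map_smul]
    rw [anti 1 2 (by decide), anti 1 3 (by decide)]
    simp only [map_neg, neg_neg]
    rw [anti 0 2 (by decide), anti 0 3 (by decide)]
    simp only [map_neg, neg_neg]
  have haK : ∀ w ∈ K, a w ∈ K := fun w hw => K.smul_mem _ (hK _ _ (hK _ _ hw))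
  have hbK : ∀ w ∈ K, b w ∈ K := fun w hw => K.smul_mem _ (hK _ _ (hK _ _ hw))
  obtain ⟨w₁, ε, hw₁, hw₁0, hε, ha₁, -⟩ := exists_eigenvector_involution a ha haK hw₀ hw₀0
  obtain ⟨w, δ, hw, hw0, hδ, hbw, haw'⟩ := exists_eigenvector_involution b hb hbK hw₁ hw₁0
  have haw : a w = ε • w := haw' a hab ε ha₁
  have a0 : ∀ w, a (c 0 w) = -c 0 (a w) := fun w => by
    simp only [a_def, map_smul]
    rw [anti 1 0 (by decide), map_neg, smul_neg]
  have a2 : ∀ w, a (c 2 w) = c 2 (a w) := fun w => by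
    simp only [a_def, map_smul]
    rw [anti 1 2 (by decide), map_neg, anti 0 2 (by decide), neg_neg]
  have b0 : ∀ w, b (c 0 w) = c 0 (b w) := fun w => by
    simp only [b_def, map_smul]
    rw [anti 3 0 (by decide), map_neg, anti 2 0 (by decide), neg_neg]
  have b2 : ∀ w, b (c 2 w) = -c 2 (b w) := fun w => by
    simp only [b_def, map_smul]
    rw [anti 3 2 (by decide), map_neg, smul_neg]
  have ne : ∀ i w, w ≠ 0 → c i w ≠ 0 := fun i w h h' => h (by
    have := sq i w
    rw [h', map_zero] at this
    exact neg_eq_zero.1 this.symm)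
  have hli : LinearIndependent ℂ ![w, c 0 w, c 2 w, c 0 (c 2 w)] := by
    rw [Fintype.linearIndependent_iff]
    intro g hg
    rw [Fin.sum_univ_four] at hg
    simp only [Matrix.cons_val_zero, Matrix.cons_val_one, Matrix.cons_val] at hg
    -- Grouped by the eigenvalue of `a`; each group is then separated by `b`.
    have hg' : (g 0 • w + g 2 • c 2 w) + (g 1 • c 0 w + g 3 • c 0 (c 2 w)) = 0 := by
      rw [← hg]
      abel
    obtain ⟨e1, e2⟩ := eq_zero_of_add_eq_zero_of_eigen hε a (by
      simp only [map_add, map_smul, a2, haw]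
      module) (by
      simp only [map_add, map_smul, a0, a2, haw]
      module) hg'
    obtain ⟨f1, f2⟩ := eq_zero_of_add_eq_zero_of_eigen hδ b (by
      simp only [map_smul, hbw]
      module) (by
      simp only [map_smul, b2, hbw]
      module) e1
    obtain ⟨f3, f4⟩ := eq_zero_of_add_eq_zero_of_eigen hδ b (by
      simp only [map_smul, b0, hbw]
      module) (by
      simp only [map_smul, b0, b2, hbw, map_neg]
      module) e2
    intro i
    fin_cases i
    · exact (smul_eq_zero.1 f1).resolve_right hw0
    · exact (smul_eq_zero.1 f3).resolve_right (ne 0 _ hw0)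
    · exact (smul_eq_zero.1 f2).resolve_right (ne 2 _ hw0)
    · exact (smul_eq_zero.1 f4).resolve_right (ne 0 _ (ne 2 _ hw0))
  have hspan := hli.span_eq_top_of_card_eq_finrank' (by rw [hW]; rfl)
  rw [eq_top_iff, ← hspan, Submodule.span_le]
  rintro _ ⟨i, rfl⟩
  fin_cases i
  exacts [hw, hK 0 _ hw, hK 2 _ hw, hK 0 _ (hK 2 _ hw)]

/-- Schur's lemma for the spin representation in dimension four. -/
lemma clifford_schur (D : W →ₗ[ℂ] W) (hD : ∀ i w, D (c i w) = c i (D w)) :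
    ∃ z : ℂ, ∀ w, D w = z • w := by
  have : Nontrivial W := Module.nontrivial_of_finrank_pos (R := ℂ) (by rw [hW]; norm_num)
  obtain ⟨z, hz⟩ := Module.End.exists_eigenvalue (K := ℂ) (D : Module.End ℂ W)
  have := clifford_invariant_eq_top hW c hc (K := Module.End.eigenspace D z) (fun i w hw => by
    rw [Module.End.mem_eigenspace_iff] at hw ⊢
    rw [hD, hw, map_smul]) hz
  exact ⟨z, fun w => Module.End.mem_eigenspace_iff.1 (this ▸ Submodule.mem_top)⟩

end Schur

/-! ### The curvature of the spin connection -/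

section ParallelMap

variable {M : Type*} [TopologicalSpace M] [ChartedSpace E4 M] [IsManifold (𝓡 4) ∞ M]
  {V₁ V₂ : M → Type*} [∀ x, AddCommGroup (V₁ x)] [∀ x, Module ℝ (V₁ x)]
  [∀ x, AddCommGroup (V₂ x)] [∀ x, Module ℝ (V₂ x)]
  {Sm₁ : (∀ x, V₁ x) → M → Prop} {Sm₂ : (∀ x, V₂ x) → M → Prop}
  {cov₁ : (∀ x, V₁ x) → ∀ x : M, TangentSpace (𝓡 4) x → V₁ x}
  {cov₂ : (∀ x, V₂ x) → ∀ x : M, TangentSpace (𝓡 4) x → V₂ x}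

/-- Curvature operators commute with parallel maps. -/
lemma curvOp_map (h₁ : IsLocalConn Sm₁ cov₁) (h₂ : IsLocalConn Sm₂ cov₂)
    (β : ∀ x, V₁ x → V₂ x) (add : ∀ x a b, β x (a + b) = β x a + β x b)
    (hsm : ∀ {s x}, Sm₁ s x → Sm₂ (fun y => β y (s y)) x)
    (hβ : ∀ {s x}, Sm₁ s x → ∀ v, cov₂ (fun y => β y (s y)) x v = β x (cov₁ s x v))
    {s} {x : M} {X Y : ∀ x : M, TangentSpace (𝓡 4) x} (hX : SmoothVF X x) (hY : SmoothVF Y x)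
    (hs : Sm₁ s x) : curvOp cov₂ X Y (fun y => β y (s y)) x = β x (curvOp cov₁ X Y s x) := by
  have sub : ∀ x a b, β x (a - b) = β x a - β x b := fun x a b =>
    eq_sub_of_add_eq (by rw [← add, sub_add_cancel])
  have key : ∀ {Z W : ∀ x : M, TangentSpace (𝓡 4) x}, SmoothVF Z x →
      cov₂ (fun y => cov₂ (fun y => β y (s y)) y (Z y)) x (W x)
        = β x (cov₁ (fun y => cov₁ s y (Z y)) x (W x)) := by
    intro Z W hZ
    have a1 := h₁.cov_smooth hZ hs
    rw [← hβ a1]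
    refine h₂.cov_congr (hsm a1) ?_ _
    filter_upwards [h₁.eventually hs] with y b1 using hβ b1 _
  simp only [curvOp]
  rw [key hX, key hY, hβ hs, sub, sub]

end ParallelMap

/-! ### The curvature tensor of a complex connection -/

section ComplexCurvature

variable {M : Type*} [TopologicalSpace M] [ChartedSpace E4 M] [IsManifold (𝓡 4) ∞ M]
  [RiemannianBundle (fun x : M => TangentSpace (𝓡 4) x)]
  [IsContMDiffRiemannianBundle (𝓡 4) ∞ E4 (fun x : M => TangentSpace (𝓡 4) x)]
  [T2Space M] {LC : CovariantDerivative (𝓡 4) E4 (fun x : M => TangentSpace (𝓡 4) x)}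
  (hLC : IsLeviCivita LC)
  {F : Type*} [NormedAddCommGroup F] [NormedSpace ℂ F] [FiniteDimensional ℂ F] {V : M → Type*}
  [TopologicalSpace (TotalSpace F V)] [∀ x, AddCommGroup (V x)] [∀ x, Module ℝ (V x)]
  [∀ x, Module ℂ (V x)] [∀ x, IsScalarTower ℝ ℂ (V x)]
  [∀ x, TopologicalSpace (V x)] [FiberBundle F V] [VectorBundle ℝ F V]
  [ContMDiffVectorBundle ∞ F V (𝓡 4)]
  {cov : (∀ x, V x) → ∀ x : M, TangentSpace (𝓡 4) x → V x}
  (h : IsComplexConn (SmoothSec F (V := V)) cov) {x : M}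
include hLC h

lemma IsComplexConn.curvOp_eq_curv {X Y : ∀ x : M, TangentSpace (𝓡 4) x} (hX : SmoothVF X x)
    (hY : SmoothVF Y x) {s : ∀ x, V x} (hs : SmoothSec F s x) :
    curvOp cov X Y s x = curv F cov (X x) (Y x) (s x) :=
  have : FiniteDimensional ℝ F := FiniteDimensional.complexToReal F
  EYM.curvOp_eq_curv hLC h.toIsLocalConn hX hY hs

/-- The curvature tensor of a complex connection as a complex linear map. -/
def curvC (v w : TangentSpace (𝓡 4) x) : V x →ₗ[ℂ] V x where
  toFun b := curv F cov v w b
  map_add' b b' :=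
    have : FiniteDimensional ℝ F := FiniteDimensional.complexToReal F
    map_add (curvForm hLC h.toIsLocalConn x v w) b b'
  map_smul' c b := by
    have hb : SmoothSec F (FiberBundle.extend F b : ∀ y, V y) x := SmoothSec.extend b
    have := h.curvOp_eq_curv hLC (smoothVF_extVF v) (smoothVF_extVF w)
      (h.csmul (SmFun.const c) hb)
    simp only [extVF_self, FiberBundle.extend_apply_self] at this
    rw [← this, h.curvOp_const_csmul (smoothVF_extVF v) (smoothVF_extVF w) c hb]
    rfl

@[simp] lemma curvC_apply (v w : TangentSpace (𝓡 4) x) (b : V x) :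
    curvC hLC h v w b = curv F cov v w b := rfl

end ComplexCurvature

/-! ### The spin curvature from the Riemann tensor -/

section SpinCurvature

variable {M : Type*} [TopologicalSpace M] [ChartedSpace E4 M] [IsManifold (𝓡 4) ∞ M]
  [RiemannianBundle (fun x : M => TangentSpace (𝓡 4) x)]
  [IsContMDiffRiemannianBundle (𝓡 4) ∞ E4 (fun x : M => TangentSpace (𝓡 4) x)]
  {FB : Type*} [NormedAddCommGroup FB] [NormedSpace ℂ FB] [FiniteDimensional ℂ FB]
  {B : M → Type*} [TopologicalSpace (TotalSpace FB B)]
  [∀ x, Ring (B x)] [∀ x, Algebra ℂ (B x)] [∀ x, StarRing (B x)] [∀ x, StarModule ℂ (B x)]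
  [∀ x, TopologicalSpace (B x)] [∀ x, IsTopologicalAddGroup (B x)]
  [∀ x, ContinuousSMul ℝ (B x)] [FiberBundle FB B]
  [VectorBundle ℂ FB B] [VectorBundle ℝ FB B] [ContMDiffVectorBundle ∞ FB B (𝓡 4)]
  {FS : Type*} [NormedAddCommGroup FS] [NormedSpace ℂ FS] [FiniteDimensional ℂ FS]
  {S : M → Type*} [TopologicalSpace (TotalSpace FS S)]
  [∀ x, NormedAddCommGroup (S x)] [∀ x, InnerProductSpace ℂ (S x)] [FiberBundle FS S]
  [VectorBundle ℂ FS S] [VectorBundle ℝ FS S] [ContMDiffVectorBundle ∞ FS S (𝓡 4)]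
  {x : M} [T2Space M]
  {LC : CovariantDerivative (𝓡 4) E4 (fun x : M => TangentSpace (𝓡 4) x)}
  (hLC : IsLeviCivita LC) {σ : SpinorStructure FS S} {nS : CovariantDerivative (𝓡 4) FS S}
  (hnS : IsSpinConnection LC σ nS)

/-- The endomorphism of the spinors induced by the bilinear form `r`. -/
def spinEnd (σ : SpinorStructure FS S) (e : Fin 4 → TangentSpace (𝓡 4) x)
    (r : Fin 4 → Fin 4 → ℝ) : S x →ₗ[ℂ] S x :=
  (1 / 4 : ℂ) • ∑ i, ∑ j, (r i j : ℂ) • (σ.c x (e i) ∘ₗ σ.c x (e j))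

lemma spinEnd_apply (e : Fin 4 → TangentSpace (𝓡 4) x) (r : Fin 4 → Fin 4 → ℝ) (ψ : S x) :
    spinEnd σ e r ψ = (1 / 4 : ℂ) • ∑ i, ∑ j, (r i j : ℂ) • σ.c x (e i) (σ.c x (e j) ψ) := by
  simp [spinEnd, LinearMap.sum_apply]

/-- For skew `r` this is the infinitesimal spin representation: moving `c(e_k)` past `c(e_i) c(e_j)`
leaves two contractions, which are equal by skewness and total `4 ∑ r k j c(e_j)`, whence the factor
`1/4`. -/
lemma spinEnd_commutator (e : OrthonormalBasis (Fin 4) ℝ (TangentSpace (𝓡 4) x))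
    {r : Fin 4 → Fin 4 → ℝ} (hr : ∀ i j, r i j = -r j i) (k : Fin 4) (ψ : S x) :
    spinEnd σ e r (σ.c x (e k) ψ) = σ.c x (∑ j, r k j • e j) ψ + σ.c x (e k) (spinEnd σ e r ψ) := by
  have h1 : ∀ i j, σ.c x (e i) (σ.c x (e j) (σ.c x (e k) ψ))
      = σ.c x (e k) (σ.c x (e i) (σ.c x (e j) ψ))
        + (if i = k then (2 : ℂ) • σ.c x (e j) ψ else 0)
        - (if j = k then (2 : ℂ) • σ.c x (e i) ψ else 0) := by
    intro i j
    have a1 := σ.c_anticomm (e j) (e k) ψ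
    have a2 := σ.c_anticomm (e i) (e k) (σ.c x (e j) ψ)
    rw [orthonormal_iff_ite.1 e.orthonormal, real_smul_eq] at a1 a2
    rw [eq_sub_of_add_eq a1, map_sub, eq_sub_of_add_eq a2, map_smul]
    split_ifs <;> push_cast <;> module
  simp only [spinEnd_apply, h1, smul_add, smul_sub, Finset.sum_add_distrib, Finset.sum_sub_distrib,
    smul_ite, smul_zero, Finset.sum_ite_eq', Finset.mem_univ, if_true, map_smul, map_sum,
    LinearMap.sum_apply, LinearMap.smul_apply]
  rw [Finset.sum_comm (f := fun i j => if i = k then (r i j : ℂ) • (2 : ℂ) • σ.c x (e j) ψ else 0)]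
  simp only [Finset.sum_ite_eq', Finset.mem_univ, if_true]
  have h2 : ∑ i, (r i k : ℂ) • (2 : ℂ) • σ.c x (e i) ψ
      = -∑ i, (r k i : ℂ) • (2 : ℂ) • σ.c x (e i) ψ := by
    rw [← Finset.sum_neg_distrib]
    refine Finset.sum_congr rfl fun i _ => ?_
    rw [hr i k]
    push_cast
    module
  have h3 : ∑ i, (r k i : ℂ) • (2 : ℂ) • σ.c x (e i) ψ
      = (2 : ℂ) • ∑ i, r k i • σ.c x (e i) ψ := by
    rw [Finset.smul_sum]
    refine Finset.sum_congr rfl fun i _ => ?_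
    rw [real_smul_eq]
    module
  rw [h2, h3]
  module

include hLC hnS

/-- Clifford multiplication is a parallel pairing of `TM` with `S`, so curvature acts on it as a
derivation. -/
lemma spin_curv_clifford (v w z : TangentSpace (𝓡 4) x) (ψ : S x) :
    curv FS (fun s x v => nS s x v) v w (σ.c x z ψ)
      = σ.c x (riem LC v w z) ψ + σ.c x z (curv FS (fun s x v => nS s x v) v w ψ) := by
  have hv := smoothVF_extVF v
  have hw := smoothVF_extVF w
  have hz := smoothVF_extVF z
  have hψ : SmoothSec FS (FiberBundle.extend FS ψ : ∀ y, S y) x := SmoothSec.extend ψ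
  have c2 := hnS.isComplexConn
  have := curvOp_pairing hLC.isLocalConn c2.toIsLocalConn c2.toIsLocalConn
    (fun x (z : TangentSpace (𝓡 4) x) (ψ : S x) => σ.c x z ψ) (fun x z z' ψ => by simp)
    (fun x z ψ ψ' => by simp) (fun h1 h2 => σ.c_smooth _ _ _ h1 h2)
    (fun h1 h2 v => hnS.clifford _ _ _ v h1 h2) hv hw hz hψ
  rw [c2.curvOp_eq_curv hLC hv hw (σ.c_smooth _ _ _ hz hψ),
    c2.curvOp_eq_curv hLC hv hw hψ, curvOp_eq_curv hLC hLC.isLocalConn hv hw hz] at this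
  simpa [riem] using this

/-- Charge conjugation is parallel. It is only antilinear, but `curvOp_map` asks for additivity
alone. -/
lemma spin_curv_J (v w : TangentSpace (𝓡 4) x) (ψ : S x) :
    curv FS (fun s x v => nS s x v) v w (σ.J x ψ)
      = σ.J x (curv FS (fun s x v => nS s x v) v w ψ) := by
  have hv := smoothVF_extVF v
  have hw := smoothVF_extVF w
  have hψ : SmoothSec FS (FiberBundle.extend FS ψ : ∀ y, S y) x := SmoothSec.extend ψ
  have c2 := hnS.isComplexConn
  have := curvOp_map c2.toIsLocalConn c2.toIsLocalConn (fun x (ψ : S x) => σ.J x ψ)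
    (fun x a b => map_add _ a b) (fun h => σ.J_smooth _ _ h) (fun h v => hnS.real _ _ v h) hv hw hψ
  rw [c2.curvOp_eq_curv hLC hv hw (σ.J_smooth _ _ hψ), c2.curvOp_eq_curv hLC hv hw hψ] at this
  simpa using this

/-- The hermitian metric is a parallel pairing into the flat trivial bundle. -/
lemma spin_curv_skew (v w : TangentSpace (𝓡 4) x) (ψ φ : S x) :
    inner ℂ (curv FS (fun s x v => nS s x v) v w ψ) φ
      + inner ℂ ψ (curv FS (fun s x v => nS s x v) v w φ) = 0 := by
  have hv := smoothVF_extVF v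
  have hw := smoothVF_extVF w
  have hψ : SmoothSec FS (FiberBundle.extend FS ψ : ∀ y, S y) x := SmoothSec.extend ψ
  have hφ : SmoothSec FS (FiberBundle.extend FS φ : ∀ y, S y) x := SmoothSec.extend φ
  have c2 := hnS.isComplexConn
  have := curvOp_pairing c2.toIsLocalConn c2.toIsLocalConn (isLocalConn_mvfderiv (M := M) ℂ)
    (fun x (ψ φ : S x) => inner ℂ ψ φ) (fun x a b c => inner_add_left a b c)
    (fun x a b c => inner_add_right a b c) (fun h1 h2 => σ.inner_smooth _ _ _ h1 h2)
    (fun h1 h2 v => hnS.hermitian _ _ _ v h1 h2) hv hw hψ hφ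
  rw [curvOp_mvfderiv hv hw (σ.inner_smooth _ _ _ hψ hφ), c2.curvOp_eq_curv hLC hv hw hψ,
    c2.curvOp_eq_curv hLC hv hw hφ] at this
  simpa using this.symm

/-- The curvature of the spin connection. -/
lemma spin_curv_eq (e : OrthonormalBasis (Fin 4) ℝ (TangentSpace (𝓡 4) x))
    (v w : TangentSpace (𝓡 4) x) (ψ : S x) :
    curv FS (fun s x v => nS s x v) v w ψ
      = spinEnd σ e (fun i j => inner ℝ (riem LC v w (e i)) (e j)) ψ := by
  set r : Fin 4 → Fin 4 → ℝ := fun i j => inner ℝ (riem LC v w (e i)) (e j) with hr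
  have hr' : ∀ i j, r i j = -r j i := fun i j => riem_skew hLC v w (e i) (e j)
  have hre : ∀ k, ∑ j, r k j • e j = riem LC v w (e k) := fun k => by
    conv_rhs => rw [← e.sum_repr' (riem LC v w (e k))]
    exact Finset.sum_congr rfl fun j _ => by rw [real_inner_comm]
  have c2 := hnS.isComplexConn
  -- Both terms of `D` have the same commutator with Clifford multiplication, so `D` commutes with
  -- it and Schur's lemma makes it a scalar `z`.
  let D : S x →ₗ[ℂ] S x := curvC hLC c2 v w - spinEnd σ e r
  have hD : ∀ ψ, D ψ = curv FS (fun s x v => nS s x v) v w ψ - spinEnd σ e r ψ := fun ψ => rfl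
  have : FiniteDimensional ℂ (S x) := Module.finite_of_finrank_pos (by
    rw [σ.finrank_eq x]; norm_num)
  have : Nontrivial (S x) := Module.nontrivial_of_finrank_pos (R := ℂ) (by
    rw [σ.finrank_eq x]; norm_num)
  obtain ⟨z, hz⟩ := clifford_schur (σ.finrank_eq x) (fun i => σ.c x (e i)) (fun i j ψ => by
    rw [σ.c_anticomm, orthonormal_iff_ite.1 e.orthonormal, real_smul_eq]
    split_ifs <;> simp) D (fun i ψ => by
    rw [hD, hD, spin_curv_clifford hLC hnS, spinEnd_commutator e hr', hre, map_sub]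
    abel)
  have h4 : conj (1 / 4 : ℂ) = 1 / 4 := by rw [map_div₀, map_one, map_ofNat]
  have hJ : ∀ ψ, D (σ.J x ψ) = σ.J x (D ψ) := fun ψ => by
    rw [hD, hD, spin_curv_J hLC hnS, map_sub]
    congr 1
    simp only [spinEnd_apply, map_smulₛₗ, map_sum, σ.J_c, Complex.conj_ofReal, h4]
  have hskew : ∀ ψ φ, inner ℂ (D ψ) φ + inner ℂ ψ (D φ) = 0 := fun ψ φ => by
    have a1 := spin_curv_skew hLC hnS v w ψ φ
    have a2 : inner ℂ (spinEnd σ e r ψ) φ + inner ℂ ψ (spinEnd σ e r φ) = 0 := by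
      simp only [spinEnd_apply, inner_smul_left, inner_smul_right, sum_inner, inner_sum,
        σ.c_skew, Complex.conj_ofReal, neg_neg]
      rw [Finset.sum_comm (f := fun i j => (r i j : ℂ)
        * inner ℂ ψ (σ.c x (e j) (σ.c x (e i) φ)))]
      rw [h4, ← mul_add, ← Finset.sum_add_distrib]
      refine mul_eq_zero_of_right _ (Finset.sum_eq_zero fun i _ => ?_)
      rw [← Finset.sum_add_distrib]
      refine Finset.sum_eq_zero fun j _ => ?_
      rw [hr' i j]
      push_cast
      ring
    rw [hD, hD, inner_sub_left, inner_sub_right]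
    linear_combination a1 - a2
  obtain ⟨φ, hφ⟩ := exists_ne (0 : S x)
  -- `D` commutes with the antilinear `σ.J`, so `z` is real; being also skew-hermitian, `D` has
  -- imaginary `z`.
  have z1 : conj z = z := by
    have := hJ φ
    rw [hz, hz, map_smulₛₗ] at this
    have hJφ : σ.J x φ ≠ 0 := fun h => hφ ((σ.J x).map_eq_zero_iff.1 h)
    exact (smul_left_injective ℂ hJφ this).symm
  have z2 : conj z + z = 0 := by
    have := hskew φ φ
    rw [hz, inner_smul_left, inner_smul_right, ← add_mul] at this
    exact (mul_eq_zero.1 this).resolve_right (inner_self_ne_zero.2 hφ)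
  have z0 : z = 0 := by
    rw [z1, ← two_mul] at z2
    exact (mul_eq_zero.1 z2).resolve_left two_ne_zero
  have := hz ψ
  rw [z0, zero_smul, hD, sub_eq_zero] at this
  exact this

end SpinCurvature

/-! ### The connection Laplacian -/

section Laplacian

variable {M : Type*} [TopologicalSpace M] [ChartedSpace E4 M] [IsManifold (𝓡 4) ∞ M]
  [RiemannianBundle (fun x : M => TangentSpace (𝓡 4) x)]
  [IsContMDiffRiemannianBundle (𝓡 4) ∞ E4 (fun x : M => TangentSpace (𝓡 4) x)]
  {W : M → Type*} [∀ x, AddCommGroup (W x)] [∀ x, Module ℝ (W x)]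

/-- The Laplacian of a connection. -/
def lap (LC : CovariantDerivative (𝓡 4) E4 (fun x : M => TangentSpace (𝓡 4) x))
    (cov : (∀ x, W x) → ∀ x : M, TangentSpace (𝓡 4) x → W x) (ξ : ∀ x, W x) (x : M) : W x :=
  -∑ i, (cov (fun y => cov ξ y (extVF (onb x i) y)) x (onb x i)
    - cov ξ x (LC (extVF (onb x i)) x (onb x i)))

variable [T2Space M] {LC : CovariantDerivative (𝓡 4) E4 (fun x : M => TangentSpace (𝓡 4) x)}
  (hLC : IsLeviCivita LC)
  {Sm : (∀ x, W x) → M → Prop} {cov : (∀ x, W x) → ∀ x : M, TangentSpace (𝓡 4) x → W x}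
  (h : IsLocalConn Sm cov) {x : M}
include hLC h

lemma lap_eq_secondCov {ξ : ∀ x, W x} (hξ : Sm ξ x)
    (e : OrthonormalBasis (Fin 4) ℝ (TangentSpace (𝓡 4) x)) :
    lap LC cov ξ x = -∑ i, secondCov hLC h ξ hξ (e i) (e i) := by
  rw [← trace_eq (secondCov hLC h ξ hξ) e (onb x)]
  rfl

/-- As for the Dirac operator, the bases `onb y` must be exchanged for a smooth orthonormal frame
before smoothness is visible. -/
lemma lap_smooth {ξ : ∀ x, W x} (hξ : Sm ξ x) : Sm (lap LC cov ξ) x := by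
  obtain ⟨E, h1, -, h3⟩ := exists_orthonormal_frame (onb x)
  refine h.congr (s := fun y => -∑ i, (cov (fun z => cov ξ z (E i z)) y (E i y)
    - cov ξ y (LC (E i) y (E i y)))) (h.neg (h.sum _ fun i _ => h.sub
      (h.cov_smooth (h1 i) (h.cov_smooth (h1 i) hξ))
      (h.cov_smooth (hLC.isLocalConn.cov_smooth (h1 i) (h1 i)) hξ))) ?_
  filter_upwards [h3, h.eventually hξ, Filter.eventually_all.2 fun i =>
    isSmoothClass_smoothVF.eventually (h1 i)] with y e1 e2 e3
  obtain ⟨b, hb⟩ := exists_orthonormalBasis_eq e1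
  rw [lap_eq_secondCov hLC h e2 b]
  simp only [hb]
  congr 1
  exact Finset.sum_congr rfl fun i _ => secondCov_vf hLC h e2 _ (e3 i)

lemma curvOp_sum {X Y : ∀ x : M, TangentSpace (𝓡 4) x} (hX : SmoothVF X x) (hY : SmoothVF Y x)
    {ι : Type*} (I : Finset ι) {s : ι → ∀ x, W x} (hs : ∀ i ∈ I, Sm (s i) x) :
    curvOp cov X Y (fun y => ∑ i ∈ I, s i y) x = ∑ i ∈ I, curvOp cov X Y (s i) x := by
  classical
  induction I using Finset.induction_on with
  | empty =>
    have := h.curvOp_add hX hY (h.zero x) (h.zero x)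
    simpa using this
  | insert a I ha ih =>
    simp only [Finset.sum_insert ha]
    rw [h.curvOp_add hX hY (hs a (by simp)) (h.sum I fun i hi => hs i (by simp [hi])),
      ih fun i hi => hs i (by simp [hi])]

end Laplacian

/-! ### Independence of the scalar curvature from the basis -/

section ScalarCurvature

variable {M : Type*} [TopologicalSpace M] [ChartedSpace E4 M] [IsManifold (𝓡 4) ∞ M]
  [RiemannianBundle (fun x : M => TangentSpace (𝓡 4) x)]
  [IsContMDiffRiemannianBundle (𝓡 4) ∞ E4 (fun x : M => TangentSpace (𝓡 4) x)]
  [T2Space M] {LC : CovariantDerivative (𝓡 4) E4 (fun x : M => TangentSpace (𝓡 4) x)}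

/-- Two successive traces, each independent of the orthonormal basis by `trace_eq`. -/
lemma scal_eq (hLC : IsLeviCivita LC) {x : M}
    (e : OrthonormalBasis (Fin 4) ℝ (TangentSpace (𝓡 4) x)) :
    scal LC x = ∑ i, ∑ j, inner ℝ (riem LC (e i) (e j) (e j)) (e i) := by
  let R := curvForm hLC hLC.isLocalConn x
  have hR : ∀ u v w, riem LC u v w = R u v w := fun u v w => rfl
  let I := innerₗ (TangentSpace (𝓡 4) x)
  have hI : ∀ u v, I u v = inner ℝ u v := fun u v => rfl
  simp only [scal, hR]
  have e1 : ∀ i, ∑ j, inner ℝ (R (onb x i) (onb x j) (onb x j)) (onb x i)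
      = ∑ j, inner ℝ (R (onb x i) (e j) (e j)) (onb x i) := fun i =>
    trace_eq ((R (onb x i)).compr₂ (I.flip (onb x i))) e (onb x)
  simp only [e1]
  rw [Finset.sum_comm]
  conv_rhs => rw [Finset.sum_comm]
  refine Finset.sum_congr rfl fun j _ => ?_
  exact trace_eq (I ∘ₗ (R.flip (e j)).flip (e j)) e (onb x)

end ScalarCurvature

/-! ### The square of the fluctuated Dirac operator -/

section FluctuatedSquare

variable {M : Type*} [TopologicalSpace M] [ChartedSpace E4 M] [IsManifold (𝓡 4) ∞ M]
  [RiemannianBundle (fun x : M => TangentSpace (𝓡 4) x)]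
  [IsContMDiffRiemannianBundle (𝓡 4) ∞ E4 (fun x : M => TangentSpace (𝓡 4) x)]
  {FB : Type*} [NormedAddCommGroup FB] [NormedSpace ℂ FB] [FiniteDimensional ℂ FB]
  {B : M → Type*} [TopologicalSpace (TotalSpace FB B)]
  [∀ x, Ring (B x)] [∀ x, Algebra ℂ (B x)] [∀ x, StarRing (B x)] [∀ x, StarModule ℂ (B x)]
  [∀ x, TopologicalSpace (B x)] [∀ x, IsTopologicalAddGroup (B x)]
  [∀ x, ContinuousSMul ℝ (B x)] [FiberBundle FB B]
  [VectorBundle ℂ FB B] [VectorBundle ℝ FB B] [ContMDiffVectorBundle ∞ FB B (𝓡 4)]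
  {FS : Type*} [NormedAddCommGroup FS] [NormedSpace ℂ FS] [FiniteDimensional ℂ FS]
  {S : M → Type*} [TopologicalSpace (TotalSpace FS S)]
  [∀ x, NormedAddCommGroup (S x)] [∀ x, InnerProductSpace ℂ (S x)] [FiberBundle FS S]
  [VectorBundle ℂ FS S] [VectorBundle ℝ FS S] [ContMDiffVectorBundle ∞ FS S (𝓡 4)]
  {x : M} [T2Space M]
  {LC : CovariantDerivative (𝓡 4) E4 (fun x : M => TangentSpace (𝓡 4) x)}
  (hLC : IsLeviCivita LC) {σ : SpinorStructure FS S} {nS : CovariantDerivative (𝓡 4) FS S}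
  (hnS : IsSpinConnection LC σ nS)
  {N : ℕ} (hB : IsMatrixAlgebraBundle FB B N) {t : TracialState FB B}
  {nB : CovariantDerivative (𝓡 4) FB B} (hnB : IsHermitianStarAlgebraConnection t nB)
  {m : ℕ} {a b : Fin m → ∀ x, B x}
  (ha : ∀ j x, SmoothSec FB (a j) x) (hb : ∀ j x, SmoothSec FB (b j) x)

/-- A real linear family of complex linear endomorphisms as a real bilinear map. -/
def realBilin {T W : Type*} [AddCommGroup T] [Module ℝ T] [AddCommGroup W] [Module ℂ W]
    (f : T → W →ₗ[ℂ] W)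
    (hadd : ∀ v w z, f (v + w) z = f v z + f w z)
    (hsmul : ∀ (c : ℝ) v z, f (c • v) z = (c : ℂ) • f v z) : T →ₗ[ℝ] W →ₗ[ℝ] W :=
  LinearMap.mk₂ ℝ (fun v z => f v z) hadd (fun c v z => by rw [hsmul, real_smul_eq])
    (fun v z w => map_add _ z w)
    (fun c v z => by rw [real_smul_eq, map_smul, real_smul_eq])

/-- Clifford multiplication on `B ⊗ S` as a real bilinear map. -/
def cliffR (σ : SpinorStructure FS S) (x : M) :=
  realBilin (W := B x ⊗[ℂ] S x) (fun v : TangentSpace (𝓡 4) x => cliff σ v)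
    (fun v w z => by
      induction z using TensorProduct.induction_on with
      | zero => simp
      | tmul s ψ => simp [TensorProduct.tmul_add]
      | add z w hz hw =>
        simp only [map_add, hz, hw]
        abel)
    (fun c v z => by
      induction z using TensorProduct.induction_on with
      | zero => simp
      | tmul s ψ =>
        rw [cliff_tmul, cliff_tmul, map_smul, LinearMap.smul_apply, real_smul_eq,
          TensorProduct.tmul_smul]
      | add z w hz hw => simp only [map_add, hz, hw, smul_add])

lemma cliffR_apply (v : TangentSpace (𝓡 4) x) (z : B x ⊗[ℂ] S x) :
    cliffR (B := B) σ x v z = cliff σ v z := rfl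

/-- The connection on `B ⊗ S` induced by the perturbed connection on `B` and the spin connection. -/
abbrev pertConn (nB : CovariantDerivative (𝓡 4) FB B) (nS : CovariantDerivative (𝓡 4) FS S)
    (a b : Fin m → ∀ x, B x) := tensorConn FB FS (nablaPert nB a b) (fun ψ x v => nS ψ x v)

include hnS hB hnB ha hb

lemma isComplexConn_pertConn :
    IsComplexConn (SmoothTensor FB FS (B := B) (S := S)) (pertConn nB nS a b) :=
  isComplexConn_tensorConn (isComplexConn_nablaPert hnB hB ha hb) hnS.isComplexConn

lemma pertConn_tmul {s : ∀ x, B x} {ψ : ∀ x, S x} (hs : SmoothSec FB s x)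
    (hψ : SmoothSec FS ψ x) (v : TangentSpace (𝓡 4) x) :
    pertConn nB nS a b (fun y => s y ⊗ₜ[ℂ] ψ y) x v
      = nablaPert nB a b s x v ⊗ₜ[ℂ] ψ x + s x ⊗ₜ[ℂ] nS ψ x v :=
  tensorConn_tmul (isComplexConn_nablaPert hnB hB ha hb) hnS.isComplexConn hs hψ v

lemma pertConn_sum {ι : Type*} [Fintype ι] {ξ : ∀ x, B x ⊗[ℂ] S x} {s : ι → ∀ x, B x}
    {ψ : ι → ∀ x, S x} (hs : ∀ i, SmoothSec FB (s i) x) (hψ : ∀ i, SmoothSec FS (ψ i) x)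
    (h : ∀ᶠ y in 𝓝 x, ξ y = ∑ i, s i y ⊗ₜ[ℂ] ψ i y) (v : TangentSpace (𝓡 4) x) :
    pertConn nB nS a b ξ x v
      = ∑ i, (nablaPert nB a b (s i) x v ⊗ₜ[ℂ] ψ i x + s i x ⊗ₜ[ℂ] nS (ψ i) x v) :=
  tensorConn_sum (isComplexConn_nablaPert hnB hB ha hb) hnS.isComplexConn hs hψ h v

/-- The perturbed connection acts on `B` and Clifford multiplication on `S`, so parallelism is
inherited from the spin connection. -/
lemma isCliffordConn_pertConn :
    IsCliffordConn LC (SmoothTensor FB FS (B := B) (S := S)) (pertConn nB nS a b) (cliffR σ) where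
  toIsLocalConn := (isComplexConn_pertConn hnS hB hnB ha hb).toIsLocalConn
  c_sq x v z := by
    simp only [cliffR_apply]
    induction z using TensorProduct.induction_on with
    | zero => simp
    | tmul s ψ =>
      rw [cliff_tmul, cliff_tmul, σ.c_sq, real_smul_eq, TensorProduct.tmul_smul]
      push_cast
      rfl
    | add z w hz hw => rw [map_add, map_add, hz, hw, smul_add]
  c_smooth hX hξ := hξ.cliff σ hX
  c_cov := by
    rintro X ξ x hX ⟨n, s, ψ, h1, h2, h3⟩ v
    simp only [cliffR_apply]
    rw [pertConn_sum hnS hB hnB ha hb h1 h2 h3, pertConn_sum hnS hB hnB ha hb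
      (ψ := fun i y => σ.c y (X y) (ψ i y)) h1 (fun i => σ.c_smooth _ _ _ hX (h2 i)),
      h3.self_of_nhds]
    · simp only [map_sum, map_add, cliff_tmul, ← Finset.sum_add_distrib]
      refine Finset.sum_congr rfl fun i _ => ?_
      rw [hnS.clifford _ _ _ v hX (h2 i), TensorProduct.tmul_add]
      abel
    · filter_upwards [h3] with y hy
      rw [hy, map_sum]
      rfl

include hLC

/-- The tensor product is a parallel pairing of `B` with `S`, so the curvatures add. -/
lemma curvOp_pertConn_tmul {X Y : ∀ x : M, TangentSpace (𝓡 4) x} (hX : SmoothVF X x)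
    (hY : SmoothVF Y x) {s : ∀ x, B x} {ψ : ∀ x, S x} (hs : SmoothSec FB s x)
    (hψ : SmoothSec FS ψ x) (e : OrthonormalBasis (Fin 4) ℝ (TangentSpace (𝓡 4) x)) :
    curvOp (pertConn nB nS a b) X Y (fun y => s y ⊗ₜ[ℂ] ψ y) x
      = curv FB (nablaPert nB a b) (X x) (Y x) (s x) ⊗ₜ[ℂ] ψ x
        + s x ⊗ₜ[ℂ] spinEnd σ e (fun i j => inner ℝ (riem LC (X x) (Y x) (e i)) (e j)) (ψ x) := by
  have c2 := hnS.isComplexConn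
  have c3 := isComplexConn_nablaPert hnB hB ha hb
  have c4 := isComplexConn_pertConn hnS hB hnB ha hb
  rw [curvOp_pairing c3.toIsLocalConn c2.toIsLocalConn c4.toIsLocalConn
    (fun x (s : B x) (ψ : S x) => s ⊗ₜ[ℂ] ψ) (fun x s s' ψ => TensorProduct.add_tmul s s' ψ)
    (fun x s ψ ψ' => TensorProduct.tmul_add s ψ ψ') (fun h1 h2 => SmoothTensor.tmul h1 h2)
    (fun h1 h2 v => pertConn_tmul hnS hB hnB ha hb h1 h2 v) hX hY hs hψ,
    c3.curvOp_eq_curv hLC hX hY hs, c2.curvOp_eq_curv hLC hX hY hψ,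
    spin_curv_eq hLC hnS e]

omit hB hnB ha hb in
-- `clifford_contract` gives twice the scalar curvature, and `spinEnd` carries the factor `1/4`.
lemma spin_lichnerowicz (e : OrthonormalBasis (Fin 4) ℝ (TangentSpace (𝓡 4) x)) (ψ : S x) :
    ∑ i, ∑ j, σ.c x (e i) (σ.c x (e j)
        (spinEnd σ e (fun k l => inner ℝ (riem LC (e i) (e j) (e k)) (e l)) ψ))
      = (1 / 2 : ℂ) • (scal LC x : ℂ) • ψ := by
  have := clifford_contract (A := Module.End ℂ (S x)) (fun i => σ.c x (e i)) (fun i j => by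
      ext ψ
      change σ.c x (e i) (σ.c x (e j) ψ) + σ.c x (e j) (σ.c x (e i) ψ) = _
      rw [σ.c_anticomm, orthonormal_iff_ite.1 e.orthonormal, real_smul_eq]
      split_ifs
      · push_cast
        have h2 : (2 : Module.End ℂ (S x)) ψ = ψ + ψ := by
          rw [← one_add_one_eq_two]
          rfl
        rw [LinearMap.neg_apply, h2]
        module
      · simp)
    (fun i j a b => inner ℝ (riem LC (e i) (e j) (e a)) (e b))
    (fun i j a b => riem_skew hLC _ _ _ _) (fun i j a b => riem_pair_symm hLC _ _ _ _)
    (fun i j a b => by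
      rw [← inner_add_left, ← inner_add_left, riem_bianchi hLC, inner_zero_left])
  have h2 := congrArg (fun f : Module.End ℂ (S x) => f ψ) this
  simp only [LinearMap.sum_apply, LinearMap.smul_apply, Module.End.mul_apply, Module.End.one_apply,
    ← scal_eq hLC e, real_smul_eq] at h2
  simp only [spinEnd_apply, map_smul, map_sum, ← Finset.smul_sum]
  rw [h2]
  push_cast
  module

omit hnS hB hnB ha hb hLC in
lemma sum_eq_two_sum_Ioi {A : Type*} [AddCommGroup A] [Module ℂ A] (g : Fin 4 → Fin 4 → A)
    (hs : ∀ i j, g i j = g j i) (hd : ∀ i, g i i = 0) :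
    ∑ i, ∑ j, g i j = (2 : ℂ) • ∑ i, ∑ j ∈ Finset.Ioi i, g i j := by
  have h0 : Finset.Ioi (0 : Fin 4) = {1, 2, 3} := by decide
  have h1 : Finset.Ioi (1 : Fin 4) = {2, 3} := by decide
  have h2 : Finset.Ioi (2 : Fin 4) = {3} := by decide
  have h3 : Finset.Ioi (3 : Fin 4) = ∅ := by decide
  simp only [Fin.sum_univ_four, h0, h1, h2, h3, hd, hs 1 0, hs 2 0, hs 3 0, hs 2 1, hs 3 1, hs 3 2,
    Finset.sum_empty, Finset.sum_singleton]
  rw [Finset.sum_insert (by decide), Finset.sum_insert (by decide), Finset.sum_insert (by decide),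
    Finset.sum_singleton, Finset.sum_singleton]
  module

omit hnS in
-- The curvature, and for `i ≠ j` also the product of Clifford generators, change sign when `i` and
-- `j` are exchanged, so the summand is symmetric; it vanishes on the diagonal because the curvature
-- does.
lemma sum_curv_cliff (e : OrthonormalBasis (Fin 4) ℝ (TangentSpace (𝓡 4) x)) (s : B x) (ψ : S x) :
    ∑ i, ∑ j, curv FB (nablaPert nB a b) (e i) (e j) s ⊗ₜ[ℂ] σ.c x (e i) (σ.c x (e j) ψ)
      = (2 : ℂ) • ∑ i, ∑ j ∈ Finset.Ioi i,
        curv FB (nablaPert nB a b) (e i) (e j) s ⊗ₜ[ℂ] σ.c x (e i) (σ.c x (e j) ψ) := by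
  have : FiniteDimensional ℝ FB := FiniteDimensional.complexToReal FB
  have c3 := isComplexConn_nablaPert hnB hB ha hb
  have hF : ∀ i j, curv FB (nablaPert nB a b) (e i) (e j) s
      = -curv FB (nablaPert nB a b) (e j) (e i) s := fun i j =>
    curv_antisymm hLC c3.toIsLocalConn _ _ s
  have hF0 : ∀ i, curv FB (nablaPert nB a b) (e i) (e i) s = 0 := fun i => by
    have h2 : (2 : ℂ) • curv FB (nablaPert nB a b) (e i) (e i) s = 0 := by
      rw [two_smul]
      nth_rw 1 [hF i i]
      exact neg_add_cancel _
    exact (smul_eq_zero.1 h2).resolve_left two_ne_zero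
  refine sum_eq_two_sum_Ioi _ (fun i j => ?_) (fun i => by rw [hF0, TensorProduct.zero_tmul])
  by_cases hij : i = j
  · rw [hij]
  · have : σ.c x (e i) (σ.c x (e j) ψ) = -σ.c x (e j) (σ.c x (e i) ψ) := by
      refine eq_neg_of_add_eq_zero_left ?_
      rw [σ.c_anticomm, orthonormal_iff_ite.1 e.orthonormal, if_neg hij]
      simp
    rw [hF i j, this, TensorProduct.neg_tmul, TensorProduct.tmul_neg, neg_neg]

omit hB hnB ha hb in
/-- The endomorphism appearing in the square of the Dirac operator. -/
def weitzEnd (σ : SpinorStructure FS S) {cov : (∀ x, B x) → ∀ x : M, TangentSpace (𝓡 4) x → B x}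
    (h : IsComplexConn (SmoothSec FB (V := B)) cov)
    (e : OrthonormalBasis (Fin 4) ℝ (TangentSpace (𝓡 4) x)) : Module.End ℂ (B x ⊗[ℂ] S x) :=
  -(1 / 4 : ℂ) • (scal LC x : ℂ) • LinearMap.id - ∑ i, ∑ j ∈ Finset.Ioi i,
    TensorProduct.map (curvC hLC h (e i) (e j)) (σ.c x (e i) ∘ₗ σ.c x (e j))

omit hnS hB hnB ha hb in
lemma weitzEnd_tmul {cov : (∀ x, B x) → ∀ x : M, TangentSpace (𝓡 4) x → B x}
    (h : IsComplexConn (SmoothSec FB (V := B)) cov)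
    (e : OrthonormalBasis (Fin 4) ℝ (TangentSpace (𝓡 4) x)) (s : B x) (ψ : S x) :
    weitzEnd hLC σ h e (s ⊗ₜ[ℂ] ψ) = -(1 / 4 : ℂ) • (scal LC x : ℂ) • (s ⊗ₜ[ℂ] ψ)
      - ∑ i, ∑ j ∈ Finset.Ioi i, curv FB cov (e i) (e j) s ⊗ₜ[ℂ] σ.c x (e i) (σ.c x (e j) ψ) := by
  simp only [weitzEnd, LinearMap.sub_apply, LinearMap.smul_apply, LinearMap.sum_apply,
    LinearMap.id_apply, TensorProduct.map_tmul, curvC_apply, LinearMap.comp_apply]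

/-- The curvature term in the square of the Dirac operator. -/
lemma sum_cliff_curvOp {ξ : ∀ x, B x ⊗[ℂ] S x} (hξ : SmoothTensor FB FS ξ x)
    (e : OrthonormalBasis (Fin 4) ℝ (TangentSpace (𝓡 4) x)) :
    (1 / 2 : ℂ) • ∑ i, ∑ j, cliffR σ x (e i) (cliffR σ x (e j)
        (curvOp (pertConn nB nS a b) (extVF (e i)) (extVF (e j)) ξ x))
      = -weitzEnd hLC σ (isComplexConn_nablaPert hnB hB ha hb) e (ξ x) := by
  have c4 := (isComplexConn_pertConn hnS hB hnB ha hb).toIsLocalConn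
  obtain ⟨n, s, ψ, h1, h2, h3⟩ := hξ
  have key : ∀ i j, curvOp (pertConn nB nS a b) (extVF (e i)) (extVF (e j)) ξ x
      = ∑ k, (curv FB (nablaPert nB a b) (e i) (e j) (s k x) ⊗ₜ[ℂ] ψ k x
        + s k x ⊗ₜ[ℂ] spinEnd σ e (fun k l => inner ℝ (riem LC (e i) (e j) (e k)) (e l)) (ψ k x)) := by
    intro i j
    have hi := smoothVF_extVF (e i)
    have hj := smoothVF_extVF (e j)
    rw [c4.curvOp_congr hi hj (c4.sum Finset.univ fun k _ => SmoothTensor.tmul (h1 k) (h2 k)) h3,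
      curvOp_sum hLC c4 hi hj _ fun k _ => SmoothTensor.tmul (h1 k) (h2 k)]
    refine Finset.sum_congr rfl fun k _ => ?_
    rw [curvOp_pertConn_tmul hLC hnS hB hnB ha hb hi hj (h1 k) (h2 k) e]
    simp
  simp only [key, h3.self_of_nhds, map_sum]
  -- The sum over elementary tensors is brought outside, so that each tensor can be treated
  -- separately.
  simp only [Finset.sum_comm (γ := Fin 4) (α := Fin n)]
  rw [Finset.smul_sum, ← Finset.sum_neg_distrib]
  refine Finset.sum_congr rfl fun k _ => ?_
  simp only [cliffR_apply, map_add, cliff_tmul, Finset.sum_add_distrib]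
  rw [sum_curv_cliff hLC hB hnB ha hb e]
  simp only [← TensorProduct.tmul_sum]
  rw [spin_lichnerowicz hLC hnS e, weitzEnd_tmul]
  simp only [TensorProduct.tmul_smul]
  module

lemma diracOp_sq_pertConn {ξ : ∀ x, B x ⊗[ℂ] S x} (hξ : SmoothTensor FB FS ξ x)
    (e : OrthonormalBasis (Fin 4) ℝ (TangentSpace (𝓡 4) x)) :
    diracOp (pertConn nB nS a b) (cliffR σ) (diracOp (pertConn nB nS a b) (cliffR σ) ξ) x
      = lap LC (pertConn nB nS a b) ξ x
        - weitzEnd hLC σ (isComplexConn_nablaPert hnB hB ha hb) e (ξ x) := by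
  have hD := isCliffordConn_pertConn (σ := σ) hnS hB hnB ha hb
  rw [hD.diracOp_sq_eq hLC hξ e, real_smul_eq, lap_eq_secondCov hLC hD.toIsLocalConn hξ e,
    sub_eq_add_neg, ← sum_cliff_curvOp hLC hnS hB hnB ha hb hξ e]
  push_cast
  rfl

/-- The endomorphism does not depend on the orthonormal basis. -/
lemma weitzEnd_eq (e e' : OrthonormalBasis (Fin 4) ℝ (TangentSpace (𝓡 4) x)) :
    weitzEnd (FS := FS) (S := S) hLC σ (isComplexConn_nablaPert hnB hB ha hb) e
      = weitzEnd hLC σ (isComplexConn_nablaPert hnB hB ha hb) e' := by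
  refine LinearMap.ext fun z => ?_
  obtain ⟨ξ, hξ, rfl⟩ := SmoothTensor.exists_eq FB FS z
  -- The square of the Dirac operator and the Laplacian do not mention `e`, so the remaining term
  -- cannot depend on it.
  have h1 := diracOp_sq_pertConn hLC hnS hB hnB ha hb (hξ x) e
  rw [diracOp_sq_pertConn hLC hnS hB hnB ha hb (hξ x) e'] at h1
  exact (sub_right_injective h1).symm

/-- Near the point the expression equals `∇^*∇ξ - D²ξ`, which is smooth; no regularity of `onb y` in
`y` is needed. -/
lemma weitzEnd_smooth {ξ : ∀ x, B x ⊗[ℂ] S x} (hξ : SmoothTensor FB FS ξ x) :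
    SmoothTensor FB FS (fun y => weitzEnd hLC σ (isComplexConn_nablaPert hnB hB ha hb)
      (onb y) (ξ y)) x := by
  have hD := isCliffordConn_pertConn (σ := σ) hnS hB hnB ha hb
  refine hD.congr (hD.sub (lap_smooth hLC hD.toIsLocalConn hξ)
    (hD.diracOp_smooth (hD.diracOp_smooth hξ))) ?_
  filter_upwards [hD.eventually hξ] with y hy
  rw [diracOp_sq_pertConn hLC hnS hB hnB ha hb hy (onb y), sub_sub_cancel]

omit hLC

omit hnS hB hnB ha hb in
-- For skew `r` the sum sees only the antisymmetric part of `c(e_i) c(e_j)`, which is half the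
-- commutator.
lemma curvature_normal_form (e : OrthonormalBasis (Fin 4) ℝ (TangentSpace (𝓡 4) x))
    {r : Fin 4 → Fin 4 → ℝ} (hr : ∀ i j, r i j = -r j i) (ψ : S x) :
    spinEnd σ e r ψ = (1 / 4 : ℂ) • ∑ i, ∑ j, (r i j : ℂ) •
      (1 / 2 : ℂ) • (σ.c x (e i) (σ.c x (e j) ψ) - σ.c x (e j) (σ.c x (e i) ψ)) := by
  rw [spinEnd_apply]
  congr 1
  simp only [smul_sub, Finset.sum_sub_distrib]
  have : ∑ i, ∑ j, (r i j : ℂ) • (1 / 2 : ℂ) • σ.c x (e j) (σ.c x (e i) ψ)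
      = -∑ i, ∑ j, (r i j : ℂ) • (1 / 2 : ℂ) • σ.c x (e i) (σ.c x (e j) ψ) := by
    rw [Finset.sum_comm, ← Finset.sum_neg_distrib]
    refine Finset.sum_congr rfl fun i _ => ?_
    rw [← Finset.sum_neg_distrib]
    refine Finset.sum_congr rfl fun j _ => ?_
    rw [hr j i]
    push_cast
    module
  rw [this, sub_neg_eq_add, ← two_smul ℂ]
  simp only [Finset.smul_sum]
  refine Finset.sum_congr rfl fun i _ => Finset.sum_congr rfl fun j _ => ?_
  module

section SelfAdjoint

variable
  (hA : ∀ ξ η : (∀ x, B x ⊗[ℂ] S x),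
      (∀ x, SmoothTensor FB FS ξ x) → (∀ x, SmoothTensor FB FS η x) →
      ∀ x, tensorInner t x (fluct σ nB nS a b ξ x) (η x)
        = tensorInner t x (ξ x) (fluct σ nB nS a b η x))

include hA

lemma diracA_eq_diracOp_pertConn {ξ : ∀ x, B x ⊗[ℂ] S x} (hξ : SmoothTensor FB FS ξ x) :
    diracA σ nB nS a b ξ x = diracOp (pertConn nB nS a b) (cliffR σ) ξ x :=
  diracA_eq_diracOp hnS hB hnB ha hb hA hξ

/-- The inner application has to be rewritten as a function on all of `M`, hence the global
smoothness assumption. The outer one needs smoothness near `x` only. -/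
lemma diracA_sq_eq {ξ : ∀ x, B x ⊗[ℂ] S x} (hξ : ∀ x, SmoothTensor FB FS ξ x) :
    diracA σ nB nS a b (diracA σ nB nS a b ξ) x
      = diracOp (pertConn nB nS a b) (cliffR σ) (diracOp (pertConn nB nS a b) (cliffR σ) ξ) x := by
  have h1 : diracA σ nB nS a b ξ = diracOp (pertConn nB nS a b) (cliffR σ) ξ :=
    funext fun y => diracA_eq_diracOp_pertConn hnS hB hnB ha hb hA (hξ y)
  rw [h1, diracA_eq_diracOp_pertConn hnS hB hnB ha hb hA
    ((isCliffordConn_pertConn hnS hB hnB ha hb).diracOp_smooth (hξ x))]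

end SelfAdjoint

end FluctuatedSquare

/-! ### The Laplacian in local coordinates -/

section Coordinates

variable {M : Type*} [TopologicalSpace M] [ChartedSpace E4 M] [IsManifold (𝓡 4) ∞ M]
  {φ : OpenPartialHomeomorph M E4} (hφ : φ ∈ IsManifold.maximalAtlas (𝓡 4) ∞ M)
  {x : M} (hx : x ∈ φ.source)

include hφ hx

lemma smFun_coord (μ : Fin 4) : SmFun (fun y => φ y μ) x := by
  filter_upwards [φ.open_source.mem_nhds hx] with y hy
  have h1 : ContMDiffAt (𝓡 4) 𝓘(ℝ, E4) ∞ φ y :=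
    (contMDiffOn_of_mem_maximalAtlas hφ).contMDiffAt (φ.open_source.mem_nhds hy)
  exact ((EuclideanSpace.proj μ : E4 →L[ℝ] ℝ).contDiff.contMDiff.contMDiffAt).comp y h1

lemma SmFun.contDiffAt_symm {u : M → ℂ} (hu : SmFun u x) :
    ∀ᶠ y in 𝓝 x, ContDiffAt ℝ ∞ (fun z => u (φ.symm z)) (φ y) := by
  filter_upwards [hu, φ.open_source.mem_nhds hx] with y h1 hy
  have h2 : ContMDiffAt 𝓘(ℝ, E4) (𝓡 4) ∞ φ.symm (φ y) :=
    (contMDiffOn_symm_of_mem_maximalAtlas hφ).contMDiffAt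
      (φ.open_target.mem_nhds (φ.map_source hy))
  refine contMDiffAt_iff_contDiffAt.1 (ContMDiffAt.comp (φ y) ?_ h2)
  rwa [φ.left_inv hy]

variable [RiemannianBundle (fun x : M => TangentSpace (𝓡 4) x)]
  [IsContMDiffRiemannianBundle (𝓡 4) ∞ E4 (fun x : M => TangentSpace (𝓡 4) x)]

lemma SmFun.pderiv {u : M → ℂ} (hu : SmFun u x) (μ : Fin 4) : SmFun (pderiv φ μ u) x := by
  filter_upwards [hu.contDiffAt_symm hφ hx, φ.open_source.mem_nhds hx] with y h1 hy
  have h2 : ContMDiffAt (𝓡 4) 𝓘(ℝ, E4) ∞ φ y :=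
    (contMDiffOn_of_mem_maximalAtlas hφ).contMDiffAt (φ.open_source.mem_nhds hy)
  have h3 : ContDiffAt ℝ ∞ (fderiv ℝ fun z => u (φ.symm z)) (φ y) :=
    h1.fderiv_right (by simp)
  exact (h3.clm_apply contDiffAt_const).contMDiffAt.comp y h2

lemma mvfderiv_eq_sum_pderiv {u : M → ℂ} (hu : SmFun u x) (v : TangentSpace (𝓡 4) x) :
    mvfderiv (𝓡 4) u x v
      = ∑ μ, EYM.pderiv φ μ u x * mvfderiv (𝓡 4) (fun y => (φ y μ : ℂ)) x v := by
  have h1 : MDifferentiableAt (𝓡 4) 𝓘(ℝ, E4) φ x :=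
    ((contMDiffOn_of_mem_maximalAtlas hφ).contMDiffAt
      (φ.open_source.mem_nhds hx)).mdifferentiableAt (by simp)
  have h2 : HasFDerivAt (fun z => u (φ.symm z)) (fderiv ℝ (fun z => u (φ.symm z)) (φ x)) (φ x) :=
    ((hu.contDiffAt_symm hφ hx).self_of_nhds.differentiableAt (by simp)).hasFDerivAt
  have h3 := h2.hasMFDerivAt.comp x h1.hasMFDerivAt
  have h4 : HasMFDerivAt (𝓡 4) 𝓘(ℝ, ℂ) u x _ := h3.congr_of_eventuallyEq (by
    filter_upwards [φ.open_source.mem_nhds hx] with y hy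
    simp [φ.left_inv hy])
  obtain ⟨w, hw⟩ : ∃ w : E4, w = mfderiv (𝓡 4) 𝓘(ℝ, E4) φ x v := ⟨_, rfl⟩
  have h5 : mvfderiv (𝓡 4) u x v = fderiv ℝ (fun z => u (φ.symm z)) (φ x) w := by
    rw [hw]
    exact congrArg (fun A => A v) h4.mfderiv
  have h6 : ∀ μ, mvfderiv (𝓡 4) (fun y => (φ y μ : ℂ)) x v = (w μ : ℂ) := fun μ => by
    have := ((Complex.ofRealCLM.comp (EuclideanSpace.proj μ : E4 →L[ℝ] ℝ)).hasMFDerivAt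
      (x := φ x)).comp x h1.hasMFDerivAt
    rw [hw]
    exact congrArg (fun A => A v) this.mfderiv
  rw [h5]
  simp only [h6]
  conv_lhs => rw [← (EuclideanSpace.basisFun (Fin 4) ℝ).sum_repr w]
  simp [EYM.pderiv, mul_comm]

end Coordinates

/-! ### The Laplacian of a product -/

section LaplacianProduct

variable {M : Type*} [TopologicalSpace M] [ChartedSpace E4 M] [IsManifold (𝓡 4) ∞ M]
  [RiemannianBundle (fun x : M => TangentSpace (𝓡 4) x)]
  [IsContMDiffRiemannianBundle (𝓡 4) ∞ E4 (fun x : M => TangentSpace (𝓡 4) x)]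
  [T2Space M] {LC : CovariantDerivative (𝓡 4) E4 (fun x : M => TangentSpace (𝓡 4) x)}
  (hLC : IsLeviCivita LC) {x : M}

/-- The Laplacian of a function. -/
def lapFun (LC : CovariantDerivative (𝓡 4) E4 (fun x : M => TangentSpace (𝓡 4) x)) (u : M → ℂ)
    (x : M) : ℂ :=
  lap LC (W := fun _ : M => ℂ) (fun u x v => mvfderiv (𝓡 4) u x v) u x

lemma lapFun_eq (u : M → ℂ) : lapFun LC u x
    = -∑ i, (mvfderiv (𝓡 4) (fun y => mvfderiv (𝓡 4) u y (extVF (onb x i) y)) x (onb x i)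
      - mvfderiv (𝓡 4) u x (LC (extVF (onb x i)) x (onb x i))) := rfl

lemma SmFun.mvfderiv {u : M → ℂ} (hu : SmFun u x) {X : ∀ x : M, TangentSpace (𝓡 4) x}
    (hX : SmoothVF X x) : SmFun (fun y => mvfderiv (𝓡 4) u y (X y)) x :=
  (isLocalConn_mvfderiv ℂ).cov_smooth hX hu

section Abstract

variable {V : M → Type*} [∀ x, AddCommGroup (V x)] [∀ x, Module ℝ (V x)]
  {Sm : (∀ x, V x) → M → Prop} {cov : (∀ x, V x) → ∀ x : M, TangentSpace (𝓡 4) x → V x}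

include hLC in
lemma lap_congr (h : IsLocalConn Sm cov) {s t : ∀ x, V x} (hs : Sm s x)
    (hst : ∀ᶠ y in 𝓝 x, t y = s y) : lap LC cov t x = lap LC cov s x := by
  simp only [lap]
  congr 1
  refine Finset.sum_congr rfl fun i _ => ?_
  rw [h.cov_congr hs hst, h.cov_congr (h.cov_smooth (smoothVF_extVF _) hs)
    ((h.cov_eventually_congr hs hst).mono fun y hy => hy _)]

include hLC in
lemma lap_add (h : IsLocalConn Sm cov) {s t : ∀ x, V x} (hs : Sm s x) (ht : Sm t x) :
    lap LC cov (fun y => s y + t y) x = lap LC cov s x + lap LC cov t x := by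
  rw [lap_eq_secondCov hLC h hs (onb x), lap_eq_secondCov hLC h ht (onb x),
    lap_eq_secondCov hLC h (h.add hs ht) (onb x)]
  simp only [secondCov_add hLC h hs ht, Finset.sum_add_distrib, neg_add]

include hLC in
lemma lap_sum (h : IsLocalConn Sm cov) {ι : Type*} (I : Finset ι) {s : ι → ∀ x, V x}
    (hs : ∀ i ∈ I, Sm (s i) x) :
    lap LC cov (fun y => ∑ i ∈ I, s i y) x = ∑ i ∈ I, lap LC cov (s i) x := by
  classical
  induction I using Finset.induction_on with
  | empty =>
    have := lap_add hLC h (h.zero x) (h.zero x)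
    simpa using this
  | insert a I ha ih =>
    simp only [Finset.sum_insert ha]
    rw [lap_add hLC h (hs a (by simp)) (h.sum I fun i hi => hs i (by simp [hi])),
      ih fun i hi => hs i (by simp [hi])]

variable [∀ x, Module ℂ (V x)] [∀ x, IsScalarTower ℝ ℂ (V x)]

/-- The Leibniz rule is applied twice; the two cross terms coincide and give the factor `2`. This is
the source of both the Laplace form and uniqueness. -/
lemma lap_csmul (h : IsComplexConn Sm cov) {f : M → ℂ} {s : ∀ x, V x} (hf : SmFun f x)
    (hs : Sm s x) :
    lap LC cov (fun y => f y • s y) x = f x • lap LC cov s x + lapFun LC f x • s x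
      - (2 : ℂ) • ∑ i, mvfderiv (𝓡 4) f x (onb x i) • cov s x (onb x i) := by
  rw [lapFun_eq]
  simp only [lap, smul_neg, neg_smul, Finset.smul_sum, Finset.sum_smul, ← Finset.sum_neg_distrib,
    ← Finset.sum_add_distrib, ← Finset.sum_sub_distrib]
  refine Finset.sum_congr rfl fun i _ => ?_
  have hX := smoothVF_extVF (onb x i)
  have e1 := hf.mvfderiv hX
  have e2 := h.cov_smooth hX hs
  rw [h.cov_congr (h.add (h.csmul hf e2) (h.csmul e1 hs)), h.cov_add (h.csmul hf e2)
    (h.csmul e1 hs), h.cov_csmul hf e2, h.cov_csmul e1 hs, h.cov_csmul hf hs, extVF_self]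
  · module
  · filter_upwards [hf.eventually, h.eventually hs] with y h1 h2
    exact h.cov_csmul h1 h2 _

end Abstract

/-- Bookkeeping for `lapFun_eq_coord`: `P` stands for the second partial derivatives, `α` for the
`dx^μ(e_i)`, `Q` for the first partial derivatives, and `R - T` for the second covariant derivatives
of the coordinates. -/
lemma sum_rearrange {ι κ : Type*} [Fintype ι] [Fintype κ] (P : κ → κ → ℂ) (α : ι → κ → ℂ)
    (Q : κ → ℂ) (R T : ι → κ → ℂ) :
    -∑ i, (∑ ν, (∑ μ, P μ ν * α i μ * α i ν + Q ν * R i ν) - ∑ ν, Q ν * T i ν)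
      = -∑ μ, ∑ ν, (∑ i, α i μ * α i ν) * P μ ν + ∑ ν, Q ν * -∑ i, (R i ν - T i ν) := by
  have e1 : ∑ μ, ∑ ν, (∑ i, α i μ * α i ν) * P μ ν = ∑ i, ∑ ν, ∑ μ, P μ ν * α i μ * α i ν := by
    simp only [Finset.sum_mul]
    rw [Finset.sum_comm, Finset.sum_comm (s := (Finset.univ : Finset ι))]
    refine Finset.sum_congr rfl fun ν _ => ?_
    rw [Finset.sum_comm]
    exact Finset.sum_congr rfl fun i _ => Finset.sum_congr rfl fun μ _ => by ring
  have e2 : ∑ ν, Q ν * -∑ i, (R i ν - T i ν) = -∑ i, (∑ ν, Q ν * R i ν - ∑ ν, Q ν * T i ν) := by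
    simp only [mul_neg, Finset.mul_sum, Finset.sum_neg_distrib]
    rw [Finset.sum_comm]
    simp only [mul_sub, Finset.sum_sub_distrib]
  rw [e1, e2]
  simp only [Finset.sum_add_distrib, Finset.sum_sub_distrib]
  ring

/-- The chain rule is differentiated once more. The first-order coefficients come out as `Δx^ν`, so
no Christoffel symbols are needed. -/
lemma lapFun_eq_coord {φ : OpenPartialHomeomorph M E4}
    (hφ : φ ∈ IsManifold.maximalAtlas (𝓡 4) ∞ M) (hx : x ∈ φ.source) {u : M → ℂ} (hu : SmFun u x) :
    lapFun LC u x = -∑ μ, ∑ ν, (invMetric φ μ ν x : ℂ) * pderiv φ μ (pderiv φ ν u) x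
      + ∑ ν, pderiv φ ν u x * lapFun LC (fun y => (φ y ν : ℂ)) x := by
  have hc : ∀ ν, SmFun (fun y => (φ y ν : ℂ)) x := fun ν => (smFun_coord hφ hx ν).ofReal
  have hd : ∀ μ v, mvfderiv (𝓡 4) (fun y => (φ y μ : ℂ)) x v
      = (mvfderiv (𝓡 4) (fun y => φ y μ) x v : ℂ) := fun μ v =>
    mvfderiv_clm Complex.ofRealCLM (smFun_coord hφ hx μ) v
  have hL := isLocalConn_mvfderiv (M := M) ℂ
  have key : ∀ i, mvfderiv (𝓡 4) (fun y => mvfderiv (𝓡 4) u y (extVF (onb x i) y)) x (onb x i)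
      = ∑ ν, (∑ μ, pderiv φ μ (pderiv φ ν u) x * mvfderiv (𝓡 4) (fun y => (φ y μ : ℂ)) x (onb x i)
          * mvfderiv (𝓡 4) (fun y => (φ y ν : ℂ)) x (onb x i)
        + pderiv φ ν u x * mvfderiv (𝓡 4)
          (fun y => mvfderiv (𝓡 4) (fun y => (φ y ν : ℂ)) y (extVF (onb x i) y)) x (onb x i)) := by
    intro i
    have e1 : ∀ ν, SmFun (fun y => pderiv φ ν u y
        * mvfderiv (𝓡 4) (fun z => (φ z ν : ℂ)) y (extVF (onb x i) y)) x := fun ν =>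
      (hu.pderiv hφ hx ν).mul ((hc ν).mvfderiv (smoothVF_extVF _))
    rw [mvfderiv_congr (SmFun.sum Finset.univ fun ν _ => e1 ν),
      hL.cov_sum Finset.univ fun ν _ => e1 ν]
    · refine Finset.sum_congr rfl fun ν _ => ?_
      rw [mvfderiv_mul (hu.pderiv hφ hx ν) ((hc ν).mvfderiv (smoothVF_extVF _)),
        mvfderiv_eq_sum_pderiv hφ hx (hu.pderiv hφ hx ν), extVF_self, Finset.sum_mul]
    · filter_upwards [hu.eventually, φ.open_source.mem_nhds hx] with y h1 h2
      exact mvfderiv_eq_sum_pderiv hφ h2 h1 _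
  simp only [lapFun_eq, key, mvfderiv_eq_sum_pderiv hφ hx hu (LC _ _ _), invMetric]
  simp only [hd]
  push_cast
  exact sum_rearrange _ _ _ _ _

end LaplacianProduct

/-! ### Operators of Laplace type -/

section LaplaceType

variable {M : Type*} [TopologicalSpace M] [ChartedSpace E4 M] [IsManifold (𝓡 4) ∞ M]
  [RiemannianBundle (fun x : M => TangentSpace (𝓡 4) x)]
  [IsContMDiffRiemannianBundle (𝓡 4) ∞ E4 (fun x : M => TangentSpace (𝓡 4) x)]
  {FB : Type*} [NormedAddCommGroup FB] [NormedSpace ℂ FB] [FiniteDimensional ℂ FB]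
  {B : M → Type*} [TopologicalSpace (TotalSpace FB B)]
  [∀ x, Ring (B x)] [∀ x, Algebra ℂ (B x)] [∀ x, StarRing (B x)] [∀ x, StarModule ℂ (B x)]
  [∀ x, TopologicalSpace (B x)] [∀ x, IsTopologicalAddGroup (B x)]
  [∀ x, ContinuousSMul ℝ (B x)] [FiberBundle FB B]
  [VectorBundle ℂ FB B] [VectorBundle ℝ FB B] [ContMDiffVectorBundle ∞ FB B (𝓡 4)]
  {FS : Type*} [NormedAddCommGroup FS] [NormedSpace ℂ FS] [FiniteDimensional ℂ FS]
  {S : M → Type*} [TopologicalSpace (TotalSpace FS S)]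
  [∀ x, NormedAddCommGroup (S x)] [∀ x, InnerProductSpace ℂ (S x)] [FiberBundle FS S]
  [VectorBundle ℂ FS S] [VectorBundle ℝ FS S] [ContMDiffVectorBundle ∞ FS S (𝓡 4)]
  {x : M}

lemma frameCoeff_frameAt {F : Type*} [NormedAddCommGroup F] [NormedSpace ℂ F]
    [FiniteDimensional ℂ F] {V : M → Type*} [TopologicalSpace (TotalSpace F V)]
    [∀ x, AddCommGroup (V x)] [∀ x, Module ℂ (V x)] [∀ x, TopologicalSpace (V x)] [FiberBundle F V]
    [VectorBundle ℂ F V] {y : M} (hy : y ∈ (trivializationAt F V x).baseSet)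
    (k l : Fin (Module.finrank ℂ F)) :
    frameCoeff F x k y (frameAt F x l y : V y) = if l = k then 1 else 0 := by
  rw [frameCoeff, frameAt, LinearMap.comp_apply, Trivialization.linearMapAt_symm _ hy]
  simp [Finsupp.single_apply]

/-- Near `x` the coefficients with respect to the frames at `x` form a coordinate system of the
fibre of `B ⊗ S`. -/
lemma eventually_tensorCoeff_equiv : ∀ᶠ y in 𝓝 x,
    ∃ e : (B y ⊗[ℂ] S y) ≃ₗ[ℂ] (Fin (Module.finrank ℂ FB) × Fin (Module.finrank ℂ FS) → ℂ),
      ∀ z i, e z i = tensorCoeff FB FS x i.1 i.2 y z := by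
  filter_upwards [eventually_eq_sum_tensor FB B FS S x,
    (trivializationAt FB B x).open_baseSet.mem_nhds
      (FiberBundle.mem_baseSet_trivializationAt FB B x),
    (trivializationAt FS S x).open_baseSet.mem_nhds
      (FiberBundle.mem_baseSet_trivializationAt FS S x)] with y h1 h2 h3
  refine ⟨LinearEquiv.ofLinearMap (LinearMap.pi fun i => tensorCoeff FB FS x i.1 i.2 y)
    (∑ i : Fin (Module.finrank ℂ FB) × Fin (Module.finrank ℂ FS),
      (LinearMap.proj i).smulRight ((frameAt FB x i.1 y : B y) ⊗ₜ[ℂ] (frameAt FS x i.2 y : S y)))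
    ?_ ?_, fun z i => rfl⟩
  · refine LinearMap.ext fun g => funext fun j => ?_
    simp only [LinearMap.comp_apply, LinearMap.sum_apply, LinearMap.id_apply,
      LinearMap.smulRight_apply, LinearMap.proj_apply, LinearMap.pi_apply, map_sum, map_smul,
      tensorCoeff_tmul, frameCoeff_frameAt h2, frameCoeff_frameAt h3]
    rw [Finset.sum_eq_single j (fun i _ hi => ?_) (by simp)]
    · simp
    · have : ¬(i.1 = j.1 ∧ i.2 = j.2) := fun h => hi (Prod.ext h.1 h.2)
      by_cases h4 : i.1 = j.1
      · simp [show i.2 ≠ j.2 from fun h5 => this ⟨h4, h5⟩]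
      · simp [h4]
  · refine LinearMap.ext fun z => ?_
    simp only [LinearMap.comp_apply, LinearMap.sum_apply, LinearMap.id_apply,
      LinearMap.smulRight_apply, LinearMap.proj_apply, LinearMap.pi_apply]
    rw [Fintype.sum_prod_type]
    exact (h1 z).symm

/-- The coefficients of a smooth section in a smooth moving basis are smooth. -/
lemma SmoothTensor.repr {ι : Type*} [Fintype ι] {f : ∀ x, Module.Basis ι ℂ (B x ⊗[ℂ] S x)}
    (hf : ∀ k, SmoothTensor FB FS (fun y => f y k) x) {ξ : ∀ x, B x ⊗[ℂ] S x}
    (hξ : SmoothTensor FB FS ξ x) (k : ι) : SmFun (fun y => (f y).repr (ξ y) k) x := by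
  refine smFun_coeff (x := x) (t := fun k y => (f y).repr (ξ y) k)
    (g := fun k y (i : Fin (Module.finrank ℂ FB) × Fin (Module.finrank ℂ FS)) =>
      EYM.tensorCoeff FB FS x i.1 i.2 y (f y k))
    (u := fun y i => EYM.tensorCoeff FB FS x i.1 i.2 y (ξ y))
    (fun k => SmFun.pi fun i => (hf k).tensorCoeff i.1 i.2) ?_
    (SmFun.pi fun i => hξ.tensorCoeff i.1 i.2) ?_ k
  · filter_upwards [eventually_tensorCoeff_equiv (FB := FB) (B := B) (FS := FS) (S := S)]
      with y ⟨e, he⟩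
    exact ⟨(f y).map e, fun k => funext fun i => by rw [Module.Basis.map_apply, he]⟩
  · refine Filter.Eventually.of_forall fun y => funext fun i => ?_
    rw [Finset.sum_apply]
    conv_rhs => rw [← (f y).sum_repr (ξ y), map_sum]
    simp

variable [T2Space M] {LC : CovariantDerivative (𝓡 4) E4 (fun x : M => TangentSpace (𝓡 4) x)}
  (hLC : IsLeviCivita LC)

include hLC in
-- Write `ξ = ∑ u_l f_l`, apply the product rule, and express `Δu_l` and `du_l` in coordinates. All
-- first-order terms assemble to `∂_μ u_l` times `[∇^*∇, x^μ] f_l`, and the remaining ones to `u_l`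
-- times the operator applied to `f_l`.
lemma isLaplaceType_lap {cov : (∀ x, B x ⊗[ℂ] S x) → ∀ x : M, TangentSpace (𝓡 4) x → B x ⊗[ℂ] S x}
    (h : IsComplexConn (SmoothTensor FB FS (B := B) (S := S)) cov)
    {E : ∀ x, Module.End ℂ (B x ⊗[ℂ] S x)}
    (hE : ∀ {ξ x}, SmoothTensor FB FS ξ x → SmoothTensor FB FS (fun y => E y (ξ y)) x)
    {Q : (∀ x, B x ⊗[ℂ] S x) → ∀ x : M, B x ⊗[ℂ] S x}
    (hQ : ∀ {ξ}, (∀ x, SmoothTensor FB FS ξ x) → ∀ x, Q ξ x = lap LC cov ξ x - E x (ξ x)) :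
    IsLaplaceType FB FS Q := by
  intro φ hφ U hU hUφ r f hf
  let c : Fin 4 → M → ℂ := fun μ y => (φ y μ : ℂ)
  have hc : ∀ μ, ∀ x ∈ U, SmFun (c μ) x := fun μ x hx => (smFun_coord hφ (hUφ hx) μ).ofReal
  -- The commutator `[∇^*∇, x^μ]` applied to the frame. In this form its smoothness is immediate
  -- from `lap_smooth`.
  let T : Fin 4 → Fin r → ∀ y, B y ⊗[ℂ] S y := fun μ l y =>
    lap LC cov (fun z => c μ z • f z l) y - c μ y • lap LC cov (fun z => f z l) y
  have hlap : ∀ {ξ x}, SmoothTensor FB FS ξ x → SmoothTensor FB FS (lap LC cov ξ) x :=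
    fun hξ => lap_smooth hLC h.toIsLocalConn hξ
  have hT : ∀ μ l, ∀ x ∈ U, SmoothTensor FB FS (T μ l) x := fun μ l x hx =>
    h.sub (hlap (h.csmul (hc μ x hx) (hf l x hx))) (h.csmul (hc μ x hx) (hlap (hf l x hx)))
  let P : Fin r → ∀ y, B y ⊗[ℂ] S y := fun l y => lap LC cov (fun z => f z l) y - E y (f y l)
  have hP : ∀ l, ∀ x ∈ U, SmoothTensor FB FS (P l) x := fun l x hx =>
    h.sub (hlap (hf l x hx)) (hE (hf l x hx))
  refine ⟨fun μ y => Matrix.of fun k l => (f y).repr (T μ l y) k,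
    fun y => Matrix.of fun k l => (f y).repr (P l y) k,
    fun μ k l x hx => SmoothTensor.repr (fun k => hf k x hx) (hT μ l x hx) k,
    fun k l x hx => SmoothTensor.repr (fun k => hf k x hx) (hP l x hx) k, ?_⟩
  intro ξ hξ x hx k
  let u : Fin r → M → ℂ := fun l y => (f y).repr (ξ y) l
  have hu : ∀ l, SmFun (u l) x := fun l => SmoothTensor.repr (fun k => hf k x hx) (hξ x) l
  have e1 : lap LC cov ξ x = ∑ l, (u l x • lap LC cov (fun z => f z l) x
      + lapFun LC (u l) x • f x l
      - (2 : ℂ) • ∑ i, mvfderiv (𝓡 4) (u l) x (onb x i) • cov (fun z => f z l) x (onb x i)) := by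
    have h1 : ∀ l, SmoothTensor FB FS (fun y => u l y • f y l) x := fun l =>
      h.csmul (hu l) (hf l x hx)
    rw [← lap_congr hLC h.toIsLocalConn (hξ x)
      (Filter.Eventually.of_forall fun y => (f y).sum_repr (ξ y)),
      lap_sum hLC h.toIsLocalConn Finset.univ fun l _ => h1 l]
    exact Finset.sum_congr rfl fun l _ => lap_csmul h (hu l) (hf l x hx)
  have e2 : ∀ μ l, T μ l x = lapFun LC (c μ) x • f x l
      - (2 : ℂ) • ∑ i, mvfderiv (𝓡 4) (c μ) x (onb x i) • cov (fun z => f z l) x (onb x i) := by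
    intro μ l
    simp only [T]
    rw [lap_csmul h (hc μ x hx) (hf l x hx)]
    abel
  have e3 : lap LC cov ξ x - E x (ξ x) = ∑ l, ((-∑ μ, ∑ ν, (invMetric φ μ ν x : ℂ) *
      pderiv φ μ (pderiv φ ν (u l)) x) • f x l + ∑ μ, pderiv φ μ (u l) x • T μ l x
      + u l x • P l x) := by
    have hE1 : E x (ξ x) = ∑ l, u l x • E x (f x l) := by
      conv_lhs => rw [← (f x).sum_repr (ξ x), map_sum]
      exact Finset.sum_congr rfl fun l _ => map_smul _ _ _
    rw [e1, hE1, ← Finset.sum_sub_distrib]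
    refine Finset.sum_congr rfl fun l _ => ?_
    have e4 : ∑ i, mvfderiv (𝓡 4) (u l) x (onb x i) • cov (fun z => f z l) x (onb x i)
        = ∑ μ, pderiv φ μ (u l) x • ∑ i, mvfderiv (𝓡 4) (c μ) x (onb x i) •
          cov (fun z => f z l) x (onb x i) := by
      simp only [mvfderiv_eq_sum_pderiv hφ (hUφ hx) (hu l), Finset.sum_smul, Finset.smul_sum,
        mul_smul]
      exact Finset.sum_comm
    rw [e4, lapFun_eq_coord hφ (hUφ hx) (hu l)]
    simp only [e2, smul_sub, Finset.sum_sub_distrib, add_smul, Finset.sum_smul, smul_smul, P,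
      Finset.smul_sum]
    simp only [mul_comm (2 : ℂ), mul_assoc, c]
    abel
  rw [hQ hξ, e3]
  simp only [map_sum, map_add, map_smul, Finsupp.coe_finsetSum, Finset.sum_apply,
    Finsupp.coe_add, Pi.add_apply, Finsupp.coe_smul, Pi.smul_apply, smul_eq_mul,
    Module.Basis.repr_self, Finset.sum_add_distrib, Matrix.of_apply]
  congr 1
  · congr 1
    · rw [Finset.sum_eq_single k (fun l _ hl => by simp [hl]) (by simp)]
      simp [u]
    · rw [Finset.sum_comm]
      exact Finset.sum_congr rfl fun μ _ => Finset.sum_congr rfl fun l _ => mul_comm _ _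
  · exact Finset.sum_congr rfl fun l _ => mul_comm _ _

end LaplaceType

/-! ### Uniqueness of the connection and of the endomorphism -/

section CoordinateFunctions

variable {M : Type*} [TopologicalSpace M] [ChartedSpace E4 M] [IsManifold (𝓡 4) ∞ M] [T2Space M]

/-- Every covector is the differential of a globally smooth function. -/
lemma exists_smFun_mvfderiv_eq (x : M) (l : TangentSpace (𝓡 4) x →ₗ[ℝ] ℝ) :
    ∃ f : M → ℂ, (∀ y, SmFun f y) ∧ ∀ v, mvfderiv (𝓡 4) f x v = (l v : ℂ) := by
  obtain ⟨χ, hχ, h1, h2⟩ := exists_bump (chart_source_mem_nhds E4 x)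
  have hφ : chartAt E4 x ∈ IsManifold.maximalAtlas (𝓡 4) ∞ M := IsManifold.chart_mem_maximalAtlas x
  have hs : ∀ y ∈ (chartAt E4 x).source, ContMDiffAt (𝓡 4) 𝓘(ℝ, E4) ∞ (chartAt E4 x) y :=
    fun y hy => (contMDiffOn_of_mem_maximalAtlas hφ).contMDiffAt
      ((chartAt E4 x).open_source.mem_nhds hy)
  have hD : (mfderiv (𝓡 4) 𝓘(ℝ, E4) (extChartAt (𝓡 4) x) x).IsInvertible :=
    isInvertible_mfderiv_extChartAt (mem_extChartAt_source x)
  obtain ⟨D, hD⟩ := hD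
  let D' : E4 →ₗ[ℝ] TangentSpace (𝓡 4) x := D.symm.toLinearEquiv.toLinearMap
  have hD' : ∀ v, D' (D v) = v := D.symm_apply_apply
  -- `D` is the derivative of the chart at `x`, so `L` composed with the chart has differential `l`
  -- there; the bump function makes it global.
  let L : E4 →L[ℝ] ℂ := Complex.ofRealCLM.comp
    (LinearMap.toContinuousLinearMap (E := E4) (l ∘ₗ D'))
  have hg : ∀ y ∈ (chartAt E4 x).source, SmFun (fun z => L (chartAt E4 x z)) y := fun y hy => by
    filter_upwards [(chartAt E4 x).open_source.mem_nhds hy] with z hz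
    exact (L.contDiff.contMDiff.contMDiffAt).comp z (hs z hz)
  have hχ' : ∀ y, SmFun χ y := fun y => Filter.Eventually.of_forall fun z => hχ z
  refine ⟨fun y => χ y • L (chartAt E4 x y), fun y => ?_, fun v => ?_⟩
  · by_cases hy : y ∈ tsupport χ
    · exact (hχ' y).smul (hg y (h2 hy))
    · refine (SmFun.const 0).congr ?_
      filter_upwards [(isClosed_tsupport χ).isOpen_compl.mem_nhds hy] with z hz
      rw [image_eq_zero_of_notMem_tsupport hz, zero_smul]
  · rw [mvfderiv_congr (hg x (mem_chart_source E4 x)) (by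
      filter_upwards [h1] with y hy
      rw [hy, one_smul])]
    have h3 := ((L.hasMFDerivAt (x := chartAt E4 x x)).comp x
      ((hs x (mem_chart_source E4 x)).mdifferentiableAt (by simp)).hasMFDerivAt).mfderiv
    have h4 : mfderiv (𝓡 4) 𝓘(ℝ, E4) (chartAt E4 x) x v = D v := by
      rw [ContinuousLinearMap.ext_iff] at hD
      exact (hD v).symm
    refine (congrArg (fun A => A v) h3).trans ?_
    change L (mfderiv (𝓡 4) 𝓘(ℝ, E4) (chartAt E4 x) x v) = _
    rw [h4]
    exact congrArg (fun w => (l w : ℂ)) (hD' v)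

end CoordinateFunctions

section Uniqueness

variable {M : Type*} [TopologicalSpace M] [ChartedSpace E4 M] [IsManifold (𝓡 4) ∞ M]
  [RiemannianBundle (fun x : M => TangentSpace (𝓡 4) x)]
  [IsContMDiffRiemannianBundle (𝓡 4) ∞ E4 (fun x : M => TangentSpace (𝓡 4) x)]
  {FB : Type*} [NormedAddCommGroup FB] [NormedSpace ℂ FB] [FiniteDimensional ℂ FB]
  {B : M → Type*} [TopologicalSpace (TotalSpace FB B)]
  [∀ x, Ring (B x)] [∀ x, Algebra ℂ (B x)] [∀ x, StarRing (B x)] [∀ x, StarModule ℂ (B x)]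
  [∀ x, TopologicalSpace (B x)] [∀ x, IsTopologicalAddGroup (B x)]
  [∀ x, ContinuousSMul ℝ (B x)] [FiberBundle FB B]
  [VectorBundle ℂ FB B] [VectorBundle ℝ FB B] [ContMDiffVectorBundle ∞ FB B (𝓡 4)]
  {FS : Type*} [NormedAddCommGroup FS] [NormedSpace ℂ FS] [FiniteDimensional ℂ FS]
  {S : M → Type*} [TopologicalSpace (TotalSpace FS S)]
  [∀ x, NormedAddCommGroup (S x)] [∀ x, InnerProductSpace ℂ (S x)] [FiberBundle FS S]
  [VectorBundle ℂ FS S] [VectorBundle ℝ FS S] [ContMDiffVectorBundle ∞ FS S (𝓡 4)]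
  {x : M} [T2Space M]

/-- Locality is not an axiom of a `TensorConnection`, but it follows from the Leibniz rule, which
allows functions that are smooth only near the point. -/
lemma TensorConnection.isComplexConn (n : TensorConnection FB B FS S) :
    IsComplexConn (SmoothTensor FB FS (B := B) (S := S)) (fun ξ x v => n.toFun ξ x v) where
  toIsSmoothClass := isSmoothClass_smoothTensor
  cov_congr := by
    classical
    intro ξ η x hξ h v
    have hη : SmoothTensor FB FS η x := isSmoothClass_smoothTensor.congr hξ h
    -- This `f` is `1` near `x`, hence smooth there with `df_x = 0`, and `f η = f ξ` holds at every
    -- point, as the Leibniz rule requires.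
    let f : M → ℂ := fun y => if η y = ξ y then 1 else 0
    have h1 : ∀ᶠ y in 𝓝 x, f y = 1 := by
      filter_upwards [h] with y hy
      simp [f, hy]
    have hf : SmFun f x := (SmFun.const 1).congr h1
    have h2 : dC f x v = 0 := by
      rw [dC, mvfderiv_congr (SmFun.const 1) h1]
      simp [mvfderiv_const]
    have h3 : (fun y => f y • η y) = fun y => f y • ξ y := by
      funext y
      simp only [f]
      split_ifs with hy
      · rw [hy]
      · simp
    have e1 := n.leibniz f η x v hf hη
    rw [h3, n.leibniz f ξ x v hf hξ, h2, h1.self_of_nhds] at e1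
    simpa using e1.symm
  cov_add hξ hη v := by rw [n.add _ _ _ hξ hη, LinearMap.add_apply]
  cov_smul := by
    intro f ξ x hf hξ v
    have h1 := n.leibniz (fun y => (f y : ℂ)) ξ x v hf.ofReal hξ
    have h2 : dC (fun y => (f y : ℂ)) x v = (mvfderiv (𝓡 4) f x v : ℂ) :=
      mvfderiv_clm Complex.ofRealCLM hf v
    rw [h2] at h1
    exact h1
  cov_vadd ξ x v w := map_add _ v w
  cov_vsmul ξ x c v := map_smul (n.toFun ξ x) c v
  cov_smooth hX hξ := n.smooth _ _ _ hX hξ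
  I_smul hξ := hξ.csmul (SmFun.const Complex.I)
  cov_I := by
    intro ξ x hξ v
    have := n.leibniz (fun _ => Complex.I) ξ x v (SmFun.const Complex.I) hξ
    simpa [dC, mvfderiv_const] using this

variable {LC : CovariantDerivative (𝓡 4) E4 (fun x : M => TangentSpace (𝓡 4) x)}
  (hLC : IsLeviCivita LC)

include hLC

/-- A connection is determined by its Laplacian up to zeroth order terms. -/
lemma conn_eq_of_lap_sub_eq
    {cov cov' : (∀ x, B x ⊗[ℂ] S x) → ∀ x : M, TangentSpace (𝓡 4) x → B x ⊗[ℂ] S x}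
    (h : IsComplexConn (SmoothTensor FB FS (B := B) (S := S)) cov)
    (h' : IsComplexConn (SmoothTensor FB FS (B := B) (S := S)) cov')
    {E E' : ∀ x, Module.End ℂ (B x ⊗[ℂ] S x)}
    (hQ : ∀ {ξ}, (∀ x, SmoothTensor FB FS ξ x) → ∀ x,
      lap LC cov ξ x - E x (ξ x) = lap LC cov' ξ x - E' x (ξ x))
    {ξ : ∀ x, B x ⊗[ℂ] S x} (hξ : SmoothTensor FB FS ξ x) (v : TangentSpace (𝓡 4) x) :
    cov' ξ x v = cov ξ x v := by
  obtain ⟨η, hη, e⟩ := hξ.exists_global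
  rw [← h.cov_congr hξ e, ← h'.cov_congr hξ e]
  clear e hξ
  suffices key : h'.covL η x = h.covL η x from congrArg (fun A => A v) key
  refine (onb x).toBasis.ext fun j => ?_
  simp only [OrthonormalBasis.coe_toBasis, IsLocalConn.covL_apply]
  -- Since `df_x = ⟨e_j, ·⟩`, the cross term of the product rule is `-2 ∇_{e_j} η`. A global `f` is
  -- needed because `hQ` concerns globally smooth sections.
  obtain ⟨f, hf, hfd⟩ := exists_smFun_mvfderiv_eq x (innerₗ _ (onb x j))
  have h1 := hQ (fun y => h.csmul (hf y) (hη y)) x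
  have h2 := congrArg (fun z => f x • z) (hQ hη x)
  have h3 : ∀ cov : (∀ x, B x ⊗[ℂ] S x) → ∀ x : M, TangentSpace (𝓡 4) x → B x ⊗[ℂ] S x,
      ∑ i, mvfderiv (𝓡 4) f x (onb x i) • cov η x (onb x i) = cov η x (onb x j) := fun cov => by
    rw [Finset.sum_eq_single j (fun i _ hi => ?_) (by simp)]
    · simp [hfd]
    · simp [hfd, orthonormal_iff_ite.1 (onb x).orthonormal, hi.symm]
  rw [lap_csmul h (hf x) (hη x), lap_csmul h' (hf x) (hη x), h3, h3, map_smul, map_smul] at h1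
  simp only [smul_sub] at h2
  -- In the difference of the identity for `f η` and `f` times the identity for `η`, the
  -- endomorphisms and the terms `(Δf) η` cancel.
  have h4 : (2 : ℂ) • cov' η x (onb x j) = (2 : ℂ) • cov η x (onb x j) := by
    linear_combination (norm := module) h1 - h2
  exact smul_right_injective _ two_ne_zero h4

/-- The connections agree on smooth sections, hence so do their Laplacians, and the endomorphisms
are compared on sections through a given vector. -/
lemma endo_eq_of_lap_sub_eq
    {cov cov' : (∀ x, B x ⊗[ℂ] S x) → ∀ x : M, TangentSpace (𝓡 4) x → B x ⊗[ℂ] S x}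
    (h : IsComplexConn (SmoothTensor FB FS (B := B) (S := S)) cov)
    (h' : IsComplexConn (SmoothTensor FB FS (B := B) (S := S)) cov')
    {E E' : ∀ x, Module.End ℂ (B x ⊗[ℂ] S x)}
    (hQ : ∀ {ξ}, (∀ x, SmoothTensor FB FS ξ x) → ∀ x,
      lap LC cov ξ x - E x (ξ x) = lap LC cov' ξ x - E' x (ξ x)) : E' = E := by
  funext x
  refine LinearMap.ext fun z => ?_
  obtain ⟨ξ, hξ, rfl⟩ := SmoothTensor.exists_eq FB FS z
  have key : ∀ {η : ∀ x, B x ⊗[ℂ] S x} {y : M}, SmoothTensor FB FS η y → ∀ v,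
    cov' η y v = cov η y v := fun hη v => conn_eq_of_lap_sub_eq hLC h h' hQ hη v
  have h1 : lap LC cov' ξ x = lap LC cov ξ x := by
    simp only [lap]
    congr 1
    refine Finset.sum_congr rfl fun i _ => ?_
    simp only [key (hξ _)]
    rw [key (h.cov_smooth (smoothVF_extVF _) (hξ x))]
  have h2 := hQ hξ x
  rw [h1] at h2
  exact (sub_right_injective h2).symm

end Uniqueness

/-! ### The connection of the fluctuated Dirac operator -/

section FluctuatedConnection

variable {M : Type*} [TopologicalSpace M] [ChartedSpace E4 M] [IsManifold (𝓡 4) ∞ M]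
  [RiemannianBundle (fun x : M => TangentSpace (𝓡 4) x)]
  [IsContMDiffRiemannianBundle (𝓡 4) ∞ E4 (fun x : M => TangentSpace (𝓡 4) x)]
  {FB : Type*} [NormedAddCommGroup FB] [NormedSpace ℂ FB] [FiniteDimensional ℂ FB]
  {B : M → Type*} [TopologicalSpace (TotalSpace FB B)]
  [∀ x, Ring (B x)] [∀ x, Algebra ℂ (B x)] [∀ x, StarRing (B x)] [∀ x, StarModule ℂ (B x)]
  [∀ x, TopologicalSpace (B x)] [∀ x, IsTopologicalAddGroup (B x)]
  [∀ x, ContinuousSMul ℝ (B x)] [FiberBundle FB B]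
  [VectorBundle ℂ FB B] [VectorBundle ℝ FB B] [ContMDiffVectorBundle ∞ FB B (𝓡 4)]
  {FS : Type*} [NormedAddCommGroup FS] [NormedSpace ℂ FS] [FiniteDimensional ℂ FS]
  {S : M → Type*} [TopologicalSpace (TotalSpace FS S)]
  [∀ x, NormedAddCommGroup (S x)] [∀ x, InnerProductSpace ℂ (S x)] [FiberBundle FS S]
  [VectorBundle ℂ FS S] [VectorBundle ℝ FS S] [ContMDiffVectorBundle ∞ FS S (𝓡 4)]
  [T2Space M]
  {LC : CovariantDerivative (𝓡 4) E4 (fun x : M => TangentSpace (𝓡 4) x)}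
  (hLC : IsLeviCivita LC) {σ : SpinorStructure FS S} {nS : CovariantDerivative (𝓡 4) FS S}
  (hnS : IsSpinConnection LC σ nS)
  {N : ℕ} (hB : IsMatrixAlgebraBundle FB B N) {t : TracialState FB B}
  {nB : CovariantDerivative (𝓡 4) FB B} (hnB : IsHermitianStarAlgebraConnection t nB)
  {m : ℕ} {a b : Fin m → ∀ x, B x}
  (ha : ∀ j x, SmoothSec FB (a j) x) (hb : ∀ j x, SmoothSec FB (b j) x)
  (hA : ∀ ξ η : (∀ x, B x ⊗[ℂ] S x),
      (∀ x, SmoothTensor FB FS ξ x) → (∀ x, SmoothTensor FB FS η x) →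
      ∀ x, tensorInner t x (fluct σ nB nS a b ξ x) (η x)
        = tensorInner t x (ξ x) (fluct σ nB nS a b η x))

/-- A complex linear connection as a `TensorConnection`. -/
def IsComplexConn.toTensorConnection
    {cov : (∀ x, B x ⊗[ℂ] S x) → ∀ x : M, TangentSpace (𝓡 4) x → B x ⊗[ℂ] S x}
    (h : IsComplexConn (SmoothTensor FB FS (B := B) (S := S)) cov) :
    TensorConnection FB B FS S where
  toFun ξ x := h.covL ξ x
  add _ _ _ hξ hη := LinearMap.ext fun v => h.cov_add hξ hη v
  leibniz _ _ _ v hf hξ := h.cov_csmul hf hξ v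
  smooth _ _ _ hX hξ := h.cov_smooth hX hξ

include hLC hnS hB hnB ha hb hA in
lemma diracA_sq_eq_lap {ξ : ∀ x, B x ⊗[ℂ] S x} (hξ : ∀ x, SmoothTensor FB FS ξ x) (x : M) :
    diracA σ nB nS a b (diracA σ nB nS a b ξ) x = lap LC (pertConn nB nS a b) ξ x
      - weitzEnd hLC σ (isComplexConn_nablaPert hnB hB ha hb) (onb x) (ξ x) := by
  rw [diracA_sq_eq hnS hB hnB ha hb hA hξ,
    diracOp_sq_pertConn hLC hnS hB hnB ha hb (hξ x) (onb x)]

end FluctuatedConnection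

end

end EYM

/-! ### Decomposition, uniqueness and curvature for the fluctuated Dirac operator -/

open EYM in
theorem mainTheorem8
    {M : Type*} [TopologicalSpace M] [ChartedSpace E4 M] [IsManifold (𝓡 4) ∞ M]
    [CompactSpace M] [T2Space M]
    [RiemannianBundle (fun x : M => TangentSpace (𝓡 4) x)]
    [IsContMDiffRiemannianBundle (𝓡 4) ∞ E4 (fun x : M => TangentSpace (𝓡 4) x)]
    {FB : Type*} [NormedAddCommGroup FB] [NormedSpace ℂ FB] [FiniteDimensional ℂ FB]
    {B : M → Type*} [TopologicalSpace (TotalSpace FB B)]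
    [∀ x, Ring (B x)] [∀ x, Algebra ℂ (B x)] [∀ x, StarRing (B x)] [∀ x, StarModule ℂ (B x)]
    [∀ x, TopologicalSpace (B x)] [∀ x, IsTopologicalAddGroup (B x)]
    [∀ x, ContinuousSMul ℝ (B x)] [FiberBundle FB B]
    [VectorBundle ℂ FB B] [VectorBundle ℝ FB B] [ContMDiffVectorBundle ∞ FB B (𝓡 4)]
    {FS : Type*} [NormedAddCommGroup FS] [NormedSpace ℂ FS] [FiniteDimensional ℂ FS]
    {S : M → Type*} [TopologicalSpace (TotalSpace FS S)]
    [∀ x, NormedAddCommGroup (S x)] [∀ x, InnerProductSpace ℂ (S x)] [FiberBundle FS S]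
    [VectorBundle ℂ FS S] [VectorBundle ℝ FS S] [ContMDiffVectorBundle ∞ FS S (𝓡 4)]
    (LC : CovariantDerivative (𝓡 4) E4 (fun x : M => TangentSpace (𝓡 4) x))
    (hLC : IsLeviCivita LC)
    (σ : SpinorStructure FS S)
    (nS : CovariantDerivative (𝓡 4) FS S) (hnS : IsSpinConnection LC σ nS)
    (N : ℕ) (hB : IsMatrixAlgebraBundle FB B N) (t : TracialState FB B)
    (nB : CovariantDerivative (𝓡 4) FB B) (hnB : IsHermitianStarAlgebraConnection t nB)
    (m : ℕ) (a b : Fin m → ∀ x, B x)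
    (ha : ∀ j x, SmoothSec FB (a j) x) (hb : ∀ j x, SmoothSec FB (b j) x)
    (hA : ∀ ξ η : (∀ x, B x ⊗[ℂ] S x),
      (∀ x, SmoothTensor FB FS ξ x) → (∀ x, SmoothTensor FB FS η x) →
      ∀ x, tensorInner t x (fluct σ nB nS a b ξ x) (η x)
        = tensorInner t x (ξ x) (fluct σ nB nS a b η x)) :
    IsLaplaceType FB FS (fun ξ => diracA σ nB nS a b (diracA σ nB nS a b ξ)) ∧
    ∃ (n : TensorConnection FB B FS S) (E : ∀ x, Module.End ℂ (B x ⊗[ℂ] S x)),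
      n.IsHermitian t ∧
      (∀ ξ x, SmoothTensor FB FS ξ x → SmoothTensor FB FS (fun y => E y (ξ y)) x) ∧
      (∀ ξ : (∀ x, B x ⊗[ℂ] S x), (∀ x, SmoothTensor FB FS ξ x) → ∀ x,
        diracA σ nB nS a b (diracA σ nB nS a b ξ) x = connLaplacian LC n ξ x - E x (ξ x)) ∧
      (∀ (n' : TensorConnection FB B FS S) (E' : ∀ x, Module.End ℂ (B x ⊗[ℂ] S x)),
        (∀ ξ x, SmoothTensor FB FS ξ x → SmoothTensor FB FS (fun y => E' y (ξ y)) x) →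
        (∀ ξ : (∀ x, B x ⊗[ℂ] S x), (∀ x, SmoothTensor FB FS ξ x) → ∀ x,
          diracA σ nB nS a b (diracA σ nB nS a b ξ) x = connLaplacian LC n' ξ x - E' x (ξ x)) →
        (∀ ξ : (∀ x, B x ⊗[ℂ] S x), (∀ x, SmoothTensor FB FS ξ x) → ∀ x,
          n'.toFun ξ x = n.toFun ξ x) ∧ E' = E) ∧
      (∀ (x : M) (e : OrthonormalBasis (Fin 4) ℝ (TangentSpace (𝓡 4) x)) (s : B x) (ψ : S x),
        E x (s ⊗ₜ[ℂ] ψ) =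
          -(1 / 4 : ℂ) • (scal LC x : ℂ) • (s ⊗ₜ[ℂ] ψ)
            - ∑ i, ∑ j ∈ Finset.Ioi i,
                curv FB (nablaPert nB a b) (e i) (e j) s ⊗ₜ[ℂ] σ.c x (e i) (σ.c x (e j) ψ)) ∧
      (∀ (X Y : ∀ x : M, TangentSpace (𝓡 4) x) (s : ∀ x, B x) (ψ : ∀ x, S x) (x : M)
        (e : OrthonormalBasis (Fin 4) ℝ (TangentSpace (𝓡 4) x)),
        SmoothVF X x → SmoothVF Y x → SmoothSec FB s x → SmoothSec FS ψ x →
        curvOp (fun ξ y v => n.toFun ξ y v) X Y (fun y => s y ⊗ₜ[ℂ] ψ y) x =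
          s x ⊗ₜ[ℂ] ((1 / 4 : ℂ) • ∑ i, ∑ j,
              (inner ℝ (riem LC (X x) (Y x) (e i)) (e j) : ℂ) •
                (1 / 2 : ℂ) • (σ.c x (e i) (σ.c x (e j) (ψ x)) - σ.c x (e j) (σ.c x (e i) (ψ x))))
            + curv FB (nablaPert nB a b) (X x) (Y x) (s x) ⊗ₜ[ℂ] ψ x)
 := by
  have h := isComplexConn_pertConn hnS hB hnB ha hb
  let E : ∀ x, Module.End ℂ (B x ⊗[ℂ] S x) := fun x =>
    weitzEnd hLC σ (isComplexConn_nablaPert hnB hB ha hb) (onb x)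
  have hE : ∀ {ξ x}, SmoothTensor FB FS ξ x → SmoothTensor FB FS (fun y => E y (ξ y)) x :=
    fun hξ => weitzEnd_smooth hLC hnS hB hnB ha hb hξ
  have hQ : ∀ {ξ : ∀ x, B x ⊗[ℂ] S x}, (∀ x, SmoothTensor FB FS ξ x) → ∀ x,
      diracA σ nB nS a b (diracA σ nB nS a b ξ) x
        = lap LC (pertConn nB nS a b) ξ x - E x (ξ x) :=
    fun hξ => diracA_sq_eq_lap hLC hnS hB hnB ha hb hA hξ
  refine ⟨isLaplaceType_lap hLC h hE hQ, h.toTensorConnection, E, ?_, fun _ _ hξ => hE hξ,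
    fun _ hξ => hQ hξ, ?_, ?_, ?_⟩
  · intro ξ η x v hξ hη
    exact tensorConn_hermitian hnS hB hnB ha hb hA hξ hη v
  · intro n' E' hE' hQ'
    have hQQ : ∀ {ξ : ∀ x, B x ⊗[ℂ] S x}, (∀ x, SmoothTensor FB FS ξ x) → ∀ x,
        lap LC (pertConn nB nS a b) ξ x - E x (ξ x)
          = lap LC (fun ξ y v => n'.toFun ξ y v) ξ x - E' x (ξ x) :=
      fun hξ x => (hQ hξ x).symm.trans (hQ' _ hξ x)
    exact ⟨fun ξ hξ x => LinearMap.ext fun v =>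
      conn_eq_of_lap_sub_eq hLC h n'.isComplexConn hQQ (hξ x) v,
      endo_eq_of_lap_sub_eq hLC h n'.isComplexConn hQQ⟩
  · intro x e s ψ
    simp only [E]
    -- `E` was defined with the basis `onb x`; independence of the basis gives the formula for every
    -- `e`.
    rw [weitzEnd_eq hLC hnS hB hnB ha hb (onb x) e, weitzEnd_tmul]
  · intro X Y s ψ x e hX hY hs hψ
    rw [← curvature_normal_form e (fun i j => riem_skew hLC _ _ _ _), add_comm]
    exact curvOp_pertConn_tmul hLC hnS hB hnB ha hb hX hY hs hψ e
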